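/- **Setting.** Consider an episodic two-player zero-sum Markov game with horizon $H\ge 1$, finite state space $\mathcal S=\mathcal S_1\times\mathcal S_2$, finite action sets $\mathcal A$ (Player 1) and $\mathcal B$ (Player 2), a fixed initial state $s_1=(s_1^1,s_1^2)$, mean rewards $r_h(s,a,b)\in[0,1]$, and unknown factored independent transitions $\mathcal P_h(s'\mid s,a,b)=\mathcal P^1_h(s^{1\prime}\mid s^1,a)\,\mathcal P^2_h(s^{2\prime}\mid s^2,b)$, $h\in[H]$. Policies have the form $\mu_h(a\mid s^1)$ for Player 1 and $\nu_h(b\mid s^2)$ for Player 2, and $V_1^{\mu,\nu}(s_1)$ is the expected sum of the rewards $r_h(s_h,a_h,b_h)$ over an episode. In episode $k=1,\dots,K$ Player 2 uses a policy $\nu^k$ that may depend arbitrarily (adversarially) on everything that happened in earlier episodes and on private randomness; Player 1 uses $\mu^k$; at each step the two actions are drawn simultaneously and independently from these policies given the past, the next state is drawn from $\mathcal P_h$, and a reward in $[0,1]$ with conditional mean $r_h(s^k_h,a^k_h,b^k_h)$ given the past and the current state and actions is observed (bandit feedback). The policy $\nu^{k-1}$ is revealed to Player 1 before episode $k$ (with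 $\nu^0$ an arbitrary policy). Player 1's regret is $\mathrm{Regret}_1(K)=\max_\mu\sum_{k=1}^K V_1^{\mu,\nu^k}(s_1)-\sum_{k=1}^K V_1^{\mu^k,\nu^k}(s_1)$, the maximum being over policies of the form $\mu_h(a\mid s^1)$. **Algorithm (Player 1), with parameters $\eta\ge 0$, $\delta\in(0,1)$.** For $k\ge1$ let $N_h^k(s,a,b)$, $N_h^k(s^1,a)$, $N_h^k(s^2,b)$ be the numbers of visits at step $h$ in episodes $1,\dots,k$; let $\hat r^k_h(s,a,b)$ be the sum of the rewards observed at step $h$ at $(s,a,b)$ in these episodes divided by $\max\{N_h^k(s,a,b),1\}$; let $\hat{\mathcal P}^{1,k}_h(s^{1\prime}\mid s^1,a)$ and $\hat{\mathcal P}^{2,k}_h(s^{2\prime}\mid s^2,b)$ be the numbers of observed transitions divided by $\max\{N_h^k(s^1,a),1\}$ and $\max\{N_h^k(s^2,b),1\}$; and let $\hat{\mathcal P}^k_h=\hat{\mathcal P}^{1,k}_h\hat{\mathcal P}^{2,k}_h$. The bonus is $$\beta_h^k(s,a,b)=\sqrt{\tfrac{4\log(|\mathcal S_1||\mathcal S_2||\mathcal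 A||\mathcal B|HK/\delta)}{\max\{N_h^k(s,a,b),1\}}}+\sqrt{\tfrac{2H^2|\mathcal S_1|\log(2|\mathcal S_1||\mathcal A|HK/\delta)}{\max\{N_h^k(s^1,a),1\}}}+\sqrt{\tfrac{2H^2|\mathcal S_2|\log(2|\mathcal S_2||\mathcal B|HK/\delta)}{\max\{N_h^k(s^2,b),1\}}}.$$ For $k=0$ the empirical transitions are uniform, $\hat r^0=\beta^0=0$, and $\mu^0_h(\cdot\mid s^1)$ is uniform on $\mathcal A$. Before episode $k+1$, $k\ge0$, Player 1 sets $\overline V^k_{H+1}=0$ and, for $h=H,\dots,1$, $\overline Q^k_h=\max\{0,\min\{\hat r^k_h+\hat{\mathcal P}^k_h\overline V^k_{h+1}+\beta^k_h,\,H-h+1\}\}$ and $\overline V^k_h(s)=\sum_{a,b}\mu^k_h(a\mid s^1)\overline Q^k_h(s,a,b)\nu^k_h(b\mid s^2)$; computes Player 2's empirical state-reaching probabilities by $d^k_1(s^2)=\mathbf 1\{s^2=s_1^2\}$, $d^k_{h+1}(s^2)=\sum_{s^{2\prime},b}d^k_h(s^{2\prime})\nu^k_h(b\mid s^{2\prime})\hat{\mathcal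 P}^{2,k}_h(s^2\mid s^{2\prime},b)$; and performs the KL mirror-ascent step $$\mu^{k+1}_h(a\mid s^1)\propto\mu^k_h(a\mid s^1)\exp\Big\{\eta\sum_{s^2}d^k_h(s^2)\sum_b\overline Q^k_h(s^1,s^2,a,b)\,\nu^k_h(b\mid s^2)\Big\}.$$ **Theorem 1.** There are universal constants $c>0$ and $p\in\mathbb N$ such that, for all such games, all $K\ge1$, all $\delta\in(0,1)$ and every Player 2 as above, if Player 1 runs this algorithm with $\eta=\sqrt{\log|\mathcal A|/(KH^2)}$, then with probability at least $1-4\delta$ $$\mathrm{Regret}_1(K)\le c\,\Big(1+\log\frac{|\mathcal S_1||\mathcal S_2||\mathcal A||\mathcal B|HK}{\delta}\Big)^{p}\,C\sqrt T,$$ that is, $\mathrm{Regret}_1(K)\le\tilde{\mathcal O}(C\sqrt T)$, where $T=KH$ and $C=\sqrt{(|\mathcal S_1|^2|\mathcal A|+|\mathcal S_2|^2|\mathcal B|)H^3}+\sqrt{|\mathcal S_1||\mathcal S_2||\mathcal A||\mathcal B|H}$. -/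

import Mathlib

open MeasureTheory ProbabilityTheory Finset
open scoped BigOperators

noncomputable section

namespace FactoredMG

/-- A (non-stationary, Markov, randomized) policy that reads only a state in `X`:
`π h x` is a probability distribution on the actions `U`, for every step `h` and state `x`. -/
def IsPolicy {H : ℕ} {X U : Type*} [Fintype U] (π : Fin H → X → U → ℝ) : Prop :=
  ∀ h x, π h x ∈ stdSimplex ℝ U

/-- An episodic two-player zero-sum Markov game of horizon `H` with state space `S₁ × S₂`,
factored independent transitions, mean rewards in `[0, 1]` and a fixed initial state.
Steps are numbered `0, …, H - 1`. -/
structure Game (H : ℕ) (S₁ S₂ A B : Type*) [Fintype S₁] [Fintype S₂] where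
  /-- `P₁ h x a x'` is the probability that Player 1's state moves from `x` to `x'`. -/
  P₁ : Fin H → S₁ → A → S₁ → ℝ
  /-- `P₂ h y b y'` is the probability that Player 2's state moves from `y` to `y'`. -/
  P₂ : Fin H → S₂ → B → S₂ → ℝ
  /-- The mean reward `r h x y a b`. -/
  r : Fin H → S₁ → S₂ → A → B → ℝ
  /-- Player 1's component of the initial state. -/
  init₁ : S₁
  /-- Player 2's component of the initial state. -/
  init₂ : S₂
  P₁_mem : ∀ h x a, P₁ h x a ∈ stdSimplex ℝ S₁
  P₂_mem : ∀ h y b, P₂ h y b ∈ stdSimplex ℝ S₂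
  r_mem : ∀ h x y a b, r h x y a b ∈ Set.Icc (0 : ℝ) 1

/-- The record of a whole run. Episodes are numbered from `1`; in each of them the states are
those at steps `0, …, H` and the actions and rewards those at steps `0, …, H - 1`.
`ν k` is Player 2's policy in episode `k` (`ν 0` is the one observed before the first episode). -/
structure Transcript (H : ℕ) (S₁ S₂ A B : Type*) where
  s₁ : ℕ → Fin (H + 1) → S₁
  s₂ : ℕ → Fin (H + 1) → S₂
  a : ℕ → Fin H → A
  b : ℕ → Fin H → B
  /-- The bandit reward observed at a step of an episode. -/
  reward : ℕ → Fin H → ℝ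
  ν : ℕ → Fin H → S₂ → B → ℝ

variable {H : ℕ} {S₁ S₂ A B : Type*} [Fintype S₁] [Fintype S₂] [Fintype A] [Fintype B]
  [DecidableEq S₁] [DecidableEq S₂] [DecidableEq A] [DecidableEq B]

/-! ### Values and regret -/

/-- The probability of the trajectory with Player 1's states `x`, Player 2's states `y` and
actions `a`, `b`, when the players follow `μ` and `ν` and the initial state is `(x₀, y₀)`. -/
def trajProb (G : Game H S₁ S₂ A B) (μ : Fin H → S₁ → A → ℝ) (ν : Fin H → S₂ → B → ℝ)
    (x₀ : S₁) (y₀ : S₂) (x : Fin (H + 1) → S₁) (y : Fin (H + 1) → S₂)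
    (a : Fin H → A) (b : Fin H → B) : ℝ :=
  (if x 0 = x₀ ∧ y 0 = y₀ then 1 else 0) *
    ∏ h : Fin H, μ h (x h.castSucc) (a h) * ν h (y h.castSucc) (b h) *
      (G.P₁ h (x h.castSucc) (a h) (x h.succ) * G.P₂ h (y h.castSucc) (b h) (y h.succ))

/-- The value `V₁^{μ,ν}(x₀, y₀)`: the expected total reward of an episode that starts from
`(x₀, y₀)`, the expectation being over the random trajectory. -/
def value (G : Game H S₁ S₂ A B) (μ : Fin H → S₁ → A → ℝ) (ν : Fin H → S₂ → B → ℝ)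
    (x₀ : S₁) (y₀ : S₂) : ℝ :=
  ∑ x : Fin (H + 1) → S₁, ∑ y : Fin (H + 1) → S₂, ∑ a : Fin H → A, ∑ b : Fin H → B,
    trajProb G μ ν x₀ y₀ x y a b *
      ∑ h : Fin H, G.r h (x h.castSucc) (y h.castSucc) (a h) (b h)

/-- Player 1's regret over episodes `1, …, K` against the best policy in hindsight (among the
policies of Player 1, which read only its own state), for the policy sequences `μ`, `ν`. -/
def regret (G : Game H S₁ S₂ A B) (K : ℕ) (μ : ℕ → Fin H → S₁ → A → ℝ)
    (ν : ℕ → Fin H → S₂ → B → ℝ) : ℝ :=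
  (⨆ μ' : {π : Fin H → S₁ → A → ℝ // IsPolicy π},
      ∑ k ∈ Icc 1 K, value G μ'.1 (ν k) G.init₁ G.init₂) -
    ∑ k ∈ Icc 1 K, value G (μ k) (ν k) G.init₁ G.init₂

/-- The best policy in hindsight exists: the supremum in `regret` is a maximum. -/
theorem exists_best_policy [Nonempty A] (G : Game H S₁ S₂ A B) (K : ℕ)
    (ν : ℕ → Fin H → S₂ → B → ℝ) :
    ∃ π : Fin H → S₁ → A → ℝ, IsPolicy π ∧ ∀ π' : Fin H → S₁ → A → ℝ, IsPolicy π' →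
      ∑ k ∈ Icc 1 K, value G π' (ν k) G.init₁ G.init₂ ≤
        ∑ k ∈ Icc 1 K, value G π (ν k) G.init₁ G.init₂ := by
  have hc : IsCompact (Set.univ.pi fun _ : Fin H => Set.univ.pi fun _ : S₁ => stdSimplex ℝ A) :=
    isCompact_univ_pi fun _ => isCompact_univ_pi fun _ => isCompact_stdSimplex ℝ A
  have hne : (Set.univ.pi fun _ : Fin H =>
      Set.univ.pi fun _ : S₁ => stdSimplex ℝ A).Nonempty := by
    obtain ⟨a⟩ := ‹Nonempty A›
    exact ⟨fun _ _ => Pi.single a 1, fun _ _ _ _ => single_mem_stdSimplex ℝ a⟩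
  have hcont : Continuous fun π : Fin H → S₁ → A → ℝ =>
      ∑ k ∈ Icc 1 K, value G π (ν k) G.init₁ G.init₂ := by
    unfold value trajProb
    fun_prop
  obtain ⟨π, hπ, hmax⟩ := hc.exists_isMaxOn hne hcont.continuousOn
  exact ⟨π, fun h x => hπ h trivial x trivial,
    fun π' hπ' => hmax (fun h _ x _ => hπ' h x)⟩

/-! ### Empirical estimates from episodes `1, …, k` -/

/-- The number of visits to `(x, y, a, b)` at step `h`. -/
def count (X : Transcript H S₁ S₂ A B) (k : ℕ) (h : Fin H) (x : S₁) (y : S₂) (a : A) (b : B) :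
    ℕ :=
  #{τ ∈ Icc 1 k | X.s₁ τ h.castSucc = x ∧ X.s₂ τ h.castSucc = y ∧ X.a τ h = a ∧ X.b τ h = b}

/-- The number of visits of Player 1 to `(x, a)` at step `h`. -/
def count₁ (X : Transcript H S₁ S₂ A B) (k : ℕ) (h : Fin H) (x : S₁) (a : A) : ℕ :=
  #{τ ∈ Icc 1 k | X.s₁ τ h.castSucc = x ∧ X.a τ h = a}

/-- The number of visits of Player 2 to `(y, b)` at step `h`. -/
def count₂ (X : Transcript H S₁ S₂ A B) (k : ℕ) (h : Fin H) (y : S₂) (b : B) : ℕ :=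
  #{τ ∈ Icc 1 k | X.s₂ τ h.castSucc = y ∧ X.b τ h = b}

/-- The empirical reward; it is `0` for `k = 0`. -/
def rHat (X : Transcript H S₁ S₂ A B) (k : ℕ) (h : Fin H) (x : S₁) (y : S₂) (a : A) (b : B) : ℝ :=
  (∑ τ ∈ Icc 1 k,
      if X.s₁ τ h.castSucc = x ∧ X.s₂ τ h.castSucc = y ∧ X.a τ h = a ∧ X.b τ h = b
      then X.reward τ h else 0) /
    max (count X k h x y a b : ℝ) 1

/-- The empirical transition of Player 1, uniform for `k = 0`. -/
def pHat₁ (X : Transcript H S₁ S₂ A B) (k : ℕ) (h : Fin H) (x : S₁) (a : A) (x' : S₁) : ℝ :=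
  if k = 0 then 1 / (Fintype.card S₁ : ℝ)
  else (#{τ ∈ Icc 1 k | X.s₁ τ h.castSucc = x ∧ X.a τ h = a ∧ X.s₁ τ h.succ = x'} : ℝ) /
    max (count₁ X k h x a : ℝ) 1

/-- The empirical transition of Player 2, uniform for `k = 0`. -/
def pHat₂ (X : Transcript H S₁ S₂ A B) (k : ℕ) (h : Fin H) (y : S₂) (b : B) (y' : S₂) : ℝ :=
  if k = 0 then 1 / (Fintype.card S₂ : ℝ)
  else (#{τ ∈ Icc 1 k | X.s₂ τ h.castSucc = y ∧ X.b τ h = b ∧ X.s₂ τ h.succ = y'} : ℝ) /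
    max (count₂ X k h y b : ℝ) 1

/-- The reward bonus. -/
def bonusR (δ : ℝ) (K : ℕ) (X : Transcript H S₁ S₂ A B) (k : ℕ) (h : Fin H)
    (x : S₁) (y : S₂) (a : A) (b : B) : ℝ :=
  √(4 * Real.log ((Fintype.card S₁ : ℝ) * Fintype.card S₂ * Fintype.card A * Fintype.card B *
      H * K / δ) / max (count X k h x y a b : ℝ) 1)

/-- The transition bonus. -/
def bonusP (δ : ℝ) (K : ℕ) (X : Transcript H S₁ S₂ A B) (k : ℕ) (h : Fin H)
    (x : S₁) (y : S₂) (a : A) (b : B) : ℝ :=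
  √(2 * (H : ℝ) ^ 2 * Fintype.card S₁ *
      Real.log (2 * (Fintype.card S₁ : ℝ) * Fintype.card A * H * K / δ) /
        max (count₁ X k h x a : ℝ) 1) +
  √(2 * (H : ℝ) ^ 2 * Fintype.card S₂ *
      Real.log (2 * (Fintype.card S₂ : ℝ) * Fintype.card B * H * K / δ) /
        max (count₂ X k h y b : ℝ) 1)

/-- The total bonus, `0` for `k = 0`. -/
def bonus (δ : ℝ) (K : ℕ) (X : Transcript H S₁ S₂ A B) (k : ℕ) (h : Fin H)
    (x : S₁) (y : S₂) (a : A) (b : B) : ℝ :=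
  if k = 0 then 0 else bonusR δ K X k h x y a b + bonusP δ K X k h x y a b

/-! ### The algorithm of Player 1 -/

/-- One step of optimistic policy evaluation: the Q-function at step `h` from the value function
`V` at step `h + 1`. With steps counted from `0` the truncation level is `H - h`. -/
def qStep (δ : ℝ) (K : ℕ) (X : Transcript H S₁ S₂ A B) (k : ℕ) (h : Fin H)
    (V : S₁ → S₂ → ℝ) (x : S₁) (y : S₂) (a : A) (b : B) : ℝ :=
  max (min (rHat X k h x y a b +
      ∑ x' : S₁, ∑ y' : S₂, pHat₁ X k h x a x' * pHat₂ X k h y b y' * V x' y' +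
      bonus δ K X k h x y a b) ((H : ℝ) - (h : ℝ))) 0

/-- The optimistic value functions at steps `0, …, H` for the policies `μ` and `X.ν k`, by
backward recursion from `0` at step `H`. -/
def vBar (δ : ℝ) (K : ℕ) (X : Transcript H S₁ S₂ A B) (k : ℕ) (μ : Fin H → S₁ → A → ℝ) :
    Fin (H + 1) → S₁ → S₂ → ℝ :=
  Fin.reverseInduction (motive := fun _ => S₁ → S₂ → ℝ) (fun _ _ => 0)
    (fun h V x y => ∑ a : A, ∑ b : B, μ h x a * qStep δ K X k h V x y a b * X.ν k h y b)

/-- The optimistic Q-functions for the policies `μ` and `X.ν k`. -/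
def qBar (δ : ℝ) (K : ℕ) (X : Transcript H S₁ S₂ A B) (k : ℕ) (μ : Fin H → S₁ → A → ℝ)
    (h : Fin H) : S₁ → S₂ → A → B → ℝ :=
  qStep δ K X k h (vBar δ K X k μ h.succ)

/-- The empirical reaching probability of Player 2's states at steps `0, …, H`, under the
policy `X.ν k` and the empirical transitions, from the initial state `y₀`. -/
def reach (X : Transcript H S₁ S₂ A B) (k : ℕ) (y₀ : S₂) : Fin (H + 1) → S₂ → ℝ :=
  Fin.induction (motive := fun _ => S₂ → ℝ) (fun y => if y = y₀ then 1 else 0)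
    (fun h d y => ∑ y' : S₂, ∑ b : B, d y' * X.ν k h y' b * pHat₂ X k h y' b y)

/-- The mirror ascent update of the distribution `p` in the direction `g` with step size `η`. -/
def mirrorStep (η : ℝ) (p g : A → ℝ) (a : A) : ℝ :=
  p a * Real.exp (η * g a) / ∑ a' : A, p a' * Real.exp (η * g a')

/-- The mirror ascent update solves the KL-regularized linear problem over the simplex. -/
theorem mirrorStep_isMaxOn {η : ℝ} (hη : 0 < η) {p : A → ℝ} (hp : p ∈ stdSimplex ℝ A)
    (hpos : ∀ a, 0 < p a) (g : A → ℝ) :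
    mirrorStep η p g ∈ stdSimplex ℝ A ∧
      IsMaxOn (fun q : A → ℝ => ∑ a, (q a - p a) * g a - η⁻¹ * ∑ a, q a * Real.log (q a / p a))
        (stdSimplex ℝ A) (mirrorStep η p g) := by
  have hA : Nonempty A := by
    by_contra h
    rw [not_nonempty_iff] at h
    simpa using hp.2
  set Y : ℝ := ∑ a' : A, p a' * Real.exp (η * g a') with hY
  have hYpos : 0 < Y := sum_pos (fun a _ => mul_pos (hpos a) (Real.exp_pos _)) univ_nonempty
  have hqpos : ∀ a, 0 < mirrorStep η p g a := fun a =>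
    div_pos (mul_pos (hpos a) (Real.exp_pos _)) hYpos
  have hqsum : ∑ a, mirrorStep η p g a = 1 := by
    simp only [mirrorStep, ← sum_div]
    exact div_self hYpos.ne'
  have key : ∀ q ∈ stdSimplex ℝ A,
      ∑ a, (q a - p a) * g a - η⁻¹ * ∑ a, q a * Real.log (q a / p a) =
        η⁻¹ * Real.log Y - ∑ a, p a * g a -
          η⁻¹ * ∑ a, q a * Real.log (q a / mirrorStep η p g a) := by
    intro q hq
    have h1 : ∀ a, q a * Real.log (q a / mirrorStep η p g a) =
        q a * Real.log (q a / p a) - η * (q a * g a) + q a * Real.log Y := by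
      intro a
      rcases (hq.1 a).eq_or_lt with h0 | h0
      · simp [← h0]
      · have : q a / mirrorStep η p g a = q a / p a * (Real.exp (η * g a))⁻¹ * Y := by
          have := hpos a
          have := Real.exp_pos (η * g a)
          simp only [mirrorStep, ← hY]
          field_simp
        rw [this, Real.log_mul (by have := hpos a; positivity) hYpos.ne',
          Real.log_mul (by have := hpos a; positivity) (by positivity), Real.log_inv, Real.log_exp]
        ring
    simp only [h1, sum_add_distrib, sum_sub_distrib, ← sum_mul, ← mul_sum, sub_mul, hq.2]
    field_simp
    ring
  have hmem : mirrorStep η p g ∈ stdSimplex ℝ A := ⟨fun a => (hqpos a).le, hqsum⟩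
  refine ⟨hmem, fun q hq => ?_⟩
  simp only [Set.mem_ofPred_eq]
  rw [key q hq, key _ hmem]
  have h2 : ∑ a, mirrorStep η p g a *
      Real.log (mirrorStep η p g a / mirrorStep η p g a) = 0 := by
    refine sum_eq_zero fun a _ => ?_
    rw [div_self (hqpos a).ne', Real.log_one, mul_zero]
  have h3 : 0 ≤ ∑ a, q a * Real.log (q a / mirrorStep η p g a) := by
    have : ∑ a, (q a - mirrorStep η p g a) ≤
        ∑ a, q a * Real.log (q a / mirrorStep η p g a) := by
      refine sum_le_sum fun a _ => ?_
      rcases (hq.1 a).eq_or_lt with h0 | h0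
      · rw [← h0]
        simpa using (hqpos a).le
      · have h4 := Real.one_sub_inv_le_log_of_pos (div_pos h0 (hqpos a))
        have h5 := mul_le_mul_of_nonneg_left h4 h0.le
        refine le_trans (le_of_eq ?_) h5
        field_simp
    rw [sum_sub_distrib, hq.2, hqsum, sub_self] at this
    exact this
  rw [h2]
  have := mul_nonneg (inv_nonneg.2 hη.le) h3
  linarith

/-- The policies `μ⁰, μ¹, μ², …` of Player 1: `μ⁰` is uniform, and the policy of episode `k + 1`
is computed from the data of the episodes `1, …, k` and the policies of episode `k`. -/
def policy (η δ : ℝ) (K : ℕ) (y₀ : S₂) (X : Transcript H S₁ S₂ A B) : ℕ → Fin H → S₁ → A → ℝ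
  | 0 => fun _ _ _ => 1 / (Fintype.card A : ℝ)
  | k + 1 => fun h x => mirrorStep η (policy η δ K y₀ X k h x) fun a =>
      ∑ y : S₂, (∑ b : B, qBar δ K X k (policy η δ K y₀ X k) h x y a b * X.ν k h y b) *
        reach X k y₀ h.castSucc y

/-! ### The interaction -/

/-- The random transcript `X` is a play of `K` episodes of the game `G` in which Player 1 runs the
algorithm and Player 2 is arbitrary. The filtration is the information available over time: with
`t = k * H + h`, time `2 * t` is just before the actions of step `h` of episode `k`, and time
`2 * t + 1` is just after the actions and before the reward and the next state. Since `ℱ` is any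
filtration to which the play is adapted, Player 2 may choose the policy of each episode from the
whole past and from private randomness. -/
structure IsPlay {Ω : Type*} {mΩ : MeasurableSpace Ω} (Pr : Measure Ω) (ℱ : Filtration ℕ mΩ)
    (G : Game H S₁ S₂ A B) (η δ : ℝ) (K : ℕ) (X : Ω → Transcript H S₁ S₂ A B) : Prop where
  ν_policy : ∀ k ≤ K, ∀ ω, IsPolicy ((X ω).ν k)
  ν_meas : ∀ k ≤ K, Measurable[ℱ (2 * (k * H))] fun ω => (X ω).ν k
  s_init : ∀ k ∈ Icc 1 K, ∀ ω, (X ω).s₁ k 0 = G.init₁ ∧ (X ω).s₂ k 0 = G.init₂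
  s_meas : ∀ k ∈ Icc 1 K, ∀ (h : Fin (H + 1)) (x : S₁) (y : S₂),
    MeasurableSet[ℱ (2 * (k * H + h))] {ω | (X ω).s₁ k h = x ∧ (X ω).s₂ k h = y}
  ab_meas : ∀ k ∈ Icc 1 K, ∀ (h : Fin H) (a : A) (b : B),
    MeasurableSet[ℱ (2 * (k * H + h) + 1)] {ω | (X ω).a k h = a ∧ (X ω).b k h = b}
  reward_meas : ∀ k ∈ Icc 1 K, ∀ h : Fin H,
    Measurable[ℱ (2 * (k * H + h + 1))] fun ω => (X ω).reward k h
  reward_mem : ∀ k ∈ Icc 1 K, ∀ (h : Fin H) (ω : Ω), (X ω).reward k h ∈ Set.Icc (0 : ℝ) 1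
  /-- The players draw their actions simultaneously from their policies. -/
  ab_law : ∀ k ∈ Icc 1 K, ∀ (h : Fin H) (a : A) (b : B),
    Pr⟦{ω | (X ω).a k h = a ∧ (X ω).b k h = b} | ℱ (2 * (k * H + h))⟧ =ᵐ[Pr] fun ω =>
      policy η δ K G.init₂ (X ω) k h ((X ω).s₁ k h.castSucc) a *
        (X ω).ν k h ((X ω).s₂ k h.castSucc) b
  /-- The next state is drawn from the factored transition. -/
  s_law : ∀ k ∈ Icc 1 K, ∀ (h : Fin H) (x' : S₁) (y' : S₂),
    Pr⟦{ω | (X ω).s₁ k h.succ = x' ∧ (X ω).s₂ k h.succ = y'} | ℱ (2 * (k * H + h) + 1)⟧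
      =ᵐ[Pr] fun ω => G.P₁ h ((X ω).s₁ k h.castSucc) ((X ω).a k h) x' *
        G.P₂ h ((X ω).s₂ k h.castSucc) ((X ω).b k h) y'
  /-- The observed reward has conditional mean `r`. -/
  reward_mean : ∀ k ∈ Icc 1 K, ∀ h : Fin H,
    Pr[fun ω => (X ω).reward k h | ℱ (2 * (k * H + h) + 1)] =ᵐ[Pr] fun ω =>
      G.r h ((X ω).s₁ k h.castSucc) ((X ω).s₂ k h.castSucc) ((X ω).a k h) ((X ω).b k h)

end FactoredMG

end

open FactoredMG

/-!
The regret of an episode is the gap between the comparator `π` and the policy `μ` that is played,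
both against Player 2's policy `ν` of the same episode. Two models of the transitions are used: the
true one `P₁ ⊗ P₂`, and the hybrid `P₁ ⊗ P̂₂` of Player 1's true and Player 2's empirical
transitions.

* Passing from the true to the hybrid model changes the value of `π` by at most the expected bonus
  of Player 2's transitions (`total_le_total_add`). This cost does not depend on `π`, because Player
  2's states evolve independently of Player 1 (`total_joint_snd`). Comparing values of the two
  models, rather than their occupancy measures one step at a time, saves a factor of the horizon.
* On the event that all estimates lie within their bonuses, the optimistic `Q̄` dominates the
  one-step lookahead of `V̄` in the hybrid model and exceeds the true lookahead by at most twice the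
  bonus (`Accurate.le_qBar`, `Accurate.qBar_le`). In the hybrid model Player 2's state distribution
  is exactly the `reach` of the algorithm, so the value difference identity `total_sub_eq` bounds
  the comparator's hybrid value minus `V̄` by the quantity that mirror ascent controls, weighted with
  Player 1's occupancy measure under the fixed `π` (`Accurate.total_hybrid_le`). Exponential weights
  then lose at most `O(H √(K log |A|))` at each step of the episode (`mirrorStep_regret_tuned`).
* The excess of `V̄` over the true value of `μ` is at most twice the bonus expected under `μ` and `ν`.

Hence the regret is at most that of mirror ascent plus three times the bonuses expected under the
policies of each episode (`regret_le_of_accurate`). The bonuses computed from the earlier episodes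
are predictable, so their expectations are close to the realized bonuses by Azuma's inequality
(`IsPlay.prob_expectedBonus_gt_le`), and the latter add up by the pigeonhole principle
(`sum_fullBonus_le`).

The estimates are accurate with high probability by exponential supermartingales. Conditional means
enter through integration against bounded measurable functions (`HasCondMean`), which allows an
arbitrary probability space. The random number `n` of visits is handled by a sum that stops after
`n` visits (`prob_visits_ge_le`), so that the union bound runs over `n` only, and the `ℓ¹` distance
of transition probabilities is a maximum over signs (`prob_l1_deviation_le`). Each of the four
events (rewards, the two transitions, Azuma) fails with probability at most `δ`.
-/

noncomputable section

namespace FactoredMG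

set_option linter.unusedSectionVars false

/-! ### Hoeffding's inequality for a bounded variable -/

/-- The chord bound for the convex function `v ↦ exp (t * v)` on `[-1, 1]`. -/
theorem exp_mul_le_cosh_add {v : ℝ} (hv : |v| ≤ 1) (t : ℝ) :
    Real.exp (t * v) ≤ Real.cosh t + v * Real.sinh t := by
  obtain ⟨h1, h2⟩ := abs_le.1 hv
  have h := convexOn_exp.2 (Set.mem_univ t) (Set.mem_univ (-t))
    (by linarith : 0 ≤ (1 + v) / 2) (by linarith : 0 ≤ (1 - v) / 2) (by ring)
  simp only [smul_eq_mul] at h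
  rw [Real.cosh_eq, Real.sinh_eq]
  calc Real.exp (t * v) = Real.exp ((1 + v) / 2 * t + (1 - v) / 2 * -t) := by congr 1; ring
    _ ≤ _ := h
    _ = _ := by ring

/-- Hoeffding's lemma for a variable on `{-1, 1}` with mean `m`. -/
theorem cosh_add_mul_sinh_le {m : ℝ} (hm : |m| ≤ 1) (t : ℝ) :
    Real.cosh t + m * Real.sinh t ≤ Real.exp (t * m + t ^ 2 / 2) := by
  obtain ⟨h1, h2⟩ := abs_le.1 hm
  have hp : 0 ≤ (1 + m) / 2 := by linarith
  have hq : 0 ≤ (1 - m) / 2 := by linarith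
  set P : Measure ℝ := ENNReal.ofReal ((1 + m) / 2) • Measure.dirac 1 +
    ENNReal.ofReal ((1 - m) / 2) • Measure.dirac (-1) with hP
  have : IsProbabilityMeasure P := ⟨by
    simp only [hP, Measure.add_apply, Measure.smul_apply, measure_univ, smul_eq_mul, mul_one]
    rw [← ENNReal.ofReal_add hp hq, show (1 + m) / 2 + (1 - m) / 2 = 1 by ring,
      ENNReal.ofReal_one]⟩
  have hint : ∀ f : ℝ → ℝ, ∫ x, f x ∂P = (1 + m) / 2 * f 1 + (1 - m) / 2 * f (-1) := by
    intro f
    rw [hP, integral_add_measure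
      ((integrable_dirac (by simp)).smul_measure (by simp))
      ((integrable_dirac (by simp)).smul_measure (by simp))]
    simp [ENNReal.toReal_ofReal hp, ENNReal.toReal_ofReal hq]
  have hmean : P[fun x : ℝ => x] = m := by rw [hint]; ring
  have h := (hasSubgaussianMGF_of_mem_Icc (μ := P) (X := fun x : ℝ => x) (a := -1) (b := 1)
    aemeasurable_id (by
      have hm' : MeasurableSet {x : ℝ | x ∈ Set.Icc (-1 : ℝ) 1} := measurableSet_Icc
      rw [hP, ae_add_measure_iff]
      constructor <;> refine Measure.ae_smul_measure ?_ _ <;> rw [ae_dirac_iff hm'] <;>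
        norm_num)).mgf_le t
  have hc : (((‖(1 : ℝ) - -1‖₊ / 2) ^ 2 : NNReal) : ℝ) = 1 := by
    norm_num [coe_nnnorm]
  rw [mgf, hint, hmean, hc] at h
  rw [add_comm (t * m), Real.exp_add]
  have h3 := mul_le_mul_of_nonneg_right h (Real.exp_pos (t * m)).le
  refine le_trans (le_of_eq ?_) (h3.trans (le_of_eq ?_))
  · rw [add_mul, mul_assoc, mul_assoc, ← Real.exp_add, ← Real.exp_add, Real.cosh_eq, Real.sinh_eq]
    ring_nf
  · ring_nf

/-! ### Mirror ascent -/

section Hedge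

variable {A : Type*} [Fintype A]

theorem mirrorStep_pos [Nonempty A] {η : ℝ} {p : A → ℝ} (hp : ∀ a, 0 < p a) (g : A → ℝ) (a : A) :
    0 < mirrorStep η p g a :=
  div_pos (mul_pos (hp a) (Real.exp_pos _))
    (sum_pos (fun a _ => mul_pos (hp a) (Real.exp_pos _)) univ_nonempty)

theorem mirrorStep_sum [Nonempty A] {η : ℝ} {p : A → ℝ} (hp : ∀ a, 0 < p a) (g : A → ℝ) :
    ∑ a, mirrorStep η p g a = 1 := by
  simp only [mirrorStep, ← sum_div]
  exact div_self (sum_pos (fun a _ => mul_pos (hp a) (Real.exp_pos _)) univ_nonempty).ne'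

theorem sum_mul_mem_Icc {ι : Type*} [Fintype ι] {p g : ι → ℝ} {R : ℝ} (hp : p ∈ stdSimplex ℝ ι)
    (hg : ∀ a, g a ∈ Set.Icc 0 R) : ∑ a, p a * g a ∈ Set.Icc 0 R := by
  refine ⟨sum_nonneg fun a _ => mul_nonneg (hp.1 a) (hg a).1, ?_⟩
  calc ∑ a, p a * g a ≤ ∑ a, p a * R :=
        sum_le_sum fun a _ => mul_le_mul_of_nonneg_left (hg a).2 (hp.1 a)
    _ = R := by rw [← sum_mul, hp.2, one_mul]

/-- One step of mirror ascent: the gain of a comparator `q` over `p` is paid for by the increase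
of `∑ a, q a * log (p a)`. -/
theorem mirrorStep_gain [Nonempty A] {η R : ℝ} (hR : 0 < R) {p g q : A → ℝ} (hpos : ∀ a, 0 < p a)
    (hp : p ∈ stdSimplex ℝ A) (hq : q ∈ stdSimplex ℝ A) (hg : ∀ a, g a ∈ Set.Icc 0 R) :
    η * ∑ a, (q a - p a) * g a ≤
      ∑ a, q a * Real.log (mirrorStep η p g a) - ∑ a, q a * Real.log (p a) +
        η ^ 2 * R ^ 2 / 2 := by
  set Y : ℝ := ∑ a' : A, p a' * Real.exp (η * g a') with hY
  have hYpos : 0 < Y := sum_pos (fun a _ => mul_pos (hpos a) (Real.exp_pos _)) univ_nonempty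
  obtain ⟨hm0, hm1⟩ := sum_mul_mem_Icc hp hg
  set m : ℝ := ∑ a, p a * g a with hm
  have hYle : Y ≤ Real.exp (η * m + (η * R) ^ 2 / 2) := by
    calc Y ≤ ∑ a, p a * (Real.cosh (η * R) + g a / R * Real.sinh (η * R)) := by
          refine sum_le_sum fun a _ => mul_le_mul_of_nonneg_left ?_ (hp.1 a)
          have := exp_mul_le_cosh_add (v := g a / R) (by
            rw [abs_of_nonneg (div_nonneg (hg a).1 hR.le)]
            exact div_le_one_of_le₀ (hg a).2 hR.le) (η * R)
          rwa [show η * R * (g a / R) = η * g a by field_simp] at this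
      _ = Real.cosh (η * R) + m / R * Real.sinh (η * R) := by
          simp only [mul_add, sum_add_distrib, ← sum_mul, hp.2, ← mul_assoc, one_mul]
          simp only [hm, sum_div, mul_div_assoc]
      _ ≤ Real.exp (η * R * (m / R) + (η * R) ^ 2 / 2) := cosh_add_mul_sinh_le (by
            rw [abs_of_nonneg (div_nonneg hm0 hR.le)]
            exact div_le_one_of_le₀ hm1 hR.le) _
      _ = _ := by rw [show η * R * (m / R) = η * m by field_simp]
  have hlog : Real.log Y ≤ η * m + (η * R) ^ 2 / 2 := by
    rw [← Real.log_exp (η * m + (η * R) ^ 2 / 2)]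
    exact Real.log_le_log hYpos hYle
  have h1 : ∀ a, q a * Real.log (mirrorStep η p g a) =
      q a * Real.log (p a) + η * (q a * g a) - q a * Real.log Y := by
    intro a
    rw [mirrorStep, ← hY, Real.log_div (mul_pos (hpos a) (Real.exp_pos _)).ne' hYpos.ne',
      Real.log_mul (hpos a).ne' (Real.exp_pos _).ne', Real.log_exp]
    ring
  simp only [h1, sum_sub_distrib, sum_add_distrib, ← sum_mul, hq.2, ← mul_sum, sub_mul]
  rw [← hm]
  nlinarith

/-- The regret bound of exponential weights from the uniform distribution, for the gains
`g 0, …, g K`. -/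
theorem mirrorStep_regret [Nonempty A] {η R : ℝ} (hR : 0 < R) (p g : ℕ → A → ℝ)
    (hp0 : p 0 = fun _ => 1 / (Fintype.card A : ℝ))
    (hp : ∀ k, p (k + 1) = mirrorStep η (p k) (g k))
    {K : ℕ} (hg : ∀ k ≤ K, ∀ a, g k a ∈ Set.Icc 0 R) {q : A → ℝ} (hq : q ∈ stdSimplex ℝ A) :
    η * ∑ k ∈ range (K + 1), ∑ a, (q a - p k a) * g k a ≤
      Real.log (Fintype.card A) + (K + 1) * (η ^ 2 * R ^ 2 / 2) := by
  have hcard : (0 : ℝ) < Fintype.card A := by exact_mod_cast Fintype.card_pos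
  have hpos : ∀ k a, 0 < p k a := by
    intro k
    induction k with
    | zero => intro a; rw [hp0]; positivity
    | succ k ih => intro a; rw [hp]; exact mirrorStep_pos ih _ a
  have hsum : ∀ k, ∑ a, p k a = 1 := by
    rintro (_ | k)
    · rw [hp0]; simp
    · rw [hp]; exact mirrorStep_sum (hpos k) _
  have key : ∀ n ≤ K + 1, η * ∑ k ∈ range n, ∑ a, (q a - p k a) * g k a ≤
      ∑ a, q a * Real.log (p n a) - ∑ a, q a * Real.log (p 0 a) +
        n * (η ^ 2 * R ^ 2 / 2) := by
    intro n hn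
    induction n with
    | zero => simp
    | succ n ih =>
      have ih := ih (by omega)
      have h := mirrorStep_gain (η := η) hR (hpos n) ⟨fun a => (hpos n a).le, hsum n⟩ hq
        (hg n (by omega))
      rw [← hp] at h
      rw [sum_range_succ, mul_add]
      push_cast
      linarith
  refine (key (K + 1) le_rfl).trans ?_
  have h1 : ∑ a, q a * Real.log (p (K + 1) a) ≤ 0 := by
    refine sum_nonpos fun a _ => mul_nonpos_of_nonneg_of_nonpos (hq.1 a) ?_
    refine Real.log_nonpos (hpos _ a).le ?_
    rw [← hsum (K + 1)]
    exact single_le_sum (f := p (K + 1)) (fun a _ => (hpos _ a).le) (mem_univ a)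
  have h2 : ∑ a, q a * Real.log (p 0 a) = -Real.log (Fintype.card A) := by
    rw [hp0]
    simp [← sum_mul, hq.2]
  rw [h2]
  push_cast
  linarith

/-- The regret of exponential weights with the tuned step size over the rounds `1, …, K`; the
round `0` contributes the term `R`. -/
theorem mirrorStep_regret_tuned [Nonempty A] {η R : ℝ} {K : ℕ} (hK : 1 ≤ K) (hR : 0 < R)
    (hη : η = √(Real.log (Fintype.card A) / (K * R ^ 2))) (p g : ℕ → A → ℝ)
    (hp0 : p 0 = fun _ => 1 / (Fintype.card A : ℝ))
    (hp : ∀ k, p (k + 1) = mirrorStep η (p k) (g k))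
    (hpm : ∀ k, p k ∈ stdSimplex ℝ A)
    (hg : ∀ k ≤ K, ∀ a, g k a ∈ Set.Icc 0 R) {q : A → ℝ} (hq : q ∈ stdSimplex ℝ A) :
    ∑ k ∈ Icc 1 K, ∑ a, (q a - p k a) * g k a ≤
      2 * R * √(K * Real.log (Fintype.card A)) + R := by
  have hK' : (1 : ℝ) ≤ K := by exact_mod_cast hK
  -- With a single action `η = 0`, and there is nothing to choose.
  rcases (Fintype.card_pos (α := A)).nat_succ_le.eq_or_lt with h1 | h1
  · have : Unique A := (Fintype.card_eq_one_iff_nonempty_unique.1 h1.symm).some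
    have hone : ∀ r : A → ℝ, r ∈ stdSimplex ℝ A → ∀ a, r a = 1 := fun r hr a => by
      have := hr.2
      rwa [Fintype.sum_unique, Subsingleton.elim default a] at this
    rw [sum_eq_zero fun k _ => sum_eq_zero fun a _ => by rw [hone q hq, hone _ (hpm k)]; ring]
    positivity
  have hlog : 0 < Real.log (Fintype.card A) := Real.log_pos (by exact_mod_cast h1)
  set l := Real.log (Fintype.card A) with hl
  have hηpos : 0 < η := by rw [hη]; positivity
  have hη2 : η ^ 2 * R ^ 2 = l / K := by
    rw [hη, Real.sq_sqrt (by positivity)]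
    field_simp
  have h2 := mirrorStep_regret (η := η) hR p g hp0 hp hg hq
  rw [hη2, ← hl] at h2
  have h3 : (K + 1) * (l / K / 2) ≤ l := by
    rw [div_div, mul_div_assoc', div_le_iff₀ (by positivity)]
    nlinarith
  have h4 : η * (R * √(K * l)) = l := by
    rw [hη, Real.sqrt_div hlog.le, Real.sqrt_mul (by positivity), Real.sqrt_mul (by positivity),
      Real.sqrt_sq hR.le]
    have h5 : 0 < √(K : ℝ) := Real.sqrt_pos.2 (by linarith)
    have h6 := Real.mul_self_sqrt hlog.le
    field_simp
    nlinarith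
  have h7 : ∑ k ∈ range (K + 1), ∑ a, (q a - p k a) * g k a ≤ 2 * R * √(K * l) := by
    refine le_of_mul_le_mul_left ?_ hηpos
    calc _ ≤ l + (K + 1) * (l / K / 2) := h2
      _ ≤ 2 * (η * (R * √(K * l))) := by rw [h4]; linarith
      _ = _ := by ring
  have h8 : -R ≤ ∑ a, (q a - p 0 a) * g 0 a := by
    have h9 := (sum_mul_mem_Icc hq (hg 0 (by omega))).1
    have h10 := (sum_mul_mem_Icc (hpm 0) (hg 0 (by omega))).2
    simp only [sub_mul, sum_sub_distrib]
    linarith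
  have h11 : ∑ k ∈ range (K + 1), ∑ a, (q a - p k a) * g k a =
      ∑ a, (q a - p 0 a) * g 0 a + ∑ k ∈ Icc 1 K, ∑ a, (q a - p k a) * g k a := by
    rw [sum_range_eq_add_Ico _ (by omega)]
    rfl
  linarith

end Hedge

/-! ### Summing bonuses along visits -/

/-- The pigeonhole bound: along any sequence in a finite type, the inverse square roots of the
numbers of earlier visits to the current point add up to at most `3 √(|Z| K)`. -/
theorem sum_inv_sqrt_visits_le {Z : Type*} [Fintype Z] [DecidableEq Z] (z : ℕ → Z) (K : ℕ) :
    ∑ k ∈ Icc 1 K, 1 / √(max (#{τ ∈ Icc 1 (k - 1) | z τ = z k} : ℝ) 1) ≤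
      3 * √((Fintype.card Z : ℝ) * K) := by
  -- The potential is `3 * ∑ x, √(N k x)`, where `N k x` counts the visits to `x` up to time `k`.
  set N : ℕ → Z → ℕ := fun k x => #{τ ∈ Icc 1 k | z τ = x} with hN
  have hsucc : ∀ k x, N (k + 1) x = N k x + if z (k + 1) = x then 1 else 0 := by
    intro k x
    simp only [hN, ← Finset.insert_Icc_right_eq_Icc_add_one (by omega : 1 ≤ k + 1), filter_insert]
    split_ifs with h
    · rw [card_insert_of_notMem (by simp)]
    · simp
  have hstep : ∀ n : ℕ, 1 / √(max (n : ℝ) 1) ≤ 3 * (√(n + 1 : ℝ) - √n) := by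
    intro n
    rcases Nat.eq_zero_or_pos n with rfl | hn
    · norm_num
    · have hn1 : (1 : ℝ) ≤ n := by exact_mod_cast hn
      rw [max_eq_left hn1]
      have h1 : 0 < √(n : ℝ) := Real.sqrt_pos.2 (by linarith)
      have h2 : √(n : ℝ) ^ 2 = n := Real.sq_sqrt (by linarith)
      have h3 : √(n + 1 : ℝ) ^ 2 = n + 1 := Real.sq_sqrt (by linarith)
      have h4 : √(n + 1 : ℝ) ≤ 2 * √n := by
        rw [Real.sqrt_le_left (by positivity)]
        nlinarith
      rw [div_le_iff₀ h1]
      have h5 : (√(n + 1 : ℝ) - √n) * (√(n + 1 : ℝ) + √n) = 1 := by nlinarith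
      have h6 : 0 ≤ √(n + 1 : ℝ) - √n := sub_nonneg.2 (Real.sqrt_le_sqrt (by linarith))
      nlinarith
  have key : ∀ K, ∑ k ∈ Icc 1 K, 1 / √(max (N (k - 1) (z k) : ℝ) 1) ≤
      3 * ∑ x, √(N K x : ℝ) := by
    intro K
    induction K with
    | zero => simp [hN]
    | succ K ih =>
      rw [sum_Icc_succ_top (by omega)]
      have h : ∑ x, √(N (K + 1) x : ℝ) =
          ∑ x, √(N K x : ℝ) + (√(N K (z (K + 1)) + 1 : ℝ) - √(N K (z (K + 1)))) := by
        rw [← sub_eq_iff_eq_add', ← sum_sub_distrib, sum_eq_single (z (K + 1))]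
        · simp [hsucc]
        · intro x _ hx
          simp [hsucc, Ne.symm hx]
        · simp
      have := hstep (N K (z (K + 1)))
      rw [h]
      simp only [Nat.add_sub_cancel]
      linarith
  refine (key K).trans (mul_le_mul_of_nonneg_left ?_ (by norm_num))
  have hcs := Finset.sum_mul_sq_le_sq_mul_sq univ (fun _ : Z => (1 : ℝ)) (fun x => √(N K x : ℝ))
  have htot : ∑ x, (N K x : ℝ) = K := by
    have := Finset.card_eq_sum_card_fiberwise (s := Icc 1 K) (t := univ) (f := z) (by simp)
    rw [Nat.card_Icc, Nat.add_sub_cancel] at this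
    exact_mod_cast this.symm
  refine Real.le_sqrt_of_sq_le ?_
  simpa [Real.sq_sqrt, htot] using hcs

/-! ### Occupancy measures -/

section Flow

variable {H : ℕ} {Z U : Type*} [Fintype Z] [Fintype U]

/-- The occupancy measures at steps `0, …, H` of the chain with initial weights `w`, policy `π`
and transition kernel `p`; neither is required to be normalized. `FactoredMG.reach` is the case
of Player 2's empirical model. -/
def flow (w : Z → ℝ) (π : Fin H → Z → U → ℝ) (p : Fin H → Z → U → Z → ℝ) : Fin (H + 1) → Z → ℝ :=
  Fin.induction (motive := fun _ => Z → ℝ) w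
    (fun h d z => ∑ z' : Z, ∑ u : U, d z' * π h z' u * p h z' u z)

@[simp] theorem flow_zero (w : Z → ℝ) (π : Fin H → Z → U → ℝ) (p : Fin H → Z → U → Z → ℝ) :
    flow w π p 0 = w := rfl

theorem flow_succ (w : Z → ℝ) (π : Fin H → Z → U → ℝ) (p : Fin H → Z → U → Z → ℝ) (h : Fin H)
    (z : Z) :
    flow w π p h.succ z = ∑ z', ∑ u, flow w π p h.castSucc z' * π h z' u * p h z' u z := by
  simp [flow, Fin.induction_succ]

/-- The expected sum of `f` along the chain. -/
def total (w : Z → ℝ) (π : Fin H → Z → U → ℝ) (p : Fin H → Z → U → Z → ℝ)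
    (f : Fin H → Z → U → ℝ) : ℝ :=
  ∑ h : Fin H, ∑ z, flow w π p h.castSucc z * ∑ u, π h z u * f h z u

/-- A kernel whose rows are nonnegative and sum to at most one. Empirical transitions are of this
kind: the rows of unvisited pairs vanish. -/
def IsSubkernel (p : Fin H → Z → U → Z → ℝ) : Prop :=
  ∀ h z u, (∀ z', 0 ≤ p h z u z') ∧ ∑ z', p h z u z' ≤ 1

theorem flow_nonneg {w : Z → ℝ} {π : Fin H → Z → U → ℝ} {p : Fin H → Z → U → Z → ℝ}
    (hw : ∀ z, 0 ≤ w z) (hπ : IsPolicy π) (hp : IsSubkernel p) (h : Fin (H + 1)) (z : Z) :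
    0 ≤ flow w π p h z := by
  induction h using Fin.induction generalizing z with
  | zero => exact hw z
  | succ h ih =>
    rw [flow_succ]
    exact sum_nonneg fun z' _ => sum_nonneg fun u _ =>
      mul_nonneg (mul_nonneg (ih z') ((hπ h z').1 u)) ((hp h z' u).1 z)

/-- Advancing a test function by one step of the chain. -/
theorem sum_flow_succ_mul (w : Z → ℝ) (π : Fin H → Z → U → ℝ) (p : Fin H → Z → U → Z → ℝ)
    (h : Fin H) (V : Z → ℝ) :
    ∑ z, flow w π p h.succ z * V z =
      ∑ z, flow w π p h.castSucc z * ∑ u, π h z u * ∑ z', p h z u z' * V z' := by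
  simp only [flow_succ, sum_mul, mul_sum]
  rw [sum_comm]
  refine sum_congr rfl fun z _ => ?_
  rw [sum_comm]
  exact sum_congr rfl fun u _ => sum_congr rfl fun z' _ => by ring

theorem sum_flow_le {w : Z → ℝ} {π : Fin H → Z → U → ℝ} {p : Fin H → Z → U → Z → ℝ}
    (hw : ∀ z, 0 ≤ w z) (hπ : IsPolicy π) (hp : IsSubkernel p) (h : Fin (H + 1)) :
    ∑ z, flow w π p h z ≤ ∑ z, w z := by
  induction h using Fin.induction with
  | zero => exact le_rfl
  | succ h ih =>
    refine le_trans ?_ ih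
    have := sum_flow_succ_mul w π p h fun _ => 1
    simp only [mul_one] at this
    rw [this]
    refine sum_le_sum fun z _ => mul_le_of_le_one_right (flow_nonneg hw hπ hp _ z) ?_
    rw [← (hπ h z).2]
    exact sum_le_sum fun u _ => mul_le_of_le_one_right ((hπ h z).1 u) (hp h z u).2

theorem sum_flow_eq {w : Z → ℝ} {π : Fin H → Z → U → ℝ} {p : Fin H → Z → U → Z → ℝ}
    (hπ : IsPolicy π) (hp : ∀ h z u, p h z u ∈ stdSimplex ℝ Z) (h : Fin (H + 1)) :
    ∑ z, flow w π p h z = ∑ z, w z := by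
  induction h using Fin.induction with
  | zero => rfl
  | succ h ih =>
    rw [← ih]
    have := sum_flow_succ_mul w π p h fun _ => 1
    simp only [mul_one, (hp h _ _).2, (hπ h _).2] at this
    exact this

/-- The value difference identity: the total of `f` exceeds the initial value of any `V` that
vanishes at the end by the accumulated Bellman errors of `V`. -/
theorem total_sub_eq (w : Z → ℝ) (π : Fin H → Z → U → ℝ) (p : Fin H → Z → U → Z → ℝ)
    (f : Fin H → Z → U → ℝ) {V : Fin (H + 1) → Z → ℝ} (hV : ∀ z, V (Fin.last H) z = 0) :
    total w π p f - ∑ z, w z * V 0 z =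
      ∑ h : Fin H, ∑ z, flow w π p h.castSucc z *
        (∑ u, π h z u * (f h z u + ∑ z', p h z u z' * V h.succ z') - V h.castSucc z) := by
  have h1 : ∑ h : Fin H, ∑ z, flow w π p h.succ z * V h.succ z + ∑ z, w z * V 0 z =
      ∑ h : Fin H, ∑ z, flow w π p h.castSucc z * V h.castSucc z := by
    have h2 := Fin.sum_univ_succ fun h : Fin (H + 1) => ∑ z, flow w π p h z * V h z
    rw [Fin.sum_univ_castSucc] at h2
    simp only [hV, mul_zero, sum_const_zero, add_zero, flow_zero] at h2
    rw [h2, add_comm]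
  simp only [sum_flow_succ_mul] at h1
  simp only [mul_sub, mul_add, sum_add_distrib, sum_sub_distrib]
  rw [← h1, total]
  ring

theorem total_mono {w : Z → ℝ} {π : Fin H → Z → U → ℝ} {p : Fin H → Z → U → Z → ℝ}
    (hw : ∀ z, 0 ≤ w z) (hπ : IsPolicy π) (hp : IsSubkernel p) {f g : Fin H → Z → U → ℝ}
    (hfg : ∀ h z u, f h z u ≤ g h z u) : total w π p f ≤ total w π p g :=
  sum_le_sum fun h _ => sum_le_sum fun z _ =>
    mul_le_mul_of_nonneg_left (sum_le_sum fun u _ =>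
      mul_le_mul_of_nonneg_left (hfg h z u) ((hπ h z).1 u)) (flow_nonneg hw hπ hp _ z)

theorem total_const_mul (w : Z → ℝ) (π : Fin H → Z → U → ℝ) (p : Fin H → Z → U → Z → ℝ)
    (f : Fin H → Z → U → ℝ) (c : ℝ) :
    total w π p (fun h z u => c * f h z u) = c * total w π p f := by
  simp only [total, mul_sum]
  exact sum_congr rfl fun h _ => sum_congr rfl fun z _ => sum_congr rfl fun u _ => by ring

theorem total_nonneg {w : Z → ℝ} {π : Fin H → Z → U → ℝ} {p : Fin H → Z → U → Z → ℝ}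
    (hw : ∀ z, 0 ≤ w z) (hπ : IsPolicy π) (hp : IsSubkernel p) {f : Fin H → Z → U → ℝ}
    (hf : ∀ h z u, 0 ≤ f h z u) : 0 ≤ total w π p f :=
  sum_nonneg fun h _ => sum_nonneg fun z _ => mul_nonneg (flow_nonneg hw hπ hp _ z)
    (sum_nonneg fun u _ => mul_nonneg ((hπ h z).1 u) (hf h z u))

theorem total_le {w : Z → ℝ} {π : Fin H → Z → U → ℝ} {p : Fin H → Z → U → Z → ℝ}
    (hw : w ∈ stdSimplex ℝ Z) (hπ : IsPolicy π) (hp : IsSubkernel p) {f : Fin H → Z → U → ℝ}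
    {R : ℝ} (hR : 0 ≤ R) (hf : ∀ h z u, f h z u ≤ R) : total w π p f ≤ H * R := by
  refine (total_mono hw.1 hπ hp hf).trans ?_
  simp only [total, ← sum_mul, (hπ _ _).2, one_mul]
  refine mul_le_mul_of_nonneg_right ?_ hR
  calc ∑ h : Fin H, ∑ z, flow w π p h.castSucc z ≤ ∑ _h : Fin H, (1 : ℝ) :=
        sum_le_sum fun h _ => (sum_flow_le hw.1 hπ hp h.castSucc).trans hw.2.le
    _ = H := by simp

/-! ### Sums over trajectories -/

theorem sum_fin_succ_fun {n : ℕ} {M : Type*} [AddCommMonoid M] [DecidableEq Z]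
    (F : (Fin (n + 1) → Z) → M) :
    ∑ z, F z = ∑ z₀ : Z, ∑ z : Fin n → Z, F (Fin.cons z₀ z) := by
  rw [← Fintype.sum_prod_type', ← (Fin.consEquiv fun _ : Fin (n + 1) => Z).sum_comp]
  rfl

theorem flow_tail (w : Z → ℝ) (π : Fin (H + 1) → Z → U → ℝ) (p : Fin (H + 1) → Z → U → Z → ℝ)
    (h : Fin (H + 1)) :
    flow w π p h.succ =
      flow (flow w π p (0 : Fin (H + 1)).succ) (fun h => π h.succ) (fun h => p h.succ) h := by
  induction h using Fin.induction with
  | zero => rfl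
  | succ h ih =>
    funext z
    rw [flow_succ, flow_succ, ← ih, Fin.succ_castSucc]

theorem total_tail (w : Z → ℝ) (π : Fin (H + 1) → Z → U → ℝ) (p : Fin (H + 1) → Z → U → Z → ℝ)
    (f : Fin (H + 1) → Z → U → ℝ) :
    total w π p f = ∑ z, w z * ∑ u, π 0 z u * f 0 z u +
      total (flow w π p (0 : Fin (H + 1)).succ) (fun h => π h.succ) (fun h => p h.succ)
        (fun h => f h.succ) := by
  rw [total, Fin.sum_univ_succ, total]
  congr 1
  refine sum_congr rfl fun h _ => ?_
  rw [← Fin.succ_castSucc, flow_tail]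

variable [DecidableEq Z] [DecidableEq U]

theorem sum_traj_eq_sum (w : Z → ℝ) {π : Fin H → Z → U → ℝ} {p : Fin H → Z → U → Z → ℝ}
    (hπ : IsPolicy π) (hp : ∀ h z u, p h z u ∈ stdSimplex ℝ Z) :
    ∑ z : Fin (H + 1) → Z, ∑ u : Fin H → U, w (z 0) *
      ∏ h, (π h (z h.castSucc) (u h) * p h (z h.castSucc) (u h) (z h.succ)) = ∑ z, w z := by
  induction H generalizing w with
  | zero => simp [sum_fin_succ_fun]
  | succ H ih =>
    have := ih (flow w π p (0 : Fin (H + 1)).succ) (fun h => hπ h.succ) (fun h => hp h.succ)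
    rw [sum_flow_eq hπ hp] at this
    rw [← this, sum_fin_succ_fun, sum_comm]
    refine sum_congr rfl fun z _ => ?_
    simp only [sum_fin_succ_fun (Z := U), Fin.prod_univ_succ, Fin.cons_zero, Fin.cons_succ,
      Fin.castSucc_zero, ← Fin.succ_castSucc, flow_succ, flow_zero, sum_mul]
    conv_rhs => rw [sum_comm]
    refine sum_congr rfl fun z₀ _ => ?_
    conv_rhs => rw [sum_comm]
    exact sum_congr rfl fun u₀ _ => sum_congr rfl fun u _ => by ring

/-- The expectation over trajectories of a sum of stage rewards, in terms of the occupancy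
measures. -/
theorem sum_traj_mul_sum (w : Z → ℝ) {π : Fin H → Z → U → ℝ} {p : Fin H → Z → U → Z → ℝ}
    (hπ : IsPolicy π) (hp : ∀ h z u, p h z u ∈ stdSimplex ℝ Z) (f : Fin H → Z → U → ℝ) :
    ∑ z : Fin (H + 1) → Z, ∑ u : Fin H → U, w (z 0) *
      (∏ h, (π h (z h.castSucc) (u h) * p h (z h.castSucc) (u h) (z h.succ))) *
        ∑ h, f h (z h.castSucc) (u h) = total w π p f := by
  induction H generalizing w with
  | zero => simp [total]
  | succ H ih =>
    rw [total_tail, ← ih _ (fun h => hπ h.succ) (fun h => hp h.succ), sum_fin_succ_fun]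
    simp only [sum_fin_succ_fun (Z := U), Fin.prod_univ_succ, Fin.sum_univ_succ, Fin.cons_zero,
      Fin.cons_succ, Fin.castSucc_zero, ← Fin.succ_castSucc, mul_add, sum_add_distrib]
    congr 1
    · refine sum_congr rfl fun z₀ _ => ?_
      rw [sum_comm, mul_sum]
      refine sum_congr rfl fun u₀ _ => ?_
      have := sum_traj_eq_sum (p 0 z₀ u₀) (fun h => hπ h.succ) (fun h => hp h.succ)
      rw [(hp 0 z₀ u₀).2] at this
      rw [← mul_one (w z₀ * _), ← this]
      simp only [mul_sum]
      exact sum_congr rfl fun z _ => sum_congr rfl fun u _ => by ring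
    · rw [sum_comm]
      refine sum_congr rfl fun z _ => ?_
      simp only [flow_succ, flow_zero, Fin.castSucc_zero, sum_mul]
      conv_rhs => rw [sum_comm]
      refine sum_congr rfl fun z₀ _ => ?_
      conv_rhs => rw [sum_comm]
      exact sum_congr rfl fun u₀ _ => sum_congr rfl fun u _ => by ring

end Flow

/-! ### Comparing two models -/

section Simulation

variable {H : ℕ} {Z U : Type*} [Fintype Z] [Fintype U]

/-- The value functions of the policy `π` with rewards `f` in the model `p`, by backward
recursion. -/
def backwardValue (π : Fin H → Z → U → ℝ) (p : Fin H → Z → U → Z → ℝ) (f : Fin H → Z → U → ℝ) :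
    Fin (H + 1) → Z → ℝ :=
  Fin.reverseInduction (motive := fun _ => Z → ℝ) (fun _ => 0)
    (fun h V z => ∑ u, π h z u * (f h z u + ∑ z', p h z u z' * V z'))

theorem backwardValue_castSucc (π : Fin H → Z → U → ℝ) (p : Fin H → Z → U → Z → ℝ)
    (f : Fin H → Z → U → ℝ) (h : Fin H) (z : Z) :
    backwardValue π p f h.castSucc z =
      ∑ u, π h z u * (f h z u + ∑ z', p h z u z' * backwardValue π p f h.succ z') := by
  simp [backwardValue]

theorem sum_mul_mem_Icc_of_le_one {ι : Type*} [Fintype ι] {p g : ι → ℝ} {R : ℝ}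
    (hp : ∀ i, 0 ≤ p i) (hp1 : ∑ i, p i ≤ 1) (hR : 0 ≤ R) (hg : ∀ i, g i ∈ Set.Icc 0 R) :
    ∑ i, p i * g i ∈ Set.Icc 0 R := by
  refine ⟨sum_nonneg fun a _ => mul_nonneg (hp a) (hg a).1, ?_⟩
  calc ∑ a, p a * g a ≤ ∑ a, p a * R :=
        sum_le_sum fun a _ => mul_le_mul_of_nonneg_left (hg a).2 (hp a)
    _ ≤ R := by rw [← sum_mul]; exact mul_le_of_le_one_left hR hp1

theorem backwardValue_mem {π : Fin H → Z → U → ℝ} {p : Fin H → Z → U → Z → ℝ}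
    {f : Fin H → Z → U → ℝ} (hπ : IsPolicy π) (hp : IsSubkernel p)
    (hf : ∀ h z u, f h z u ∈ Set.Icc (0 : ℝ) 1) (h : Fin (H + 1)) (z : Z) :
    backwardValue π p f h z ∈ Set.Icc 0 ((H : ℝ) - h) := by
  induction h using Fin.reverseInduction generalizing z with
  | last => simp [backwardValue]
  | cast h ih =>
    rw [backwardValue_castSucc]
    refine sum_mul_mem_Icc (hπ h z) fun u => ?_
    have hh : ((h : ℕ) : ℝ) + 1 ≤ H := by exact_mod_cast h.2
    simp only [Fin.val_succ, Nat.cast_add, Nat.cast_one] at ih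
    obtain ⟨h1, h2⟩ := sum_mul_mem_Icc_of_le_one (hp h z u).1 (hp h z u).2 (by linarith) ih
    obtain ⟨h3, h4⟩ := hf h z u
    simp only [Fin.val_castSucc]
    constructor <;> linarith

/-- The simulation lemma: when the one-step errors of `p'` against `p` on functions with values in
`[0, H]` are at most `ε`, the total in the model `p` exceeds that in the model `p'` by at most the
total of `ε` in the model `p`. -/
theorem total_le_total_add {w : Z → ℝ} {π : Fin H → Z → U → ℝ} {p p' : Fin H → Z → U → Z → ℝ}
    {f ε : Fin H → Z → U → ℝ} (hw : ∀ z, 0 ≤ w z) (hπ : IsPolicy π) (hp : IsSubkernel p)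
    (hp' : IsSubkernel p') (hf : ∀ h z u, f h z u ∈ Set.Icc (0 : ℝ) 1)
    (hε : ∀ h z u (V : Z → ℝ), (∀ z, V z ∈ Set.Icc (0 : ℝ) H) →
      ∑ z', p h z u z' * V z' - ∑ z', p' h z u z' * V z' ≤ ε h z u) :
    total w π p f ≤ total w π p' f + total w π p ε := by
  set V := backwardValue π p' f with hV
  have hlast : ∀ z, V (Fin.last H) z = 0 := fun z => by simp [hV, backwardValue]
  have h1 := total_sub_eq w π p f hlast
  have h2 := total_sub_eq w π p' f hlast
  simp only [hV, backwardValue_castSucc, sub_self, mul_zero, sum_const_zero] at h2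
  have h3 := total_mono hw hπ hp (f := fun h z u =>
    ∑ z', p h z u z' * V h.succ z' - ∑ z', p' h z u z' * V h.succ z') (g := ε)
    fun h z u => hε h z u _ fun z => by
      obtain ⟨h4, h5⟩ := backwardValue_mem hπ hp' hf h.succ z
      exact ⟨h4, h5.trans (sub_le_self _ (Nat.cast_nonneg _))⟩
  have h4 : total w π p (fun h z u =>
      ∑ z', p h z u z' * V h.succ z' - ∑ z', p' h z u z' * V h.succ z') =
      total w π p f - ∑ z, w z * V 0 z := by
    rw [h1, total]
    refine sum_congr rfl fun h _ => sum_congr rfl fun z _ => ?_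
    rw [hV, backwardValue_castSucc, ← sum_sub_distrib]
    exact congrArg _ (sum_congr rfl fun u _ => by ring)
  rw [← hV] at h2
  linarith

end Simulation

/-! ### The product structure of the game -/

section Product

variable {H : ℕ} {S₁ S₂ A B : Type*}

/-- The policy on pairs of actions when the players act independently. -/
def jointPolicy (μ : Fin H → S₁ → A → ℝ) (ν : Fin H → S₂ → B → ℝ) : Fin H → S₁ × S₂ → A × B → ℝ :=
  fun h z u => μ h z.1 u.1 * ν h z.2 u.2

/-- The factored transition kernel on pairs of states. -/
def jointKernel (p₁ : Fin H → S₁ → A → S₁ → ℝ) (p₂ : Fin H → S₂ → B → S₂ → ℝ) :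
    Fin H → S₁ × S₂ → A × B → S₁ × S₂ → ℝ :=
  fun h z u z' => p₁ h z.1 u.1 z'.1 * p₂ h z.2 u.2 z'.2

/-- The weights of the deterministic initial state `x₀`. -/
def point {S : Type*} [DecidableEq S] (x₀ : S) : S → ℝ := fun x => if x = x₀ then 1 else 0

theorem point_mem {S : Type*} [Fintype S] [DecidableEq S] (x₀ : S) : point x₀ ∈ stdSimplex ℝ S :=
  ⟨fun x => by unfold point; split_ifs <;> norm_num, by simp [point]⟩

theorem mul_mem_stdSimplex {ι κ : Type*} [Fintype ι] [Fintype κ] {p : ι → ℝ} {q : κ → ℝ}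
    (hp : p ∈ stdSimplex ℝ ι) (hq : q ∈ stdSimplex ℝ κ) :
    (fun z : ι × κ => p z.1 * q z.2) ∈ stdSimplex ℝ (ι × κ) :=
  ⟨fun z => mul_nonneg (hp.1 _) (hq.1 _), by
    simp [Fintype.sum_prod_type, ← mul_sum, hp.2, hq.2]⟩

theorem IsPolicy.joint [Fintype A] [Fintype B]
    {μ : Fin H → S₁ → A → ℝ} {ν : Fin H → S₂ → B → ℝ} (hμ : IsPolicy μ)
    (hν : IsPolicy ν) : IsPolicy (jointPolicy μ ν) :=
  fun h z => mul_mem_stdSimplex (hμ h z.1) (hν h z.2)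

variable [Fintype S₁] [Fintype S₂]

theorem IsSubkernel.joint {p₁ : Fin H → S₁ → A → S₁ → ℝ} {p₂ : Fin H → S₂ → B → S₂ → ℝ}
    (h₁ : IsSubkernel p₁) (h₂ : IsSubkernel p₂) : IsSubkernel (jointKernel p₁ p₂) := by
  refine fun h z u => ⟨fun z' => mul_nonneg ((h₁ h _ _).1 _) ((h₂ h _ _).1 _), ?_⟩
  simp only [jointKernel, Fintype.sum_prod_type, ← mul_sum, ← sum_mul]
  exact mul_le_one₀ (h₁ h _ _).2 (sum_nonneg fun _ _ => (h₂ h _ _).1 _) (h₂ h _ _).2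

theorem isSubkernel_of_mem {p₁ : Fin H → S₁ → A → S₁ → ℝ}
    (hp : ∀ h x a, p₁ h x a ∈ stdSimplex ℝ S₁) : IsSubkernel p₁ :=
  fun h x a => ⟨(hp h x a).1, (hp h x a).2.le⟩

variable [Fintype A] [Fintype B] [DecidableEq S₁] [DecidableEq S₂]

/-- The players' states are independent under independent play. -/
theorem flow_joint (x₀ : S₁) (y₀ : S₂) (μ : Fin H → S₁ → A → ℝ) (ν : Fin H → S₂ → B → ℝ)
    (p₁ : Fin H → S₁ → A → S₁ → ℝ) (p₂ : Fin H → S₂ → B → S₂ → ℝ) (h : Fin (H + 1))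
    (z : S₁ × S₂) :
    flow (point (x₀, y₀)) (jointPolicy μ ν) (jointKernel p₁ p₂) h z =
      flow (point x₀) μ p₁ h z.1 * flow (point y₀) ν p₂ h z.2 := by
  induction h using Fin.induction generalizing z with
  | zero => simp [point, Prod.ext_iff, ← ite_and, and_comm]
  | succ h ih =>
    simp only [flow_succ, ih, Fintype.sum_prod_type, sum_mul_sum, jointPolicy, jointKernel]
    refine sum_congr rfl fun x _ => sum_congr rfl fun y _ => sum_congr rfl fun a _ =>
      sum_congr rfl fun b _ => by ring

/-- A quantity that depends only on Player 2 has the same total in the one-player chain. -/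
theorem total_joint_snd (x₀ : S₁) (y₀ : S₂) {μ : Fin H → S₁ → A → ℝ} (ν : Fin H → S₂ → B → ℝ)
    {p₁ : Fin H → S₁ → A → S₁ → ℝ} (p₂ : Fin H → S₂ → B → S₂ → ℝ) (hμ : IsPolicy μ)
    (hp₁ : ∀ h x a, p₁ h x a ∈ stdSimplex ℝ S₁) (f : Fin H → S₂ → B → ℝ) :
    total (point (x₀, y₀)) (jointPolicy μ ν) (jointKernel p₁ p₂) (fun h z u => f h z.2 u.2) =
      total (point y₀) ν p₂ f := by
  refine sum_congr rfl fun h _ => ?_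
  have h1 : ∀ z : S₁ × S₂, ∑ u, jointPolicy μ ν h z u * f h z.2 u.2 =
      ∑ b, ν h z.2 b * f h z.2 b := by
    intro z
    simp only [jointPolicy, Fintype.sum_prod_type, mul_assoc, ← mul_sum, ← sum_mul, (hμ h z.1).2,
      one_mul]
  simp only [h1, flow_joint, Fintype.sum_prod_type, mul_assoc, ← mul_sum, ← sum_mul,
    sum_flow_eq hμ hp₁, (point_mem x₀).2, one_mul]

variable [DecidableEq A] [DecidableEq B]

theorem value_eq_total (G : Game H S₁ S₂ A B) {μ : Fin H → S₁ → A → ℝ} {ν : Fin H → S₂ → B → ℝ}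
    (hμ : IsPolicy μ) (hν : IsPolicy ν) (x₀ : S₁) (y₀ : S₂) :
    value G μ ν x₀ y₀ = total (point (x₀, y₀)) (jointPolicy μ ν) (jointKernel G.P₁ G.P₂)
      (fun h z u => G.r h z.1 z.2 u.1 u.2) := by
  rw [← sum_traj_mul_sum _ (hμ.joint hν) (p := jointKernel G.P₁ G.P₂) fun h z u =>
    mul_mem_stdSimplex (G.P₁_mem h z.1 u.1) (G.P₂_mem h z.2 u.2)]
  rw [← (Equiv.arrowProdEquivProdArrow (Fin (H + 1)) (fun _ => S₁) (fun _ => S₂)).symm.sum_comp,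
    Fintype.sum_prod_type]
  refine sum_congr rfl fun x _ => sum_congr rfl fun y _ => ?_
  rw [← (Equiv.arrowProdEquivProdArrow (Fin H) (fun _ => A) (fun _ => B)).symm.sum_comp,
    Fintype.sum_prod_type]
  refine sum_congr rfl fun a _ => sum_congr rfl fun b _ => ?_
  simp [trajProb, Equiv.arrowProdEquivProdArrow, jointPolicy, jointKernel, point, Prod.ext_iff]

end Product

/-! ### Optimism on the event of accurate estimates -/

section Optimism

variable {H : ℕ} {S₁ S₂ A B : Type*} [Fintype S₁] [Fintype S₂] [Fintype A] [Fintype B]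
  [DecidableEq S₁] [DecidableEq S₂] [DecidableEq A] [DecidableEq B]

/-- The part of the transition bonus that comes from Player 1's transitions. -/
def bonus₁ (δ : ℝ) (K : ℕ) (X : Transcript H S₁ S₂ A B) (k : ℕ) (h : Fin H) (x : S₁) (a : A) : ℝ :=
  √(2 * (H : ℝ) ^ 2 * Fintype.card S₁ *
    Real.log (2 * (Fintype.card S₁ : ℝ) * Fintype.card A * H * K / δ) /
      max (count₁ X k h x a : ℝ) 1)

/-- The part of the transition bonus that comes from Player 2's transitions. -/
def bonus₂ (δ : ℝ) (K : ℕ) (X : Transcript H S₁ S₂ A B) (k : ℕ) (h : Fin H) (y : S₂) (b : B) : ℝ :=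
  √(2 * (H : ℝ) ^ 2 * Fintype.card S₂ *
    Real.log (2 * (Fintype.card S₂ : ℝ) * Fintype.card B * H * K / δ) /
      max (count₂ X k h y b : ℝ) 1)

/-- The bonus formula, without the convention that the bonus of episode `0` vanishes. -/
def fullBonus (δ : ℝ) (K : ℕ) (X : Transcript H S₁ S₂ A B) (k : ℕ) (h : Fin H)
    (z : S₁ × S₂) (u : A × B) : ℝ :=
  bonusR δ K X k h z.1 z.2 u.1 u.2 + (bonus₁ δ K X k h z.1 u.1 + bonus₂ δ K X k h z.2 u.2)

theorem bonus_eq_fullBonus (δ : ℝ) (K : ℕ) (X : Transcript H S₁ S₂ A B) {k : ℕ} (hk : k ≠ 0)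
    (h : Fin H) (z : S₁ × S₂) (u : A × B) :
    bonus δ K X k h z.1 z.2 u.1 u.2 = fullBonus δ K X k h z u := by
  rw [bonus, if_neg hk]
  rfl

/-- The empirical model is within the bonuses of the true one. -/
structure Accurate (G : Game H S₁ S₂ A B) (δ : ℝ) (K : ℕ) (X : Transcript H S₁ S₂ A B) (k : ℕ) :
    Prop where
  reward : ∀ h x y a b, |rHat X k h x y a b - G.r h x y a b| ≤ bonusR δ K X k h x y a b
  trans₁ : ∀ h x a, H * ∑ x', |pHat₁ X k h x a x' - G.P₁ h x a x'| ≤ bonus₁ δ K X k h x a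
  trans₂ : ∀ h y b, H * ∑ y', |pHat₂ X k h y b y' - G.P₂ h y b y'| ≤ bonus₂ δ K X k h y b

theorem isSubkernel_pHat₂ (X : Transcript H S₁ S₂ A B) (k : ℕ) : IsSubkernel (pHat₂ X k) := by
  intro h y b
  refine ⟨fun y' => by unfold pHat₂; split_ifs <;> positivity, ?_⟩
  by_cases hk : k = 0
  · simp only [pHat₂, hk, if_true, sum_const, card_univ, nsmul_eq_mul]
    rw [mul_one_div]
    exact div_self_le_one _
  · simp only [pHat₂, hk, if_false, ← sum_div]
    refine div_le_one_of_le₀ (le_trans (le_of_eq ?_) (le_max_left _ _)) (by positivity)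
    have := card_eq_sum_card_fiberwise (t := univ) (f := fun τ => X.s₂ τ h.succ)
      (s := {τ ∈ Icc 1 k | X.s₂ τ h.castSucc = y ∧ X.b τ h = b}) (by simp)
    simp only [filter_filter, and_assoc] at this
    rw [count₂, this]
    push_cast
    rfl

/-- Two product weights integrate a bounded function to almost the same value when their factors
are close in `ℓ¹`. -/
theorem abs_sum_prod_sub_le {ι κ : Type*} [Fintype ι] [Fintype κ] {p p' : ι → ℝ} {q q' : κ → ℝ}
    {R : ℝ} (hR : 0 ≤ R) (hq : ∀ j, 0 ≤ q j) (hq1 : ∑ j, q j ≤ 1) (hp' : ∀ i, 0 ≤ p' i) (hp1 : ∑ i, p' i ≤ 1)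
    {V : ι × κ → ℝ} (hV : ∀ z, V z ∈ Set.Icc 0 R) :
    |∑ z : ι × κ, p z.1 * q z.2 * V z - ∑ z : ι × κ, p' z.1 * q' z.2 * V z| ≤
      R * ∑ i, |p i - p' i| + R * ∑ j, |q j - q' j| := by
  have h1 : ∑ z : ι × κ, p z.1 * q z.2 * V z - ∑ z : ι × κ, p' z.1 * q' z.2 * V z =
      ∑ i, (p i - p' i) * ∑ j, q j * V (i, j) + ∑ j, (q j - q' j) * ∑ i, p' i * V (i, j) := by
    simp only [mul_sum]
    rw [sum_comm (γ := κ), ← sum_add_distrib, ← sum_sub_distrib, Fintype.sum_prod_type]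
    refine sum_congr rfl fun i _ => ?_
    rw [← sum_add_distrib]
    exact sum_congr rfl fun j _ => by ring
  rw [h1]
  refine (abs_add_le _ _).trans (add_le_add ?_ ?_)
  · rw [mul_sum]
    refine (abs_sum_le_sum_abs _ _).trans (sum_le_sum fun i _ => ?_)
    obtain ⟨h2, h3⟩ := sum_mul_mem_Icc_of_le_one hq hq1 hR fun j => hV (i, j)
    rw [abs_mul, abs_of_nonneg h2, mul_comm]
    exact mul_le_mul_of_nonneg_right h3 (abs_nonneg _)
  · rw [mul_sum]
    refine (abs_sum_le_sum_abs _ _).trans (sum_le_sum fun j _ => ?_)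
    obtain ⟨h2, h3⟩ := sum_mul_mem_Icc_of_le_one hp' hp1 hR fun i => hV (i, j)
    rw [abs_mul, abs_of_nonneg h2, mul_comm]
    exact mul_le_mul_of_nonneg_right h3 (abs_nonneg _)

variable {δ : ℝ} {K k : ℕ} {X : Transcript H S₁ S₂ A B} {G : Game H S₁ S₂ A B}

theorem qStep_mem (h : Fin H) (V : S₁ → S₂ → ℝ) (x : S₁) (y : S₂) (a : A) (b : B) :
    qStep δ K X k h V x y a b ∈ Set.Icc 0 ((H : ℝ) - h) := by
  have hh : ((h : ℕ) : ℝ) ≤ H := by exact_mod_cast h.2.le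
  exact ⟨le_max_right _ _, max_le (min_le_right _ _) (by linarith)⟩

theorem vBar_castSucc (μ : Fin H → S₁ → A → ℝ) (h : Fin H) (x : S₁) (y : S₂) :
    vBar δ K X k μ h.castSucc x y =
      ∑ a : A, ∑ b : B, μ h x a * qBar δ K X k μ h x y a b * X.ν k h y b := by
  simp [vBar, qBar]

theorem vBar_last (μ : Fin H → S₁ → A → ℝ) (x : S₁) (y : S₂) :
    vBar δ K X k μ (Fin.last H) x y = 0 := by
  simp [vBar]

theorem vBar_castSucc_eq_joint (μ : Fin H → S₁ → A → ℝ) (h : Fin H) (z : S₁ × S₂) :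
    vBar δ K X k μ h.castSucc z.1 z.2 =
      ∑ u, jointPolicy μ (X.ν k) h z u * qBar δ K X k μ h z.1 z.2 u.1 u.2 := by
  rw [vBar_castSucc, Fintype.sum_prod_type]
  exact sum_congr rfl fun a _ => sum_congr rfl fun b _ => by rw [jointPolicy]; ring

theorem vBar_mem {μ : Fin H → S₁ → A → ℝ} (hμ : IsPolicy μ) (hν : IsPolicy (X.ν k))
    (h : Fin (H + 1)) (x : S₁) (y : S₂) : vBar δ K X k μ h x y ∈ Set.Icc 0 ((H : ℝ) - h) := by
  induction h using Fin.lastCases with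
  | last => simp [vBar_last]
  | cast h =>
    have := vBar_castSucc_eq_joint (δ := δ) (K := K) (X := X) (k := k) μ h (x, y)
    rw [this]
    exact sum_mul_mem_Icc (hμ.joint hν h (x, y)) fun u => qStep_mem h _ x y u.1 u.2

theorem qBar_eq (hk : k ≠ 0) (μ : Fin H → S₁ → A → ℝ) (h : Fin H) (z : S₁ × S₂) (u : A × B) :
    qBar δ K X k μ h z.1 z.2 u.1 u.2 =
      max (min (rHat X k h z.1 z.2 u.1 u.2 +
        ∑ z', jointKernel (pHat₁ X k) (pHat₂ X k) h z u z' * vBar δ K X k μ h.succ z'.1 z'.2 +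
        fullBonus δ K X k h z u) ((H : ℝ) - h)) 0 := by
  rw [qBar, qStep, bonus_eq_fullBonus δ K X hk, Fintype.sum_prod_type]
  rfl

theorem vBar_mem_of_horizon {μ : Fin H → S₁ → A → ℝ} (hμ : IsPolicy μ) (hν : IsPolicy (X.ν k))
    (h : Fin (H + 1)) (z : S₁ × S₂) : vBar δ K X k μ h z.1 z.2 ∈ Set.Icc 0 (H : ℝ) :=
  ⟨(vBar_mem hμ hν h z.1 z.2).1,
    (vBar_mem hμ hν h z.1 z.2).2.trans (sub_le_self _ (Nat.cast_nonneg _))⟩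

/-- Optimism. The comparison is with the hybrid model made of Player 1's true and Player 2's
empirical transitions. -/
theorem Accurate.le_qBar (hX : Accurate G δ K X k) (hk : k ≠ 0) {μ : Fin H → S₁ → A → ℝ}
    (hμ : IsPolicy μ) (hν : IsPolicy (X.ν k)) (h : Fin H) (z : S₁ × S₂) (u : A × B) :
    G.r h z.1 z.2 u.1 u.2 +
        ∑ z', jointKernel G.P₁ (pHat₂ X k) h z u z' * vBar δ K X k μ h.succ z'.1 z'.2 ≤
      qBar δ K X k μ h z.1 z.2 u.1 u.2 := by
  rw [qBar_eq hk]
  refine le_trans (le_min ?_ ?_) (le_max_left _ _)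
  · have h1 := abs_sum_prod_sub_le (p := pHat₁ X k h z.1 u.1) (p' := G.P₁ h z.1 u.1)
      (q := pHat₂ X k h z.2 u.2) (q' := pHat₂ X k h z.2 u.2) (R := H) (by positivity)
      (isSubkernel_pHat₂ X k h z.2 u.2).1 (isSubkernel_pHat₂ X k h z.2 u.2).2
      (G.P₁_mem h z.1 u.1).1 (G.P₁_mem h z.1 u.1).2.le
      (V := fun z' => vBar δ K X k μ h.succ z'.1 z'.2) (vBar_mem_of_horizon hμ hν h.succ)
    have h2 := hX.trans₁ h z.1 u.1
    have h3 := (abs_le.1 (hX.reward h z.1 z.2 u.1 u.2)).1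
    have h4 : 0 ≤ bonus₂ δ K X k h z.2 u.2 := Real.sqrt_nonneg _
    simp only [sub_self, abs_zero, sum_const_zero, mul_zero, add_zero] at h1
    have h5 := (abs_le.1 h1).1
    simp only [jointKernel, fullBonus]
    linarith
  · have hh : ((h : ℕ) : ℝ) + 1 ≤ H := by exact_mod_cast h.2
    have h1 := (isSubkernel_of_mem G.P₁_mem).joint (isSubkernel_pHat₂ X k) h z u
    have h2 := (sum_mul_mem_Icc_of_le_one h1.1 h1.2 (by linarith : (0 : ℝ) ≤ H - ((h : ℕ) + 1))
      (g := fun z' => vBar δ K X k μ h.succ z'.1 z'.2) fun z' => by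
        simpa using vBar_mem (δ := δ) (K := K) hμ hν h.succ z'.1 z'.2).2
    have h3 := (G.r_mem h z.1 z.2 u.1 u.2).2
    linarith

theorem fullBonus_nonneg (h : Fin H) (z : S₁ × S₂) (u : A × B) : 0 ≤ fullBonus δ K X k h z u :=
  add_nonneg (Real.sqrt_nonneg _) (add_nonneg (Real.sqrt_nonneg _) (Real.sqrt_nonneg _))

theorem Accurate.qBar_le (hX : Accurate G δ K X k) (hk : k ≠ 0) {μ : Fin H → S₁ → A → ℝ}
    (hμ : IsPolicy μ) (hν : IsPolicy (X.ν k)) (h : Fin H) (z : S₁ × S₂) (u : A × B) :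
    qBar δ K X k μ h z.1 z.2 u.1 u.2 ≤
      2 * fullBonus δ K X k h z u + (G.r h z.1 z.2 u.1 u.2 +
        ∑ z', jointKernel G.P₁ G.P₂ h z u z' * vBar δ K X k μ h.succ z'.1 z'.2) := by
  rw [qBar_eq hk]
  have hP := (isSubkernel_of_mem G.P₁_mem).joint (isSubkernel_of_mem G.P₂_mem) h z u
  refine max_le ((min_le_left _ _).trans ?_) (add_nonneg ?_ (add_nonneg ?_ ?_))
  · have h1 := abs_sum_prod_sub_le (p := pHat₁ X k h z.1 u.1) (p' := G.P₁ h z.1 u.1)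
      (q := pHat₂ X k h z.2 u.2) (q' := G.P₂ h z.2 u.2) (R := H) (by positivity)
      (isSubkernel_pHat₂ X k h z.2 u.2).1 (isSubkernel_pHat₂ X k h z.2 u.2).2
      (G.P₁_mem h z.1 u.1).1 (G.P₁_mem h z.1 u.1).2.le
      (V := fun z' => vBar δ K X k μ h.succ z'.1 z'.2) (vBar_mem_of_horizon hμ hν h.succ)
    have h2 := hX.trans₁ h z.1 u.1
    have h3 := hX.trans₂ h z.2 u.2
    have h4 := (abs_le.1 (hX.reward h z.1 z.2 u.1 u.2)).2
    have h5 := (abs_le.1 h1).2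
    simp only [jointKernel, fullBonus]
    linarith
  · exact mul_nonneg zero_le_two (fullBonus_nonneg h z u)
  · exact (G.r_mem h z.1 z.2 u.1 u.2).1
  · exact sum_nonneg fun z' _ => mul_nonneg (hP.1 z') (vBar_mem hμ hν h.succ z'.1 z'.2).1

/-- The direction of Player 1's mirror ascent step. -/
def gain (δ : ℝ) (K : ℕ) (X : Transcript H S₁ S₂ A B) (k : ℕ) (μ : Fin H → S₁ → A → ℝ) (y₀ : S₂)
    (h : Fin H) (x : S₁) (a : A) : ℝ :=
  ∑ y : S₂, (∑ b : B, qBar δ K X k μ h x y a b * X.ν k h y b) * reach X k y₀ h.castSucc y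

theorem reach_eq_flow (y₀ : S₂) : reach X k y₀ = flow (point y₀) (X.ν k) (pHat₂ X k) := rfl

theorem gain_mem (hν : IsPolicy (X.ν k)) (μ : Fin H → S₁ → A → ℝ) (y₀ : S₂) (h : Fin H) (x : S₁)
    (a : A) : gain δ K X k μ y₀ h x a ∈ Set.Icc 0 (H : ℝ) := by
  have h0 : ∀ y, 0 ≤ reach X k y₀ h.castSucc y :=
    flow_nonneg (point_mem y₀).1 hν (isSubkernel_pHat₂ X k) _
  have h1 : ∑ y, reach X k y₀ h.castSucc y ≤ 1 :=
    (sum_flow_le (point_mem y₀).1 hν (isSubkernel_pHat₂ X k) h.castSucc).trans (point_mem y₀).2.le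
  have h2 := sum_mul_mem_Icc_of_le_one h0 h1 (Nat.cast_nonneg (α := ℝ) H)
    (g := fun y => ∑ b : B, qBar δ K X k μ h x y a b * X.ν k h y b) fun y => by
      have := sum_mul_mem_Icc (hν h y) (g := fun b => qBar δ K X k μ h x y a b) (R := H)
        fun b => ⟨(qStep_mem h _ x y a b).1,
          (qStep_mem h _ x y a b).2.trans (sub_le_self _ (Nat.cast_nonneg _))⟩
      simpa only [mul_comm] using this
  simpa only [gain, mul_comm] using h2

theorem isSubkernel_joint_game (G : Game H S₁ S₂ A B) : IsSubkernel (jointKernel G.P₁ G.P₂) :=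
  (isSubkernel_of_mem G.P₁_mem).joint (isSubkernel_of_mem G.P₂_mem)

/-- In the hybrid model, whose state distribution is the product of Player 1's true occupancy
measure and `reach`, a comparator gains over the optimistic value no more than what the mirror
ascent steps see. -/
theorem Accurate.total_hybrid_le (hX : Accurate G δ K X k) (hk : k ≠ 0)
    {μ π : Fin H → S₁ → A → ℝ} (hμ : IsPolicy μ) (hν : IsPolicy (X.ν k)) (hπ : IsPolicy π)
    (x₀ : S₁) (y₀ : S₂) :
    total (point (x₀, y₀)) (jointPolicy π (X.ν k)) (jointKernel G.P₁ (pHat₂ X k))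
        (fun h z u => G.r h z.1 z.2 u.1 u.2) ≤
      vBar δ K X k μ 0 x₀ y₀ + ∑ h : Fin H, ∑ x, flow (point x₀) π G.P₁ h.castSucc x *
        ∑ a, (π h x a - μ h x a) * gain δ K X k μ y₀ h x a := by
  have hsub := (isSubkernel_of_mem G.P₁_mem).joint (isSubkernel_pHat₂ X k)
  have h1 := total_sub_eq (point (x₀, y₀)) (jointPolicy π (X.ν k))
    (jointKernel G.P₁ (pHat₂ X k)) (fun h z u => G.r h z.1 z.2 u.1 u.2)
    (V := fun h z => vBar δ K X k μ h z.1 z.2) fun z => vBar_last μ z.1 z.2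
  have h2 : ∑ z, point (x₀, y₀) z * vBar δ K X k μ 0 z.1 z.2 = vBar δ K X k μ 0 x₀ y₀ := by
    simp [point]
  rw [h2, sub_eq_iff_eq_add'] at h1
  rw [h1]
  refine add_le_add_right (sum_le_sum fun h _ => ?_) _
  have h3 : ∀ z : S₁ × S₂, ∑ u, jointPolicy π (X.ν k) h z u * (G.r h z.1 z.2 u.1 u.2 +
        ∑ z', jointKernel G.P₁ (pHat₂ X k) h z u z' * vBar δ K X k μ h.succ z'.1 z'.2) -
        vBar δ K X k μ h.castSucc z.1 z.2 ≤
      ∑ a, (π h z.1 a - μ h z.1 a) *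
        ∑ b, qBar δ K X k μ h z.1 z.2 a b * X.ν k h z.2 b := by
    intro z
    refine (sub_le_sub_right (sum_le_sum fun u _ => mul_le_mul_of_nonneg_left
      (hX.le_qBar hk hμ hν h z u) ((hπ.joint hν h z).1 u)) _).trans (le_of_eq ?_)
    rw [vBar_castSucc_eq_joint, ← sum_sub_distrib, Fintype.sum_prod_type]
    refine sum_congr rfl fun a _ => ?_
    rw [mul_sum]
    exact sum_congr rfl fun b _ => by simp only [jointPolicy]; ring
  refine (sum_le_sum fun z _ => mul_le_mul_of_nonneg_left (h3 z)
    (flow_nonneg (point_mem _).1 (hπ.joint hν) hsub _ z)).trans (le_of_eq ?_)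
  simp only [flow_joint, Fintype.sum_prod_type, gain, reach_eq_flow, mul_sum]
  refine sum_congr rfl fun x _ => ?_
  rw [sum_comm]
  refine sum_congr rfl fun a _ => sum_congr rfl fun y _ => ?_
  rw [sum_mul, mul_sum, mul_sum]
  exact sum_congr rfl fun b _ => by ring

/-- The regret of one episode: the part handled by mirror ascent, and three times the expected
bonuses under the policies of the episode (once for replacing Player 2's transitions by the
empirical ones in the comparator's value, twice for the width of the optimistic value). -/
theorem Accurate.value_sub_value_le (hX : Accurate G δ K X k) (hk : k ≠ 0)
    {μ π : Fin H → S₁ → A → ℝ} (hμ : IsPolicy μ) (hν : IsPolicy (X.ν k)) (hπ : IsPolicy π)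
    (x₀ : S₁) (y₀ : S₂) :
    value G π (X.ν k) x₀ y₀ - value G μ (X.ν k) x₀ y₀ ≤
      ∑ h : Fin H, ∑ x, flow (point x₀) π G.P₁ h.castSucc x *
        ∑ a, (π h x a - μ h x a) * gain δ K X k μ y₀ h x a +
      3 * total (point (x₀, y₀)) (jointPolicy μ (X.ν k)) (jointKernel G.P₁ G.P₂)
        (fullBonus δ K X k) := by
  have hw := (point_mem (x₀, y₀)).1
  have hP := isSubkernel_joint_game G
  have h1 := total_le_total_add hw (hπ.joint hν) hP
    ((isSubkernel_of_mem G.P₁_mem).joint (isSubkernel_pHat₂ X k))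
    (f := fun h z u => G.r h z.1 z.2 u.1 u.2) (ε := fun h z u => bonus₂ δ K X k h z.2 u.2)
    (fun h z u => G.r_mem h z.1 z.2 u.1 u.2) fun h z u V hV => by
      have h2 := abs_sum_prod_sub_le (p := G.P₁ h z.1 u.1) (p' := G.P₁ h z.1 u.1)
        (q := pHat₂ X k h z.2 u.2) (q' := G.P₂ h z.2 u.2) (R := H) (by positivity)
        (isSubkernel_pHat₂ X k h z.2 u.2).1 (isSubkernel_pHat₂ X k h z.2 u.2).2
        (G.P₁_mem h z.1 u.1).1 (G.P₁_mem h z.1 u.1).2.le hV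
      simp only [sub_self, abs_zero, sum_const_zero, mul_zero, zero_add] at h2
      have h3 := (abs_le.1 h2).1
      have h4 := hX.trans₂ h z.2 u.2
      simp only [jointKernel]
      linarith
  rw [total_joint_snd x₀ y₀ _ _ hπ G.P₁_mem, ← total_joint_snd x₀ y₀ _ _ hμ G.P₁_mem] at h1
  have h2 := total_mono hw (hμ.joint hν) hP (f := fun h z u => bonus₂ δ K X k h z.2 u.2)
    (g := fullBonus δ K X k) fun h z u => by
      have h3 : 0 ≤ bonus₁ δ K X k h z.1 u.1 := Real.sqrt_nonneg _
      have h4 : 0 ≤ bonusR δ K X k h z.1 z.2 u.1 u.2 := Real.sqrt_nonneg _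
      simp only [fullBonus]
      linarith
  have h3 := hX.total_hybrid_le hk hμ hν hπ x₀ y₀
  have h4 : vBar δ K X k μ 0 x₀ y₀ -
      total (point (x₀, y₀)) (jointPolicy μ (X.ν k)) (jointKernel G.P₁ G.P₂)
        (fun h z u => G.r h z.1 z.2 u.1 u.2) ≤
      total (point (x₀, y₀)) (jointPolicy μ (X.ν k)) (jointKernel G.P₁ G.P₂)
        (fun h z u => 2 * fullBonus δ K X k h z u) := by
    have h5 := total_sub_eq (point (x₀, y₀)) (jointPolicy μ (X.ν k)) (jointKernel G.P₁ G.P₂)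
      (fun h z u => G.r h z.1 z.2 u.1 u.2)
      (V := fun h z => vBar δ K X k μ h z.1 z.2) fun z => vBar_last μ z.1 z.2
    have h6 : ∑ z, point (x₀, y₀) z * vBar δ K X k μ 0 z.1 z.2 = vBar δ K X k μ 0 x₀ y₀ := by
      simp [point]
    rw [h6] at h5
    rw [← neg_sub, h5, total, ← sum_neg_distrib]
    refine sum_le_sum fun h _ => ?_
    rw [← sum_neg_distrib]
    refine sum_le_sum fun z _ => ?_
    rw [← mul_neg, neg_sub]
    refine mul_le_mul_of_nonneg_left ?_ (flow_nonneg hw (hμ.joint hν) hP _ z)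
    rw [vBar_castSucc_eq_joint, ← sum_sub_distrib]
    refine sum_le_sum fun u _ => ?_
    rw [← mul_sub]
    refine mul_le_mul_of_nonneg_left ?_ ((hμ.joint hν h z).1 u)
    have := hX.qBar_le hk hμ hν h z u
    linarith
  rw [total_const_mul] at h4
  rw [value_eq_total G hπ hν, value_eq_total G hμ hν]
  linarith

end Optimism

/-! ### The regret on the event of accurate estimates -/

section Regret

variable {H : ℕ} {S₁ S₂ A B : Type*} [Fintype S₁] [Fintype S₂] [Fintype A] [Fintype B]
  [DecidableEq S₁] [DecidableEq S₂] [DecidableEq A] [DecidableEq B]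

theorem policy_pos [Nonempty A] (η δ : ℝ) (K : ℕ) (y₀ : S₂) (X : Transcript H S₁ S₂ A B) (k : ℕ)
    (h : Fin H) (x : S₁) (a : A) : 0 < policy η δ K y₀ X k h x a := by
  induction k generalizing h x a with
  | zero => simp [policy, Fintype.card_pos]
  | succ k ih => rw [policy]; exact mirrorStep_pos (ih h x) _ a

theorem isPolicy_policy [Nonempty A] (η δ : ℝ) (K : ℕ) (y₀ : S₂) (X : Transcript H S₁ S₂ A B)
    (k : ℕ) : IsPolicy (policy η δ K y₀ X k) := by
  refine fun h x => ⟨fun a => (policy_pos η δ K y₀ X k h x a).le, ?_⟩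
  cases k with
  | zero => simp [policy]
  | succ k => simp only [policy]; exact mirrorStep_sum (policy_pos η δ K y₀ X k h x) _

/-- Bonuses computed from one more episode are smaller. -/
theorem fullBonus_le_pred (δ : ℝ) (K : ℕ) (X : Transcript H S₁ S₂ A B) (k : ℕ)
    (hlog : 0 ≤ Real.log ((Fintype.card S₁ : ℝ) * Fintype.card S₂ * Fintype.card A *
      Fintype.card B * H * K / δ))
    (hlog₁ : 0 ≤ Real.log (2 * (Fintype.card S₁ : ℝ) * Fintype.card A * H * K / δ))
    (hlog₂ : 0 ≤ Real.log (2 * (Fintype.card S₂ : ℝ) * Fintype.card B * H * K / δ))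
    (h : Fin H) (z : S₁ × S₂) (u : A × B) :
    fullBonus δ K X k h z u ≤ fullBonus δ K X (k - 1) h z u := by
  have hsub : Icc 1 (k - 1) ⊆ Icc 1 k := Icc_subset_Icc_right (Nat.sub_le k 1)
  unfold fullBonus bonusR bonus₁ bonus₂
  gcongr
  · exact card_le_card (filter_subset_filter _ hsub)
  · exact card_le_card (filter_subset_filter _ hsub)
  · exact card_le_card (filter_subset_filter _ hsub)

theorem sum_sqrt_div_le {ι : Type*} {s : Finset ι} (c : ℝ) {M : ℝ} {n : ι → ℝ}
    (hn : ∀ k, 0 ≤ n k) (h : ∑ k ∈ s, 1 / √(n k) ≤ 3 * M) :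
    ∑ k ∈ s, √(c / n k) ≤ 3 * √c * M := by
  calc ∑ k ∈ s, √(c / n k) = √c * ∑ k ∈ s, 1 / √(n k) := by
        rw [mul_sum]
        exact sum_congr rfl fun k _ => by rw [Real.sqrt_div' _ (hn k), mul_one_div]
    _ ≤ √c * (3 * M) := mul_le_mul_of_nonneg_left h (Real.sqrt_nonneg _)
    _ = _ := by ring

/-- The bonuses of the visited points, summed over a run. -/
theorem sum_fullBonus_le (δ : ℝ) (K : ℕ) (X : Transcript H S₁ S₂ A B) :
    ∑ k ∈ Icc 1 K, ∑ h : Fin H, fullBonus δ K X (k - 1) h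
        (X.s₁ k h.castSucc, X.s₂ k h.castSucc) (X.a k h, X.b k h) ≤
      H * (3 * √(4 * Real.log ((Fintype.card S₁ : ℝ) * Fintype.card S₂ * Fintype.card A *
          Fintype.card B * H * K / δ)) *
          √((Fintype.card S₁ : ℝ) * Fintype.card S₂ * Fintype.card A * Fintype.card B * K) +
        (3 * √(2 * (H : ℝ) ^ 2 * Fintype.card S₁ *
          Real.log (2 * (Fintype.card S₁ : ℝ) * Fintype.card A * H * K / δ)) *
          √((Fintype.card S₁ : ℝ) * Fintype.card A * K) +
        3 * √(2 * (H : ℝ) ^ 2 * Fintype.card S₂ *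
          Real.log (2 * (Fintype.card S₂ : ℝ) * Fintype.card B * H * K / δ)) *
          √((Fintype.card S₂ : ℝ) * Fintype.card B * K))) := by
  rw [sum_comm]
  refine (sum_le_card_nsmul univ _ _ fun h _ => ?_).trans_eq (by rw [card_fin, nsmul_eq_mul])
  have h0 := sum_inv_sqrt_visits_le
    (fun τ => (X.s₁ τ h.castSucc, X.s₂ τ h.castSucc, X.a τ h, X.b τ h)) K
  have h1 := sum_inv_sqrt_visits_le (fun τ => (X.s₁ τ h.castSucc, X.a τ h)) K
  have h2 := sum_inv_sqrt_visits_le (fun τ => (X.s₂ τ h.castSucc, X.b τ h)) K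
  simp only [Prod.mk.injEq, Fintype.card_prod, Nat.cast_mul, ← mul_assoc] at h0 h1 h2
  simp only [fullBonus, bonusR, bonus₁, bonus₂, sum_add_distrib, count, count₁, count₂]
  refine add_le_add ?_ (add_le_add ?_ ?_)
  · exact sum_sqrt_div_le _ (fun k => by positivity) h0
  · exact sum_sqrt_div_le _ (fun k => by positivity) h1
  · exact sum_sqrt_div_le _ (fun k => by positivity) h2

/-- The regret of a run along which all estimates are accurate: the regret of mirror ascent, and
the bonuses expected under the policies of each episode given the earlier episodes. -/
theorem regret_le_of_accurate [Nonempty A] {G : Game H S₁ S₂ A B} {K : ℕ} {η δ : ℝ} {y₀ : S₂}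
    {X : Transcript H S₁ S₂ A B} (hH : 1 ≤ H) (hK : 1 ≤ K)
    (hη : η = √(Real.log (Fintype.card A) / (K * (H : ℝ) ^ 2))) (hy : y₀ = G.init₂)
    (hlog : 0 ≤ Real.log ((Fintype.card S₁ : ℝ) * Fintype.card S₂ * Fintype.card A *
      Fintype.card B * H * K / δ))
    (hlog₁ : 0 ≤ Real.log (2 * (Fintype.card S₁ : ℝ) * Fintype.card A * H * K / δ))
    (hlog₂ : 0 ≤ Real.log (2 * (Fintype.card S₂ : ℝ) * Fintype.card B * H * K / δ))
    (hν : ∀ k ≤ K, IsPolicy (X.ν k)) (hX : ∀ k ∈ Icc 1 K, Accurate G δ K X k) :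
    regret G K (policy η δ K y₀ X) X.ν ≤
      H * (2 * H * √(K * Real.log (Fintype.card A)) + H) +
        3 * ∑ k ∈ Icc 1 K, total (point (G.init₁, y₀)) (jointPolicy (policy η δ K y₀ X k) (X.ν k))
          (jointKernel G.P₁ G.P₂) (fullBonus δ K X (k - 1)) := by
  obtain ⟨π, hπ, hmax⟩ := exists_best_policy G K X.ν
  have hsup : (⨆ μ' : {π : Fin H → S₁ → A → ℝ // IsPolicy π},
      ∑ k ∈ Icc 1 K, value G μ'.1 (X.ν k) G.init₁ G.init₂) ≤
        ∑ k ∈ Icc 1 K, value G π (X.ν k) G.init₁ G.init₂ :=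
    haveI : Nonempty {π : Fin H → S₁ → A → ℝ // IsPolicy π} := ⟨⟨π, hπ⟩⟩
    ciSup_le fun μ' => hmax μ'.1 μ'.2
  subst hy
  refine (sub_le_sub_right hsup _).trans ?_
  rw [← sum_sub_distrib, mul_sum]
  have hep : ∀ k ∈ Icc 1 K, value G π (X.ν k) G.init₁ G.init₂ -
      value G (policy η δ K G.init₂ X k) (X.ν k) G.init₁ G.init₂ ≤
        ∑ h : Fin H, ∑ x, flow (point G.init₁) π G.P₁ h.castSucc x *
          ∑ a, (π h x a - policy η δ K G.init₂ X k h x a) *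
            gain δ K X k (policy η δ K G.init₂ X k) G.init₂ h x a +
        3 * total (point (G.init₁, G.init₂)) (jointPolicy (policy η δ K G.init₂ X k) (X.ν k))
          (jointKernel G.P₁ G.P₂) (fullBonus δ K X (k - 1)) := by
    intro k hk
    obtain ⟨hk1, hk2⟩ := mem_Icc.1 hk
    have hμ := isPolicy_policy η δ K G.init₂ X k
    refine ((hX k hk).value_sub_value_le (by omega) hμ (hν k hk2) hπ
      G.init₁ G.init₂).trans ?_
    refine add_le_add_right (mul_le_mul_of_nonneg_left ?_ (by norm_num)) _
    exact total_mono (point_mem _).1 (hμ.joint (hν k hk2)) (isSubkernel_joint_game G)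
      fun h z u => fullBonus_le_pred δ K X k hlog hlog₁ hlog₂ h z u
  refine (sum_le_sum hep).trans ?_
  rw [sum_add_distrib]
  refine add_le_add_left ?_ _
  rw [sum_comm]
  refine (sum_le_card_nsmul univ _ _ fun h _ => ?_).trans_eq (by rw [card_fin, nsmul_eq_mul])
  rw [sum_comm]
  simp only [← mul_sum]
  set Rg : ℝ := 2 * H * √(K * Real.log (Fintype.card A)) + H with hRg
  calc _ ≤ ∑ x, flow (point G.init₁) π G.P₁ h.castSucc x * Rg := by
        refine sum_le_sum fun x _ => mul_le_mul_of_nonneg_left ?_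
          (flow_nonneg (point_mem _).1 hπ (isSubkernel_of_mem G.P₁_mem) _ x)
        exact mirrorStep_regret_tuned hK (by exact_mod_cast hH) hη
          (fun k => policy η δ K G.init₂ X k h x)
          (fun k => gain δ K X k (policy η δ K G.init₂ X k) G.init₂ h x) rfl (fun k => rfl)
          (fun k => isPolicy_policy η δ K G.init₂ X k h x)
          (fun k hk a => gain_mem (hν k hk) _ _ h x a) (hπ h x)
    _ = Rg := by rw [← sum_mul, sum_flow_eq hπ G.P₁_mem, (point_mem _).2, one_mul]

end Regret

/-! ### Conditional means of bounded variables -/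

section CondMean

variable {Ω : Type*} {mΩ : MeasurableSpace Ω}

/-- Bounded functions measurable with respect to the σ-algebra `𝒢`. -/
structure BddMeas (𝒢 : MeasurableSpace Ω) (f : Ω → ℝ) : Prop where
  meas : Measurable[𝒢] f
  bdd : ∃ C, ∀ ω, |f ω| ≤ C

namespace BddMeas

variable {𝒢 𝒢' : MeasurableSpace Ω} {f g : Ω → ℝ}

theorem mono (hf : BddMeas 𝒢 f) (h : 𝒢 ≤ 𝒢') : BddMeas 𝒢' f := ⟨hf.meas.mono h le_rfl, hf.bdd⟩

theorem const (c : ℝ) : BddMeas 𝒢 fun _ => c := ⟨measurable_const, |c|, fun _ => le_rfl⟩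

theorem add (hf : BddMeas 𝒢 f) (hg : BddMeas 𝒢 g) : BddMeas 𝒢 fun ω => f ω + g ω := by
  obtain ⟨C, hC⟩ := hf.bdd
  obtain ⟨D, hD⟩ := hg.bdd
  exact ⟨hf.meas.add hg.meas, C + D, fun ω => (abs_add_le _ _).trans (add_le_add (hC ω) (hD ω))⟩

theorem mul (hf : BddMeas 𝒢 f) (hg : BddMeas 𝒢 g) : BddMeas 𝒢 fun ω => f ω * g ω := by
  obtain ⟨C, hC⟩ := hf.bdd
  obtain ⟨D, hD⟩ := hg.bdd
  exact ⟨hf.meas.mul hg.meas, C * D, fun ω => by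
    rw [abs_mul]
    exact mul_le_mul (hC ω) (hD ω) (abs_nonneg _) ((abs_nonneg _).trans (hC ω))⟩

theorem sub (hf : BddMeas 𝒢 f) (hg : BddMeas 𝒢 g) : BddMeas 𝒢 fun ω => f ω - g ω := by
  simpa [sub_eq_add_neg] using hf.add ((const (-1)).mul hg)

theorem exp (hf : BddMeas 𝒢 f) : BddMeas 𝒢 fun ω => Real.exp (f ω) := by
  obtain ⟨C, hC⟩ := hf.bdd
  exact ⟨hf.meas.exp, Real.exp C, fun ω => by
    rw [abs_of_pos (Real.exp_pos _)]
    exact Real.exp_le_exp.2 ((le_abs_self _).trans (hC ω))⟩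

theorem sum {ι : Type*} {s : Finset ι} {F : ι → Ω → ℝ} (hF : ∀ i ∈ s, BddMeas 𝒢 (F i)) :
    BddMeas 𝒢 fun ω => ∑ i ∈ s, F i ω := by
  classical
  induction s using Finset.induction_on with
  | empty => simpa using const (𝒢 := 𝒢) 0
  | insert i s hi ih =>
    simp only [sum_insert hi]
    exact (hF i (mem_insert_self i s)).add (ih fun j hj => hF j (mem_insert_of_mem hj))

theorem ite {p : Ω → Prop} [DecidablePred p] (hp : MeasurableSet[𝒢] {ω | p ω}) :
    BddMeas 𝒢 fun ω => if p ω then (1 : ℝ) else 0 :=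
  ⟨Measurable.ite hp measurable_const measurable_const, 1, fun ω => by split_ifs <;> simp⟩

theorem integrable (hf : BddMeas 𝒢 f) (h𝒢 : 𝒢 ≤ mΩ) (Pr : Measure[mΩ] Ω) [IsFiniteMeasure Pr] :
    Integrable f Pr := by
  obtain ⟨C, hC⟩ := hf.bdd
  exact Integrable.of_bound (mα := mΩ) (hf.meas.mono h𝒢 le_rfl).aestronglyMeasurable C
    (Filter.Eventually.of_forall hC)

end BddMeas

/-- `m` is a version of the conditional mean of the bounded variable `v` given `𝒢`, expressed by
integration against bounded `𝒢`-measurable functions. -/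
structure HasCondMean (Pr : Measure Ω) (𝒢 : MeasurableSpace Ω) (v m : Ω → ℝ) : Prop where
  left : BddMeas mΩ v
  right : BddMeas 𝒢 m
  integral_eq : ∀ g, BddMeas 𝒢 g → ∫ ω, g ω * v ω ∂Pr = ∫ ω, g ω * m ω ∂Pr

namespace HasCondMean

variable {Pr : Measure Ω} {𝒢 𝒢' : MeasurableSpace Ω} {v m m' : Ω → ℝ}

theorem refl (h𝒢 : 𝒢 ≤ mΩ) (hm : BddMeas 𝒢 m) : HasCondMean Pr 𝒢 m m :=
  ⟨hm.mono h𝒢, hm, fun _ _ => rfl⟩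

theorem mul_left {c : Ω → ℝ} (h𝒢 : 𝒢 ≤ mΩ) (hc : BddMeas 𝒢 c) (h : HasCondMean Pr 𝒢 v m) :
    HasCondMean Pr 𝒢 (fun ω => c ω * v ω) (fun ω => c ω * m ω) :=
  ⟨(hc.mono h𝒢).mul h.left, hc.mul h.right, fun g hg => by
    simpa only [mul_assoc] using h.integral_eq _ (hg.mul hc)⟩

/-- The tower property. -/
theorem trans (hle : 𝒢 ≤ 𝒢') (h : HasCondMean Pr 𝒢' v m) (h' : HasCondMean Pr 𝒢 m m') :
    HasCondMean Pr 𝒢 v m' :=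
  ⟨h.left, h'.right, fun g hg => (h.integral_eq g (hg.mono hle)).trans (h'.integral_eq g hg)⟩

variable [IsProbabilityMeasure Pr]

theorem of_condExp (h𝒢 : 𝒢 ≤ mΩ) (hv : BddMeas mΩ v) (hm : BddMeas 𝒢 m)
    (h : Pr[v | 𝒢] =ᵐ[Pr] m) : HasCondMean Pr 𝒢 v m := by
  refine ⟨hv, hm, fun g hg => ?_⟩
  have h1 := condExp_mul_of_stronglyMeasurable_left (μ := Pr) (f := g) (g := v)
    (hg.meas.stronglyMeasurable) (((hg.mono h𝒢).mul hv).integrable le_rfl Pr)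
    (hv.integrable le_rfl Pr)
  calc ∫ ω, g ω * v ω ∂Pr = ∫ ω, (Pr[fun ω => g ω * v ω | 𝒢]) ω ∂Pr :=
        (integral_condExp h𝒢).symm
    _ = ∫ ω, g ω * m ω ∂Pr := integral_congr_ae (by
        filter_upwards [h1, h] with ω h2 h3
        refine h2.trans ?_
        rw [Pi.mul_apply, h3])

theorem sum {ι : Type*} {s : Finset ι} {v m : ι → Ω → ℝ} (h𝒢 : 𝒢 ≤ mΩ)
    (h : ∀ i ∈ s, HasCondMean Pr 𝒢 (v i) (m i)) :
    HasCondMean Pr 𝒢 (fun ω => ∑ i ∈ s, v i ω) (fun ω => ∑ i ∈ s, m i ω) := by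
  refine ⟨BddMeas.sum fun i hi => (h i hi).left, BddMeas.sum fun i hi => (h i hi).right,
    fun g hg => ?_⟩
  simp only [mul_sum]
  rw [integral_finsetSum _ fun i hi => ((hg.mono h𝒢).mul (h i hi).left).integrable le_rfl Pr,
    integral_finsetSum _ fun i hi => (hg.mul (h i hi).right).integrable h𝒢 Pr]
  exact sum_congr rfl fun i hi => (h i hi).integral_eq g hg

end HasCondMean

/-! ### Deviations of sums of bounded variables -/

variable {Pr : Measure Ω} [IsProbabilityMeasure Pr]

/-- The exponential supermartingale of a sequence of variables in `[-1, 1]` that are switched on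
and off by the predictable indicators `I`. -/
theorem integral_exp_sum_le_one {𝒢 : ℕ → MeasurableSpace Ω} (h𝒢 : ∀ τ, 𝒢 τ ≤ mΩ)
    (hmono : Monotone 𝒢) {I v m : ℕ → Ω → ℝ} {K : ℕ}
    (hI : ∀ τ ∈ Icc 1 K, BddMeas (𝒢 τ) (I τ))
    (hI01 : ∀ τ ∈ Icc 1 K, ∀ ω, I τ ω = 0 ∨ I τ ω = 1)
    (hv : ∀ τ ∈ Icc 1 K, HasCondMean Pr (𝒢 τ) (v τ) (m τ))
    (hvm : ∀ τ ∈ Icc 1 K, Measurable[𝒢 (τ + 1)] (v τ))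
    (hv1 : ∀ τ ∈ Icc 1 K, ∀ ω, |v τ ω| ≤ 1) (hm1 : ∀ τ ∈ Icc 1 K, ∀ ω, |m τ ω| ≤ 1) (t : ℝ)
    {k : ℕ} (hk : k ≤ K) :
    ∫ ω, Real.exp (∑ τ ∈ Icc 1 k, I τ ω * (t * (v τ ω - m τ ω) - t ^ 2 / 2)) ∂Pr ≤ 1 := by
  induction k with
  | zero => simp
  | succ k ih =>
    have hmem : k + 1 ∈ Icc 1 K := mem_Icc.2 ⟨by omega, hk⟩
    set M : Ω → ℝ := fun ω =>
      Real.exp (∑ τ ∈ Icc 1 k, I τ ω * (t * (v τ ω - m τ ω) - t ^ 2 / 2)) with hM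
    have hMm : BddMeas (𝒢 (k + 1)) M := by
      refine (BddMeas.sum fun τ hτ => ?_).exp
      obtain ⟨hτ1, hτ2⟩ := mem_Icc.1 hτ
      have hτK : τ ∈ Icc 1 K := mem_Icc.2 ⟨hτ1, by omega⟩
      have h1 : BddMeas (𝒢 (k + 1)) (v τ) :=
        ⟨(hvm τ hτK).mono (hmono (by omega)) le_rfl, (hv τ hτK).left.bdd⟩
      exact ((hI τ hτK).mono (hmono (by omega))).mul
        (((BddMeas.const t).mul (h1.sub ((hv τ hτK).right.mono (hmono (by omega))))).sub
          (BddMeas.const _))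
    set i := I (k + 1) with hi
    set w := v (k + 1) with hw
    set q := m (k + 1) with hq
    have hqm : BddMeas (𝒢 (k + 1)) q := (hv _ hmem).right
    -- `v` enters the chord bound linearly, so it may be replaced by its conditional mean.
    set J : Ω → ℝ := fun ω => Real.exp (-(t * q ω) - t ^ 2 / 2) with hJ
    have hJm : BddMeas (𝒢 (k + 1)) J := by
      have := (((BddMeas.const (-t)).mul hqm).sub (BddMeas.const (t ^ 2 / 2))).exp
      simpa only [neg_mul] using this
    have hstep : ∀ ω, Real.exp (∑ τ ∈ Icc 1 (k + 1), I τ ω * (t * (v τ ω - m τ ω) - t ^ 2 / 2)) ≤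
        M ω * (1 - i ω) + M ω * i ω * J ω * Real.cosh t +
          M ω * i ω * J ω * Real.sinh t * w ω := by
      intro ω
      rw [sum_Icc_succ_top (by omega), Real.exp_add]
      have hMpos : 0 < M ω := Real.exp_pos _
      rcases hI01 _ hmem ω with h | h
      · have h4 : i ω = 0 := h
        rw [← hi, h4]
        simp [hM]
      · have h1 := exp_mul_le_cosh_add (hv1 _ hmem ω) t
        have h2 : Real.exp (t * (w ω - q ω) - t ^ 2 / 2) = J ω * Real.exp (t * w ω) := by
          rw [hJ, ← Real.exp_add]
          congr 1
          ring
        have h3 := mul_le_mul_of_nonneg_left h1 (mul_pos hMpos (Real.exp_pos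
          (-(t * q ω) - t ^ 2 / 2))).le
        have h4 : i ω = 1 := h
        rw [← hi, ← hw, ← hq, h4, one_mul, h2]
        calc _ = M ω * J ω * Real.exp (t * w ω) := by rw [hM]; ring
          _ ≤ M ω * J ω * (Real.cosh t + w ω * Real.sinh t) := h3
          _ = _ := by ring
    have him := hI _ hmem
    have hA : BddMeas (𝒢 (k + 1)) fun ω => M ω * (1 - i ω) + M ω * i ω * J ω * Real.cosh t :=
      (hMm.mul ((BddMeas.const 1).sub him)).add (((hMm.mul him).mul hJm).mul (BddMeas.const _))
    have hB : BddMeas (𝒢 (k + 1)) fun ω => M ω * i ω * J ω * Real.sinh t :=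
      ((hMm.mul him).mul hJm).mul (BddMeas.const _)
    have hAi := hA.integrable (h𝒢 _) Pr
    have hBw := ((hB.mono (h𝒢 _)).mul (hv _ hmem).left).integrable le_rfl Pr
    have hBq := (hB.mul hqm).integrable (h𝒢 _) Pr
    refine le_trans ?_ (ih (by omega))
    calc _ ≤ ∫ ω, (M ω * (1 - i ω) + M ω * i ω * J ω * Real.cosh t +
          M ω * i ω * J ω * Real.sinh t * w ω) ∂Pr := by
          refine integral_mono_of_nonneg (Filter.Eventually.of_forall fun ω => (Real.exp_pos _).le)
            (hAi.add hBw) (Filter.Eventually.of_forall hstep)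
      _ = ∫ ω, (M ω * (1 - i ω) + M ω * i ω * J ω * Real.cosh t +
          M ω * i ω * J ω * Real.sinh t * q ω) ∂Pr := by
          rw [integral_add hAi hBw, integral_add hAi hBq, (hv _ hmem).integral_eq _ hB]
      _ ≤ ∫ ω, M ω ∂Pr := by
          refine integral_mono (hAi.add hBq) (hMm.integrable (h𝒢 _) Pr) fun ω => ?_
          have hMpos : 0 < M ω := Real.exp_pos _
          have h1 : J ω * (Real.cosh t + q ω * Real.sinh t) ≤ 1 := by
            refine (mul_le_mul_of_nonneg_left (cosh_add_mul_sinh_le (hm1 _ hmem ω) t)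
              (Real.exp_pos _).le).trans (le_of_eq ?_)
            rw [← Real.exp_add, ← Real.exp_zero]
            congr 1
            rw [← hq]
            ring
          have h2 : 0 ≤ i ω := by rcases hI01 _ hmem ω with h | h <;> simp [hi, h]
          have h3 := mul_le_mul_of_nonneg_left h1 (mul_nonneg hMpos.le h2)
          simp only
          linarith

/-- The Hoeffding bound when at most `n` variables are switched on. -/
theorem prob_sum_ge_le {𝒢 : ℕ → MeasurableSpace Ω} (h𝒢 : ∀ τ, 𝒢 τ ≤ mΩ)
    (hmono : Monotone 𝒢) {I v m : ℕ → Ω → ℝ} {K : ℕ}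
    (hI : ∀ τ ∈ Icc 1 K, BddMeas (𝒢 τ) (I τ))
    (hI01 : ∀ τ ∈ Icc 1 K, ∀ ω, I τ ω = 0 ∨ I τ ω = 1)
    (hv : ∀ τ ∈ Icc 1 K, HasCondMean Pr (𝒢 τ) (v τ) (m τ))
    (hvm : ∀ τ ∈ Icc 1 K, Measurable[𝒢 (τ + 1)] (v τ))
    (hv1 : ∀ τ ∈ Icc 1 K, ∀ ω, |v τ ω| ≤ 1) (hm1 : ∀ τ ∈ Icc 1 K, ∀ ω, |m τ ω| ≤ 1)
    {n ε : ℝ} (hn : 0 < n) (hε : 0 ≤ ε) (hIn : ∀ ω, ∑ τ ∈ Icc 1 K, I τ ω ≤ n) :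
    Pr.real {ω | ε ≤ ∑ τ ∈ Icc 1 K, I τ ω * (v τ ω - m τ ω)} ≤ Real.exp (-(ε ^ 2 / (2 * n))) := by
  -- The optimal exponent.
  set t := ε / n with ht
  set F : Ω → ℝ := fun ω =>
    Real.exp (∑ τ ∈ Icc 1 K, I τ ω * (t * (v τ ω - m τ ω) - t ^ 2 / 2)) with hF
  have hFint : Integrable F Pr := by
    refine BddMeas.integrable (𝒢 := mΩ) (BddMeas.sum fun τ hτ => ?_).exp le_rfl Pr
    exact ((hI τ hτ).mono (h𝒢 τ)).mul
      (((BddMeas.const t).mul ((hv τ hτ).left.sub ((hv τ hτ).right.mono (h𝒢 τ)))).sub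
        (BddMeas.const _))
  have h1 := mul_meas_ge_le_integral_of_nonneg (μ := Pr) (f := F)
    (Filter.Eventually.of_forall fun ω => (Real.exp_pos _).le) hFint (Real.exp (ε ^ 2 / (2 * n)))
  have h2 := integral_exp_sum_le_one h𝒢 hmono hI hI01 hv hvm hv1 hm1 t le_rfl
  have hsub : {ω | ε ≤ ∑ τ ∈ Icc 1 K, I τ ω * (v τ ω - m τ ω)} ⊆
      {ω | Real.exp (ε ^ 2 / (2 * n)) ≤ F ω} := by
    intro ω hω
    simp only [Set.mem_ofPred_eq] at hω ⊢
    refine Real.exp_le_exp.2 ?_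
    have h3 : ∑ τ ∈ Icc 1 K, I τ ω * (t * (v τ ω - m τ ω) - t ^ 2 / 2) =
        t * ∑ τ ∈ Icc 1 K, I τ ω * (v τ ω - m τ ω) - t ^ 2 / 2 * ∑ τ ∈ Icc 1 K, I τ ω := by
      rw [mul_sum, mul_sum, ← sum_sub_distrib]
      exact sum_congr rfl fun τ _ => by ring
    have h4 : 0 ≤ t := div_nonneg hε hn.le
    have h5 := mul_le_mul_of_nonneg_left hω h4
    have h6 := mul_le_mul_of_nonneg_left (hIn ω) (by positivity : 0 ≤ t ^ 2 / 2)
    have h7 : ε ^ 2 / (2 * n) = t * ε - t ^ 2 / 2 * n := by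
      rw [ht]
      field_simp
      ring
    rw [h3, h7]
    linarith
  rw [Real.exp_neg, ← one_div, le_div_iff₀ (Real.exp_pos _), mul_comm]
  exact (mul_le_mul_of_nonneg_left (measureReal_mono hsub) (Real.exp_pos _).le).trans
    (h1.trans h2)

section Visits

/-- Along a sequence of visits, the visits preceded by fewer than `n` others number at most `n`. -/
theorem card_visits_lt (P : ℕ → Prop) [DecidablePred P] (n k : ℕ) :
    #{τ ∈ Icc 1 k | P τ ∧ #{σ ∈ Icc 1 (τ - 1) | P σ} < n} = min #{τ ∈ Icc 1 k | P τ} n := by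
  induction k with
  | zero => simp
  | succ k ih =>
    rw [← Finset.insert_Icc_right_eq_Icc_add_one (by omega : 1 ≤ k + 1), filter_insert,
      filter_insert]
    simp only [Nat.add_sub_cancel]
    by_cases h : P (k + 1)
    · by_cases h' : #{τ ∈ Icc 1 k | P τ} < n
      · simp only [h, h', and_self, if_true]
        rw [card_insert_of_notMem (by simp), card_insert_of_notMem (by simp), ih]
        omega
      · simp only [h, h', and_false, if_false, if_true]
        rw [card_insert_of_notMem (by simp), ih]
        omega
    · simpa only [h, false_and, if_false] using ih

/-- If there are exactly `n` visits up to time `k`, they are the visits, at any time, that are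
preceded by fewer than `n` others. -/
theorem sum_visits_lt (P : ℕ → Prop) [DecidablePred P] {n k K : ℕ} (hk : k ≤ K) (hn : #{τ ∈ Icc 1 k | P τ} = n)
    (f : ℕ → ℝ) :
    ∑ τ ∈ Icc 1 K, (if P τ ∧ #{σ ∈ Icc 1 (τ - 1) | P σ} < n then 1 else 0) * f τ =
      ∑ τ ∈ Icc 1 k, if P τ then f τ else 0 := by
  symm
  rw [← sum_subset (Icc_subset_Icc_right hk)]
  · refine sum_congr rfl fun τ hτ => ?_
    obtain ⟨h1, h2⟩ := mem_Icc.1 hτ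
    by_cases h : P τ
    · have : #{σ ∈ Icc 1 (τ - 1) | P σ} < n := by
        rw [← hn]
        refine card_lt_card ⟨fun σ hσ => ?_, fun hsub => ?_⟩
        · simp only [mem_filter, mem_Icc] at hσ ⊢
          exact ⟨⟨hσ.1.1, by omega⟩, hσ.2⟩
        · have := hsub (mem_filter.2 ⟨hτ, h⟩)
          simp only [mem_filter, mem_Icc] at this
          omega
      simp [h, this]
    · simp [h]
  · intro τ hτ hτk
    obtain ⟨h1, h2⟩ := mem_Icc.1 hτ
    have h3 : k ≤ τ - 1 := by
      by_contra hc
      exact hτk (mem_Icc.2 ⟨h1, by omega⟩)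
    have : n ≤ #{σ ∈ Icc 1 (τ - 1) | P σ} := by
      rw [← hn]
      exact card_le_card (filter_subset_filter _ (Icc_subset_Icc_right h3))
    simp [this.not_gt]

/-- The Hoeffding bound for the sum over the first `n` visits. The number of visits is random, but
no union over the time of the last visit is needed, because later visits are switched off. -/
theorem prob_visits_ge_le {𝒢 : ℕ → MeasurableSpace Ω} (h𝒢 : ∀ τ, 𝒢 τ ≤ mΩ)
    (hmono : Monotone 𝒢) {P : ℕ → Ω → Prop} [∀ τ ω, Decidable (P τ ω)]
    {v m : ℕ → Ω → ℝ} {K : ℕ} (hP : ∀ τ ∈ Icc 1 K, MeasurableSet[𝒢 τ] {ω | P τ ω})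
    (hv : ∀ τ ∈ Icc 1 K, HasCondMean Pr (𝒢 τ) (v τ) (m τ))
    (hvm : ∀ τ ∈ Icc 1 K, Measurable[𝒢 (τ + 1)] (v τ))
    (hv1 : ∀ τ ∈ Icc 1 K, ∀ ω, |v τ ω| ≤ 1) (hm1 : ∀ τ ∈ Icc 1 K, ∀ ω, |m τ ω| ≤ 1)
    {n : ℕ} {ε : ℝ} (hn : 0 < n) (hε : 0 ≤ ε) :
    Pr.real {ω | ∃ k ≤ K, #{τ ∈ Icc 1 k | P τ ω} = n ∧
      ε ≤ ∑ τ ∈ Icc 1 k, if P τ ω then v τ ω - m τ ω else 0} ≤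
      Real.exp (-(ε ^ 2 / (2 * n))) := by
  have hN : ∀ τ ∈ Icc 1 K, MeasurableSet[𝒢 τ]
      {ω | P τ ω ∧ #{σ ∈ Icc 1 (τ - 1) | P σ ω} < n} := by
    intro τ hτ
    obtain ⟨h1, h2⟩ := mem_Icc.1 hτ
    refine (hP τ hτ).inter ?_
    have : Measurable[𝒢 τ] fun ω => #{σ ∈ Icc 1 (τ - 1) | P σ ω} := by
      simp only [card_filter]
      refine Finset.measurable_sum _ fun σ hσ => ?_
      obtain ⟨h3, h4⟩ := mem_Icc.1 hσ
      exact Measurable.ite (hmono (by omega : σ ≤ τ) _ (hP σ (mem_Icc.2 ⟨h3, by omega⟩)))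
        measurable_const measurable_const
    exact this (measurableSet_Iio (a := n))
  refine (measureReal_mono ?_).trans (prob_sum_ge_le h𝒢 hmono
    (I := fun τ ω => if P τ ω ∧ #{σ ∈ Icc 1 (τ - 1) | P σ ω} < n then 1 else 0)
    (fun τ hτ => BddMeas.ite (hN τ hτ)) (fun τ _ ω => by split_ifs <;> simp)
    hv hvm hv1 hm1 (n := n) (by exact_mod_cast hn) hε fun ω => ?_)
  · rintro ω ⟨k, hk, hkn, hsum⟩
    simp only [Set.mem_ofPred_eq]
    rwa [sum_visits_lt (fun τ => P τ ω) hk hkn]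
  · rw [← natCast_card_filter]
    exact_mod_cast (card_visits_lt (fun τ => P τ ω) n K).trans_le (min_le_right _ _)

/-- The `ℓ¹` distance of empirical frequencies to a probability vector, as a sum over the sample
for a suitable choice of signs. -/
theorem exists_signs_abs_sum_eq {S : Type*} [Fintype S] [DecidableEq S] (P : ℕ → Prop)
    [DecidablePred P] (s : ℕ → S) (p : S → ℝ) {k : ℕ} (hN : 0 < #{τ ∈ Icc 1 k | P τ}) :
    ∃ σ : S → Bool, (#{τ ∈ Icc 1 k | P τ} : ℝ) *
        ∑ x, |(#{τ ∈ Icc 1 k | P τ ∧ s τ = x} : ℝ) / #{τ ∈ Icc 1 k | P τ} - p x| =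
      ∑ τ ∈ Icc 1 k, if P τ then (if σ (s τ) then 1 else -1) - ∑ x, p x * (if σ x then 1 else -1)
        else 0 := by
  set N := #{τ ∈ Icc 1 k | P τ} with hNdef
  have hN' : (N : ℝ) ≠ 0 := by exact_mod_cast hN.ne'
  set f : S → ℝ := fun x => (#{τ ∈ Icc 1 k | P τ ∧ s τ = x} : ℝ) with hf
  set g : S → ℝ := fun x => if p x ≤ f x / N then 1 else -1 with hg
  refine ⟨fun x => decide (p x ≤ f x / N), ?_⟩
  simp only [decide_eq_true_eq]
  have h1 : ∀ x, |f x / N - p x| = (f x / N - p x) * g x := by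
    intro x
    simp only [hg]
    split_ifs with h
    · rw [abs_of_nonneg (by linarith), mul_one]
    · rw [abs_of_neg (by linarith)]
      ring
  have h2 : ∑ τ ∈ Icc 1 k, (if P τ then g (s τ) else 0) = ∑ x, f x * g x := by
    simp only [hf, natCast_card_filter, sum_mul]
    rw [sum_comm]
    refine sum_congr rfl fun τ _ => ?_
    by_cases h : P τ <;> simp [h]
  have h3 : ∀ τ, (if P τ then g (s τ) - ∑ x, p x * g x else 0) =
      (if P τ then g (s τ) else 0) - (if P τ then 1 else 0) * ∑ x, p x * g x := by
    intro τ
    split_ifs <;> simp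
  change (N : ℝ) * ∑ x, |f x / N - p x| =
    ∑ τ ∈ Icc 1 k, if P τ then g (s τ) - ∑ x, p x * g x else 0
  simp only [h1, h3, sum_sub_distrib, h2, ← sum_mul, ← natCast_card_filter]
  rw [← hNdef, mul_sum, mul_sum, ← sum_sub_distrib]
  refine sum_congr rfl fun x _ => ?_
  field_simp

/-- Uniform `ℓ¹` concentration (Weissman's inequality) of the empirical frequencies of the outcomes
`s j` at the visits `P j`, for all `j` and all times at once. -/
theorem prob_l1_deviation_le {J S : Type*} [Fintype J] [Fintype S] [DecidableEq S] [Nonempty S]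
    [Nonempty J] {𝒢 : J → ℕ → MeasurableSpace Ω} (h𝒢 : ∀ j τ, 𝒢 j τ ≤ mΩ)
    (hmono : ∀ j, Monotone (𝒢 j)) {P : J → ℕ → Ω → Prop} [∀ j τ ω, Decidable (P j τ ω)]
    {s : J → ℕ → Ω → S} {p : J → S → ℝ} {q : J → ℕ → Ω → S → ℝ} {K : ℕ} (hK : 1 ≤ K)
    (hP : ∀ j, ∀ τ ∈ Icc 1 K, MeasurableSet[𝒢 j τ] {ω | P j τ ω})
    (hs : ∀ j, ∀ τ ∈ Icc 1 K, ∀ x, MeasurableSet[𝒢 j (τ + 1)] {ω | s j τ ω = x})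
    (hq : ∀ j, ∀ τ ∈ Icc 1 K, ∀ ω, q j τ ω ∈ stdSimplex ℝ S)
    (hpq : ∀ j, ∀ τ ∈ Icc 1 K, ∀ ω, P j τ ω → q j τ ω = p j)
    (hcond : ∀ j, ∀ τ ∈ Icc 1 K, ∀ φ : S → ℝ, HasCondMean Pr (𝒢 j τ) (fun ω => φ (s j τ ω))
      (fun ω => ∑ x, q j τ ω x * φ x))
    {δ : ℝ} (hδ : 0 < δ) (hδ1 : δ ≤ 1) :
    Pr.real {ω | ∃ k ≤ K, ∃ j, 0 < #{τ ∈ Icc 1 k | P j τ ω} ∧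
      √(2 * Fintype.card S * Real.log (2 * Fintype.card J * K / δ) / #{τ ∈ Icc 1 k | P j τ ω}) <
        ∑ x, |(#{τ ∈ Icc 1 k | P j τ ω ∧ s j τ ω = x} : ℝ) / #{τ ∈ Icc 1 k | P j τ ω} - p j x|} ≤
      δ := by
  set l := Real.log (2 * Fintype.card J * K / δ) with hl
  -- The union is over the point `j`, the number of visits and the signs.
  set E : J × Fin K × (S → Bool) → Set Ω := fun i => {ω | ∃ k ≤ K,
    #{τ ∈ Icc 1 k | P i.1 τ ω} = (i.2.1 : ℕ) + 1 ∧
      √(2 * Fintype.card S * l * ((i.2.1 : ℕ) + 1 : ℕ)) ≤ ∑ τ ∈ Icc 1 k, if P i.1 τ ω then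
        (if i.2.2 (s i.1 τ ω) then 1 else -1) -
          ∑ x, q i.1 τ ω x * (if i.2.2 x then 1 else -1) else 0} with hE
  have hJ : (1 : ℝ) ≤ Fintype.card J := by exact_mod_cast Fintype.card_pos
  have hS : 1 ≤ Fintype.card S := Fintype.card_pos
  have hK' : (1 : ℝ) ≤ K := by exact_mod_cast hK
  set M : ℝ := Fintype.card J * K with hM
  have hM1 : 1 ≤ M := by nlinarith
  have hl0 : 0 ≤ l := Real.log_nonneg (by
    rw [le_div_iff₀ hδ, mul_assoc, ← hM]
    linarith)
  have hsub : {ω | ∃ k ≤ K, ∃ j, 0 < #{τ ∈ Icc 1 k | P j τ ω} ∧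
      √(2 * Fintype.card S * l / #{τ ∈ Icc 1 k | P j τ ω}) <
        ∑ x, |(#{τ ∈ Icc 1 k | P j τ ω ∧ s j τ ω = x} : ℝ) / #{τ ∈ Icc 1 k | P j τ ω} - p j x|} ⊆
      ⋃ i, E i := by
    rintro ω ⟨k, hk, j, hN, hlt⟩
    obtain ⟨σ, hσ⟩ := exists_signs_abs_sum_eq (fun τ => P j τ ω) (fun τ => s j τ ω) (p j) hN
    have hNK : #{τ ∈ Icc 1 k | P j τ ω} ≤ K := (card_filter_le _ _).trans (by simpa using hk)
    refine Set.mem_iUnion.2 ⟨(j, ⟨#{τ ∈ Icc 1 k | P j τ ω} - 1, by omega⟩, σ), k, hk, ?_, ?_⟩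
    · simp only
      omega
    · simp only
      rw [Nat.sub_add_cancel hN]
      have h1 : ∑ τ ∈ Icc 1 k, (if P j τ ω then (if σ (s j τ ω) then (1 : ℝ) else -1) -
          ∑ x, q j τ ω x * (if σ x then 1 else -1) else 0) =
          ∑ τ ∈ Icc 1 k, if P j τ ω then (if σ (s j τ ω) then 1 else -1) -
          ∑ x, p j x * (if σ x then 1 else -1) else 0 := by
        refine sum_congr rfl fun τ hτ => ?_
        by_cases h : P j τ ω
        · rw [if_pos h, if_pos h, hpq j τ (Icc_subset_Icc_right hk hτ) ω h]
        · rw [if_neg h, if_neg h]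
      rw [h1, ← hσ]
      have hN' : (0 : ℝ) < #{τ ∈ Icc 1 k | P j τ ω} := by exact_mod_cast hN
      refine le_trans (le_of_eq ?_) (mul_le_mul_of_nonneg_left hlt.le hN'.le)
      rw [Real.sqrt_div' _ hN'.le, Real.sqrt_mul' _ hN'.le]
      have h2 := Real.mul_self_sqrt hN'.le
      have h3 := Real.sqrt_pos.2 hN'
      field_simp
      rw [sq, h2]
  have hEi : ∀ i, Pr.real (E i) ≤ Real.exp (-(Fintype.card S * l)) := by
    rintro ⟨j, n, σ⟩
    have hg : ∀ x, |(if σ x then (1 : ℝ) else -1)| ≤ 1 := fun x => by split_ifs <;> simp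
    refine (prob_visits_ge_le (h𝒢 j) (hmono j) (P := P j)
      (v := fun τ ω => if σ (s j τ ω) then (1 : ℝ) else -1)
      (m := fun τ ω => ∑ x, q j τ ω x * (if σ x then 1 else -1)) (hP j)
      (fun τ hτ => hcond j τ hτ fun x => if σ x then 1 else -1) (fun τ hτ => ?_)
      (fun τ _ ω => hg _) (fun τ hτ ω => ?_) (n := (n : ℕ) + 1) (Nat.succ_pos _)
      (Real.sqrt_nonneg _)).trans (Real.exp_le_exp.2 (neg_le_neg (le_of_eq ?_)))
    · refine Measurable.ite ?_ measurable_const measurable_const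
      have : {ω | σ (s j τ ω) = true} = ⋃ x ∈ {x | σ x = true}, {ω | s j τ ω = x} := by
        ext ω
        simp
      rw [this]
      exact MeasurableSet.biUnion (Set.to_countable _) fun x _ => hs j τ hτ x
    · refine (abs_sum_le_sum_abs _ _).trans
        ((sum_le_sum fun x _ => ?_).trans_eq (hq j τ hτ ω).2)
      rw [abs_mul, abs_of_nonneg ((hq j τ hτ ω).1 x)]
      exact mul_le_of_le_one_right ((hq j τ hτ ω).1 x) (hg x)
    · rw [Real.sq_sqrt (by positivity)]
      push_cast
      field_simp
  calc _ ≤ Pr.real (⋃ i, E i) := measureReal_mono hsub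
    _ ≤ ∑ i, Pr.real (E i) := measureReal_iUnion_fintype_le _
    _ ≤ ∑ _i : J × Fin K × (S → Bool), Real.exp (-(Fintype.card S * l)) :=
        sum_le_sum fun i _ => hEi i
    _ = M * (2 * Real.exp (-l)) ^ Fintype.card S := by
        rw [sum_const, card_univ, nsmul_eq_mul, mul_pow, ← Real.exp_nat_mul]
        simp [Fintype.card_prod, hM]
        ring
    _ = M * (δ / M) ^ Fintype.card S := by
        rw [Real.exp_neg, Real.exp_log (by rw [mul_assoc, ← hM]; positivity), mul_assoc 2, ← hM]
        congr 2
        field_simp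
    _ ≤ M * (δ / M) := by
        refine mul_le_mul_of_nonneg_left ?_ (by linarith)
        exact pow_le_of_le_one (by positivity) (div_le_one_of_le₀ (by linarith) (by linarith))
          (by omega)
    _ = δ := by field_simp

end Visits

end CondMean

/-! ### Measurability of the algorithm -/

section Measurability

variable {H : ℕ} {S₁ S₂ A B : Type*} [Fintype S₁] [Fintype S₂] [Fintype A] [Fintype B]
  [DecidableEq S₁] [DecidableEq S₂] [DecidableEq A] [DecidableEq B]
  {Ω : Type*}

/-- The data of the episodes `1, …, k` are measurable with respect to `𝒢`. -/
structure DataMeas (𝒢 : MeasurableSpace Ω) (X : Ω → Transcript H S₁ S₂ A B) (k : ℕ) : Prop where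
  s₁ : ∀ τ ∈ Icc 1 k, ∀ h x, MeasurableSet[𝒢] {ω | (X ω).s₁ τ h = x}
  s₂ : ∀ τ ∈ Icc 1 k, ∀ h y, MeasurableSet[𝒢] {ω | (X ω).s₂ τ h = y}
  a : ∀ τ ∈ Icc 1 k, ∀ h a, MeasurableSet[𝒢] {ω | (X ω).a τ h = a}
  b : ∀ τ ∈ Icc 1 k, ∀ h b, MeasurableSet[𝒢] {ω | (X ω).b τ h = b}
  reward : ∀ τ ∈ Icc 1 k, ∀ h, Measurable[𝒢] fun ω => (X ω).reward τ h

variable {𝒢 : MeasurableSpace Ω} {X : Ω → Transcript H S₁ S₂ A B} {k : ℕ} {δ η : ℝ} {K : ℕ}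

theorem DataMeas.anti (hX : DataMeas 𝒢 X k) {j : ℕ} (hj : j ≤ k) : DataMeas 𝒢 X j :=
  have h : ∀ τ ∈ Icc 1 j, τ ∈ Icc 1 k := fun _ hτ => Icc_subset_Icc_right hj hτ
  ⟨fun τ hτ => hX.s₁ τ (h τ hτ), fun τ hτ => hX.s₂ τ (h τ hτ), fun τ hτ => hX.a τ (h τ hτ),
    fun τ hτ => hX.b τ (h τ hτ), fun τ hτ => hX.reward τ (h τ hτ)⟩

theorem measurable_card_filter {s : Finset ℕ} {P : ℕ → Ω → Prop} [∀ τ ω, Decidable (P τ ω)]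
    (hP : ∀ τ ∈ s, MeasurableSet {ω | P τ ω}) :
    Measurable fun ω => (#{τ ∈ s | P τ ω} : ℝ) := by
  simp only [natCast_card_filter]
  exact Finset.measurable_sum _ fun τ hτ =>
    Measurable.ite (hP τ hτ) measurable_const measurable_const

namespace DataMeas

theorem visit (hX : DataMeas 𝒢 X k) {τ : ℕ} (hτ : τ ∈ Icc 1 k) (h : Fin H) (x : S₁) (y : S₂)
    (a : A) (b : B) : MeasurableSet {ω | (X ω).s₁ τ h.castSucc = x ∧ (X ω).s₂ τ h.castSucc = y ∧
      (X ω).a τ h = a ∧ (X ω).b τ h = b} :=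
  (hX.s₁ τ hτ _ x).inter ((hX.s₂ τ hτ _ y).inter ((hX.a τ hτ h a).inter (hX.b τ hτ h b)))

theorem count (hX : DataMeas 𝒢 X k) (h : Fin H) (x : S₁) (y : S₂) (a : A) (b : B) :
    Measurable fun ω => (count (X ω) k h x y a b : ℝ) :=
  measurable_card_filter fun _ hτ => hX.visit hτ h x y a b

theorem count₁ (hX : DataMeas 𝒢 X k) (h : Fin H) (x : S₁) (a : A) :
    Measurable fun ω => (count₁ (X ω) k h x a : ℝ) :=
  measurable_card_filter fun τ hτ => (hX.s₁ τ hτ _ x).inter (hX.a τ hτ h a)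

theorem count₂ (hX : DataMeas 𝒢 X k) (h : Fin H) (y : S₂) (b : B) :
    Measurable fun ω => (count₂ (X ω) k h y b : ℝ) :=
  measurable_card_filter fun τ hτ => (hX.s₂ τ hτ _ y).inter (hX.b τ hτ h b)

theorem rHat (hX : DataMeas 𝒢 X k) (h : Fin H) (x : S₁) (y : S₂) (a : A) (b : B) :
    Measurable fun ω => rHat (X ω) k h x y a b :=
  (Finset.measurable_sum _ fun τ hτ => Measurable.ite (hX.visit hτ h x y a b)
    (hX.reward τ hτ h) measurable_const).div ((hX.count h x y a b).max measurable_const)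

theorem pHat₁ (hX : DataMeas 𝒢 X k) (h : Fin H) (x : S₁) (a : A) (x' : S₁) :
    Measurable fun ω => pHat₁ (X ω) k h x a x' := by
  unfold FactoredMG.pHat₁
  refine Measurable.ite (MeasurableSet.const _) measurable_const ?_
  refine Measurable.div (measurable_card_filter fun τ hτ => ?_)
    ((hX.count₁ h x a).max measurable_const)
  exact (hX.s₁ τ hτ _ x).inter ((hX.a τ hτ h a).inter (hX.s₁ τ hτ _ x'))

theorem pHat₂ (hX : DataMeas 𝒢 X k) (h : Fin H) (y : S₂) (b : B) (y' : S₂) :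
    Measurable fun ω => pHat₂ (X ω) k h y b y' := by
  unfold FactoredMG.pHat₂
  refine Measurable.ite (MeasurableSet.const _) measurable_const ?_
  refine Measurable.div (measurable_card_filter fun τ hτ => ?_)
    ((hX.count₂ h y b).max measurable_const)
  exact (hX.s₂ τ hτ _ y).inter ((hX.b τ hτ h b).inter (hX.s₂ τ hτ _ y'))

theorem fullBonus (hX : DataMeas 𝒢 X k) (δ : ℝ) (K : ℕ) (h : Fin H) (z : S₁ × S₂) (u : A × B) :
    Measurable fun ω => fullBonus δ K (X ω) k h z u := by
  have h1 := (hX.count h z.1 z.2 u.1 u.2).max measurable_const (g := fun _ => (1 : ℝ))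
  have h2 := (hX.count₁ h z.1 u.1).max measurable_const (g := fun _ => (1 : ℝ))
  have h3 := (hX.count₂ h z.2 u.2).max measurable_const (g := fun _ => (1 : ℝ))
  exact (measurable_const.div h1).sqrt.add
    ((measurable_const.div h2).sqrt.add (measurable_const.div h3).sqrt)

theorem qStep (hX : DataMeas 𝒢 X k) {V : Ω → S₁ → S₂ → ℝ} (hV : ∀ x y, Measurable fun ω => V ω x y)
    (h : Fin H) (x : S₁) (y : S₂) (a : A) (b : B) :
    Measurable fun ω => qStep δ K (X ω) k h (V ω) x y a b := by
  have hb : Measurable fun ω => bonus δ K (X ω) k h x y a b :=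
    Measurable.ite (MeasurableSet.const _) measurable_const (hX.fullBonus δ K h (x, y) (a, b))
  refine Measurable.max (Measurable.min (((hX.rHat h x y a b).add ?_).add hb) measurable_const)
    measurable_const
  exact Finset.measurable_sum _ fun x' _ => Finset.measurable_sum _ fun y' _ =>
    ((hX.pHat₁ h x a x').mul (hX.pHat₂ h y b y')).mul (hV x' y')

theorem vBar (hX : DataMeas 𝒢 X k) {μ : Ω → Fin H → S₁ → A → ℝ}
    (hμ : ∀ h x a, Measurable fun ω => μ ω h x a)
    (hν : ∀ h y b, Measurable fun ω => (X ω).ν k h y b) (h : Fin (H + 1)) (x : S₁) (y : S₂) :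
    Measurable fun ω => vBar δ K (X ω) k (μ ω) h x y := by
  induction h using Fin.reverseInduction generalizing x y with
  | last => simp only [vBar_last]; exact measurable_const
  | cast h ih =>
    simp only [vBar_castSucc]
    exact Finset.measurable_sum _ fun a _ => Finset.measurable_sum _ fun b _ =>
      ((hμ h x a).mul (hX.qStep ih h x y a b)).mul (hν h y b)

theorem reach (hX : DataMeas 𝒢 X k) (hν : ∀ h y b, Measurable fun ω => (X ω).ν k h y b) (y₀ : S₂)
    (h : Fin (H + 1)) (y : S₂) : Measurable fun ω => reach (X ω) k y₀ h y := by
  induction h using Fin.induction generalizing y with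
  | zero => exact measurable_const
  | succ h ih =>
    simp only [reach_eq_flow, flow_succ] at ih ⊢
    exact Finset.measurable_sum _ fun y' _ => Finset.measurable_sum _ fun b _ =>
      ((ih y').mul (hν h y' b)).mul (hX.pHat₂ h y' b y)

/-- The policy of an episode is determined by the data of the earlier episodes and by Player 2's
earlier policies. -/
theorem policy (hX : DataMeas 𝒢 X (k - 1))
    (hν : ∀ j < k, ∀ h y b, Measurable fun ω => (X ω).ν j h y b) (y₀ : S₂) (h : Fin H) (x : S₁)
    (a : A) : Measurable fun ω => policy η δ K y₀ (X ω) k h x a := by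
  induction k generalizing h x a with
  | zero => exact measurable_const
  | succ k ih =>
    have hX : DataMeas 𝒢 X k := hX
    have ih := ih (hX.anti (Nat.sub_le k 1)) fun j hj => hν j (by omega)
    have hν := hν k (by omega)
    have hstep : ∀ a, Measurable fun ω => FactoredMG.policy η δ K y₀ (X ω) k h x a *
        Real.exp (η * ∑ y : S₂,
          (∑ b : B, qBar δ K (X ω) k (FactoredMG.policy η δ K y₀ (X ω) k) h x y a b *
            (X ω).ν k h y b) * FactoredMG.reach (X ω) k y₀ h.castSucc y) := by
      intro a
      refine (ih h x a).mul ((Finset.measurable_sum _ fun y _ => ?_).const_mul η).exp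
      refine (Finset.measurable_sum _ fun b _ => ?_).mul (hX.reach hν y₀ _ y)
      exact (hX.qStep (hX.vBar ih hν h.succ) h x y a b).mul (hν h y b)
    simp only [FactoredMG.policy, mirrorStep]
    exact (hstep a).div (Finset.measurable_sum _ fun a' _ => hstep a')

end DataMeas

end Measurability

/-! ### Conditional laws along a play -/

section Play

theorem BddMeas.comp_of_fintype {Ω Z : Type*} [Fintype Z] [DecidableEq Z] {𝒢 : MeasurableSpace Ω}
    {f : Ω → Z} (hf : ∀ z, MeasurableSet[𝒢] {ω | f ω = z}) (φ : Z → ℝ) :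
    BddMeas 𝒢 fun ω => φ (f ω) := by
  have : (fun ω => φ (f ω)) = fun ω => ∑ z, (if f ω = z then 1 else 0) * φ z := by
    funext ω
    simp
  rw [this]
  exact BddMeas.sum fun z _ => (BddMeas.ite (hf z)).mul (BddMeas.const _)

variable {H : ℕ} {S₁ S₂ A B : Type*} [Fintype S₁] [Fintype S₂] [Fintype A] [Fintype B]
  [DecidableEq S₁] [DecidableEq S₂] [DecidableEq A] [DecidableEq B]

/-- The joint state at a step of an episode. -/
def Transcript.state (X : Transcript H S₁ S₂ A B) (k : ℕ) (h : Fin (H + 1)) : S₁ × S₂ :=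
  (X.s₁ k h, X.s₂ k h)

/-- The joint action at a step of an episode. -/
def Transcript.act (X : Transcript H S₁ S₂ A B) (k : ℕ) (h : Fin H) : A × B := (X.a k h, X.b k h)

variable {Ω : Type*} {mΩ : MeasurableSpace Ω} {Pr : Measure Ω} [IsProbabilityMeasure Pr]
  {ℱ : Filtration ℕ mΩ} {G : Game H S₁ S₂ A B} {η δ : ℝ} {K : ℕ}
  {X : Ω → Transcript H S₁ S₂ A B}

namespace IsPlay

variable (hX : IsPlay Pr ℱ G η δ K X)
include hX

theorem measurableSet_state {k : ℕ} (hk : k ∈ Icc 1 K) (h : Fin (H + 1)) (z : S₁ × S₂) :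
    MeasurableSet[ℱ (2 * (k * H + h))] {ω | (X ω).state k h = z} := by
  simpa only [Transcript.state, Prod.ext_iff] using hX.s_meas k hk h z.1 z.2

theorem measurableSet_act {k : ℕ} (hk : k ∈ Icc 1 K) (h : Fin H) (u : A × B) :
    MeasurableSet[ℱ (2 * (k * H + h) + 1)] {ω | (X ω).act k h = u} := by
  simpa only [Transcript.act, Prod.ext_iff] using hX.ab_meas k hk h u.1 u.2

theorem measurableSet_s₁ {k : ℕ} (hk : k ∈ Icc 1 K) (h : Fin (H + 1)) (x : S₁) :
    MeasurableSet[ℱ (2 * (k * H + h))] {ω | (X ω).s₁ k h = x} := by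
  have : {ω | (X ω).s₁ k h = x} = ⋃ y, {ω | (X ω).s₁ k h = x ∧ (X ω).s₂ k h = y} := by
    ext ω
    simp
  rw [this]
  exact MeasurableSet.iUnion fun y => hX.s_meas k hk h x y

theorem measurableSet_s₂ {k : ℕ} (hk : k ∈ Icc 1 K) (h : Fin (H + 1)) (y : S₂) :
    MeasurableSet[ℱ (2 * (k * H + h))] {ω | (X ω).s₂ k h = y} := by
  have : {ω | (X ω).s₂ k h = y} = ⋃ x, {ω | (X ω).s₁ k h = x ∧ (X ω).s₂ k h = y} := by
    ext ω
    simp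
  rw [this]
  exact MeasurableSet.iUnion fun x => hX.s_meas k hk h x y

theorem measurableSet_a {k : ℕ} (hk : k ∈ Icc 1 K) (h : Fin H) (a : A) :
    MeasurableSet[ℱ (2 * (k * H + h) + 1)] {ω | (X ω).a k h = a} := by
  have : {ω | (X ω).a k h = a} = ⋃ b, {ω | (X ω).a k h = a ∧ (X ω).b k h = b} := by
    ext ω
    simp
  rw [this]
  exact MeasurableSet.iUnion fun b => hX.ab_meas k hk h a b

theorem measurableSet_b {k : ℕ} (hk : k ∈ Icc 1 K) (h : Fin H) (b : B) :
    MeasurableSet[ℱ (2 * (k * H + h) + 1)] {ω | (X ω).b k h = b} := by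
  have : {ω | (X ω).b k h = b} = ⋃ a, {ω | (X ω).a k h = a ∧ (X ω).b k h = b} := by
    ext ω
    simp
  rw [this]
  exact MeasurableSet.iUnion fun a => hX.ab_meas k hk h a b

theorem dataMeas {k : ℕ} (hk : k ≤ K) : DataMeas (ℱ (2 * ((k + 1) * H))) X k := by
  have hK : ∀ τ ∈ Icc 1 k, τ ∈ Icc 1 K := fun τ hτ => Icc_subset_Icc_right hk hτ
  have ht : ∀ τ ∈ Icc 1 k, τ * H + H ≤ (k + 1) * H := fun τ hτ => by
    rw [← add_one_mul]
    exact Nat.mul_le_mul_right H (by have := (mem_Icc.1 hτ).2; omega)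
  refine ⟨fun τ hτ h x => ?_, fun τ hτ h y => ?_, fun τ hτ h a => ?_, fun τ hτ h b => ?_,
    fun τ hτ h => ?_⟩
  · refine ℱ.mono ?_ _ (hX.measurableSet_s₁ (hK τ hτ) h x)
    have := ht τ hτ
    have := h.is_le
    omega
  · refine ℱ.mono ?_ _ (hX.measurableSet_s₂ (hK τ hτ) h y)
    have := ht τ hτ
    have := h.is_le
    omega
  · refine ℱ.mono ?_ _ (hX.measurableSet_a (hK τ hτ) h a)
    have := ht τ hτ
    have := h.is_lt
    omega
  · refine ℱ.mono ?_ _ (hX.measurableSet_b (hK τ hτ) h b)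
    have := ht τ hτ
    have := h.is_lt
    omega
  · refine (hX.reward_meas τ (hK τ hτ) h).mono (ℱ.mono ?_) le_rfl
    have := ht τ hτ
    have := h.is_lt
    omega

theorem dataMeas_pred {k : ℕ} (hk : k ∈ Icc 1 K) : DataMeas (ℱ (2 * (k * H))) X (k - 1) := by
  obtain ⟨h1, h2⟩ := mem_Icc.1 hk
  have := hX.dataMeas (k := k - 1) (by omega)
  rwa [Nat.sub_add_cancel h1] at this

theorem measurable_ν {k : ℕ} (hk : k ≤ K) (h : Fin H) (y : S₂) (b : B) :
    Measurable[ℱ (2 * (k * H))] fun ω => (X ω).ν k h y b :=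
  (measurable_pi_apply b).comp ((measurable_pi_apply y).comp
    ((measurable_pi_apply h).comp (hX.ν_meas k hk)))

/-- The joint policy of an episode is determined before the episode. -/
theorem bddMeas_jointPolicy [Nonempty A] {k : ℕ} (hk : k ∈ Icc 1 K) (h : Fin H) (z : S₁ × S₂)
    (u : A × B) : BddMeas (ℱ (2 * (k * H))) fun ω =>
      jointPolicy (policy η δ K G.init₂ (X ω) k) ((X ω).ν k) h z u := by
  have hk2 := (mem_Icc.1 hk).2
  have hμ := (hX.dataMeas_pred hk).policy (η := η) (δ := δ) (K := K) (fun j hj h y b =>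
    (hX.measurable_ν (by omega : j ≤ K) h y b).mono
      (ℱ.mono (Nat.mul_le_mul_left 2 (Nat.mul_le_mul_right H hj.le))) le_rfl)
    G.init₂ h z.1 u.1
  refine ⟨hμ.mul (hX.measurable_ν hk2 h z.2 u.2), 1, fun ω => ?_⟩
  have h1 := (isPolicy_policy η δ K G.init₂ (X ω) k).joint (hX.ν_policy k hk2 ω) h z
  rw [abs_of_nonneg (h1.1 u), ← h1.2]
  exact single_le_sum (fun u _ => h1.1 u) (mem_univ u)

theorem condMean_act [Nonempty A] {k : ℕ} (hk : k ∈ Icc 1 K) (h : Fin H) (u : A × B) :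
    HasCondMean Pr (ℱ (2 * (k * H + h))) (fun ω => if (X ω).act k h = u then 1 else 0)
      (fun ω => jointPolicy (policy η δ K G.init₂ (X ω) k) ((X ω).ν k) h
        ((X ω).state k h.castSucc) u) := by
  refine HasCondMean.of_condExp (ℱ.le _)
    (BddMeas.ite (ℱ.le _ _ (hX.measurableSet_act hk h u))) ?_ ?_
  · have : (fun ω => jointPolicy (policy η δ K G.init₂ (X ω) k) ((X ω).ν k) h
        ((X ω).state k h.castSucc) u) = fun ω => ∑ z,
        (if (X ω).state k h.castSucc = z then 1 else 0) *
          jointPolicy (policy η δ K G.init₂ (X ω) k) ((X ω).ν k) h z u := by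
      funext ω
      simp
    rw [this]
    exact BddMeas.sum fun z _ => (BddMeas.ite (hX.measurableSet_state hk h.castSucc z)).mul
      ((hX.bddMeas_jointPolicy hk h z u).mono (ℱ.mono (by omega)))
  · have : (fun ω => if (X ω).act k h = u then (1 : ℝ) else 0) =
        {ω | (X ω).a k h = u.1 ∧ (X ω).b k h = u.2}.indicator fun _ => 1 := by
      funext ω
      simp [Set.indicator_apply, Transcript.act, Prod.ext_iff]
    rw [this]
    exact hX.ab_law k hk h u.1 u.2

theorem condMean_state_succ {k : ℕ} (hk : k ∈ Icc 1 K) (h : Fin H) (z' : S₁ × S₂) :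
    HasCondMean Pr (ℱ (2 * (k * H + h) + 1))
      (fun ω => if (X ω).state k h.succ = z' then 1 else 0)
      (fun ω => jointKernel G.P₁ G.P₂ h ((X ω).state k h.castSucc) ((X ω).act k h) z') := by
  refine HasCondMean.of_condExp (ℱ.le _)
    (BddMeas.ite (ℱ.le _ _ (hX.measurableSet_state hk h.succ z'))) ?_ ?_
  · refine BddMeas.comp_of_fintype (f := fun ω => ((X ω).state k h.castSucc, (X ω).act k h))
      (fun w => ?_) fun w => jointKernel G.P₁ G.P₂ h w.1 w.2 z'
    simp only [Prod.ext_iff (y := w)]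
    exact (ℱ.mono (by simp) _ (hX.measurableSet_state hk h.castSucc w.1)).inter
      (hX.measurableSet_act hk h w.2)
  · have : (fun ω => if (X ω).state k h.succ = z' then (1 : ℝ) else 0) =
        {ω | (X ω).s₁ k h.succ = z'.1 ∧ (X ω).s₂ k h.succ = z'.2}.indicator fun _ => 1 := by
      funext ω
      simp [Set.indicator_apply, Transcript.state, Prod.ext_iff]
    rw [this]
    exact hX.s_law k hk h z'.1 z'.2

theorem condMean_reward {k : ℕ} (hk : k ∈ Icc 1 K) (h : Fin H) :
    HasCondMean Pr (ℱ (2 * (k * H + h) + 1)) (fun ω => (X ω).reward k h)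
      (fun ω => G.r h ((X ω).s₁ k h.castSucc) ((X ω).s₂ k h.castSucc) ((X ω).a k h)
        ((X ω).b k h)) := by
  refine HasCondMean.of_condExp (ℱ.le _)
    ⟨(hX.reward_meas k hk h).mono (ℱ.le _) le_rfl, 1, fun ω => ?_⟩ ?_ (hX.reward_mean k hk h)
  · rw [abs_of_nonneg (hX.reward_mem k hk h ω).1]
    exact (hX.reward_mem k hk h ω).2
  · refine BddMeas.comp_of_fintype (f := fun ω => ((X ω).state k h.castSucc, (X ω).act k h))
      (fun w => ?_) fun w => G.r h w.1.1 w.1.2 w.2.1 w.2.2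
    simp only [Prod.ext_iff (y := w)]
    exact (ℱ.mono (by simp) _ (hX.measurableSet_state hk h.castSucc w.1)).inter
      (hX.measurableSet_act hk h w.2)

/-- Given the past of the episode, the state and actions at a step follow the occupancy measure if
the state does. -/
theorem condMean_visit_of_state [Nonempty A] {k : ℕ} (hk : k ∈ Icc 1 K) (h : Fin H)
    {d : Ω → S₁ × S₂ → ℝ}
    (hd : ∀ z, HasCondMean Pr (ℱ (2 * (k * H)))
      (fun ω => if (X ω).state k h.castSucc = z then 1 else 0) (fun ω => d ω z))
    (z : S₁ × S₂) (u : A × B) :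
    HasCondMean Pr (ℱ (2 * (k * H)))
      (fun ω => (if (X ω).state k h.castSucc = z then 1 else 0) *
        if (X ω).act k h = u then 1 else 0)
      (fun ω => d ω z * jointPolicy (policy η δ K G.init₂ (X ω) k) ((X ω).ν k) h z u) := by
  have hle : ℱ (2 * (k * H)) ≤ ℱ (2 * (k * H + h)) := ℱ.mono (by omega)
  have h1 := (hX.condMean_act hk h u).mul_left (ℱ.le _)
    (BddMeas.ite (hX.measurableSet_state hk h.castSucc z))
  refine HasCondMean.trans hle h1 ?_
  have h2 := (hd z).mul_left (ℱ.le _) (hX.bddMeas_jointPolicy hk h z u)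
  convert h2 using 1
  · funext ω
    by_cases h3 : (X ω).state k h.castSucc = z
    · simp [h3]
    · simp [h3]
  · funext ω
    rw [mul_comm]

/-- Before an episode, the conditional law of the state at a step is the occupancy measure of the
policies of the episode. -/
theorem condMean_state [Nonempty A] {k : ℕ} (hk : k ∈ Icc 1 K) (h : Fin (H + 1)) (z : S₁ × S₂) :
    HasCondMean Pr (ℱ (2 * (k * H))) (fun ω => if (X ω).state k h = z then 1 else 0)
      (fun ω => flow (point (G.init₁, G.init₂))
        (jointPolicy (policy η δ K G.init₂ (X ω) k) ((X ω).ν k)) (jointKernel G.P₁ G.P₂) h z) := by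
  induction h using Fin.induction generalizing z with
  | zero =>
    have : ∀ ω, (X ω).state k 0 = (G.init₁, G.init₂) := fun ω =>
      Prod.ext (hX.s_init k hk ω).1 (hX.s_init k hk ω).2
    simp only [this, flow_zero, point, eq_comm (b := z)]
    exact HasCondMean.refl (ℱ.le _) (BddMeas.const _)
  | succ h ih =>
    refine HasCondMean.trans (ℱ.mono (by omega)) (hX.condMean_state_succ hk h z) ?_
    have h1 := HasCondMean.sum (s := univ) (ℱ.le _) fun z' _ =>
      HasCondMean.sum (s := univ) (ℱ.le _) fun u _ =>
        (hX.condMean_visit_of_state hk h ih z' u).mul_left (ℱ.le _)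
          (BddMeas.const (jointKernel G.P₁ G.P₂ h z' u z))
    convert h1 using 1
    · funext ω
      simp
    · funext ω
      rw [flow_succ]
      exact sum_congr rfl fun z' _ => sum_congr rfl fun u _ => by ring

/-- The conditional mean, before an episode, of predictable coefficients summed over the visited
points. -/
theorem condMean_total [Nonempty A] {k : ℕ} (hk : k ∈ Icc 1 K)
    {β : Ω → Fin H → S₁ × S₂ → A × B → ℝ}
    (hβ : ∀ h z u, BddMeas (ℱ (2 * (k * H))) fun ω => β ω h z u) :
    HasCondMean Pr (ℱ (2 * (k * H)))
      (fun ω => ∑ h : Fin H, β ω h ((X ω).state k h.castSucc) ((X ω).act k h))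
      (fun ω => total (point (G.init₁, G.init₂))
        (jointPolicy (policy η δ K G.init₂ (X ω) k) ((X ω).ν k)) (jointKernel G.P₁ G.P₂)
        (β ω)) := by
  have h1 := HasCondMean.sum (s := univ) (ℱ.le _) fun (h : Fin H) _ =>
    HasCondMean.sum (s := univ) (ℱ.le _) fun z _ =>
      HasCondMean.sum (s := univ) (ℱ.le _) fun u _ =>
        (hX.condMean_visit_of_state hk h (hX.condMean_state hk h.castSucc) z u).mul_left (ℱ.le _)
          (hβ h z u)
  convert h1 using 1
  · funext ω
    simp
  · funext ω
    simp only [total, mul_sum]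
    exact sum_congr rfl fun h _ => sum_congr rfl fun z _ => sum_congr rfl fun u _ => by ring

end IsPlay

end Play

/-! ### The event of accurate estimates -/

section Events

/-- From `ℓ¹` concentration of the frequencies at visited points to the transition bonus; at an
unvisited point the empirical weights vanish and the bonus exceeds `R`. -/
theorem mul_sum_abs_le_bonus {S : Type*} [Fintype S] [Nonempty S] {c : S → ℕ} {N : ℕ}
    (hc : ∀ x, c x ≤ N) {p : S → ℝ} (hp : p ∈ stdSimplex ℝ S) {l R : ℝ} (hl : 1 / 2 ≤ l)
    (hR : 0 ≤ R)
    (h : 0 < N → ∑ x, |(c x : ℝ) / N - p x| ≤ √(2 * Fintype.card S * l / N)) :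
    R * ∑ x, |(c x : ℝ) / max (N : ℝ) 1 - p x| ≤
      √(2 * R ^ 2 * Fintype.card S * l / max (N : ℝ) 1) := by
  have hS : (1 : ℝ) ≤ Fintype.card S := by exact_mod_cast Fintype.card_pos
  rcases Nat.eq_zero_or_pos N with rfl | hN
  · have hc0 : ∀ x, (c x : ℝ) = 0 := fun x => by exact_mod_cast Nat.le_zero.1 (hc x)
    simp only [hc0, Nat.cast_zero, zero_sub, abs_neg, abs_of_nonneg (hp.1 _), hp.2,
      mul_one, zero_le_one, max_eq_right, div_one]
    refine Real.le_sqrt_of_sq_le ?_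
    have : 1 ≤ 2 * Fintype.card S * l := by nlinarith
    calc R ^ 2 = R ^ 2 * 1 := (mul_one _).symm
      _ ≤ R ^ 2 * (2 * Fintype.card S * l) := by gcongr
      _ = _ := by ring
  · have hN1 : (1 : ℝ) ≤ N := by exact_mod_cast hN
    rw [max_eq_left hN1]
    calc R * ∑ x, |(c x : ℝ) / N - p x| ≤ R * √(2 * Fintype.card S * l / N) := by
          gcongr
          exact h hN
      _ = √(R ^ 2 * (2 * Fintype.card S * l / N)) := by
          rw [Real.sqrt_mul (by positivity), Real.sqrt_sq hR]
      _ = _ := by congr 1; ring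

theorem half_le_log_two_mul {n : ℕ} (hn : 0 < n) {δ : ℝ} (hδ : 0 < δ) (hδ1 : δ ≤ 1) :
    1 / 2 ≤ Real.log (2 * n / δ) := by
  have hn' : (1 : ℝ) ≤ n := by exact_mod_cast hn
  have h1 : (2 : ℝ) ≤ 2 * n / δ := by
    rw [le_div_iff₀ hδ]
    linarith
  have := Real.log_le_log two_pos h1
  have := Real.log_two_gt_d9
  linarith

variable {H : ℕ} {S₁ S₂ A B : Type*} [Fintype S₁] [Fintype S₂] [Fintype A] [Fintype B]
  [DecidableEq S₁] [DecidableEq S₂] [DecidableEq A] [DecidableEq B]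
variable {Ω : Type*} {mΩ : MeasurableSpace Ω} {Pr : Measure Ω} [IsProbabilityMeasure Pr]
  {ℱ : Filtration ℕ mΩ} {G : Game H S₁ S₂ A B} {η δ : ℝ} {K : ℕ}
  {X : Ω → Transcript H S₁ S₂ A B}

namespace IsPlay

variable (hX : IsPlay Pr ℱ G η δ K X)
include hX

theorem condMean_s₁_succ {k : ℕ} (hk : k ∈ Icc 1 K) (h : Fin H) (φ : S₁ → ℝ) :
    HasCondMean Pr (ℱ (2 * (k * H + h) + 1)) (fun ω => φ ((X ω).s₁ k h.succ))
      (fun ω => ∑ x, G.P₁ h ((X ω).s₁ k h.castSucc) ((X ω).a k h) x * φ x) := by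
  have h1 := HasCondMean.sum (s := univ) (ℱ.le _) fun z _ =>
    (hX.condMean_state_succ hk h z).mul_left (ℱ.le _) (BddMeas.const (φ z.1))
  convert h1 using 1
  · funext ω
    simp only [mul_ite, mul_one, mul_zero, sum_ite_eq, mem_univ, if_true]
    rfl
  · funext ω
    rw [Fintype.sum_prod_type]
    refine sum_congr rfl fun x _ => ?_
    simp only [jointKernel, ← mul_sum, (G.P₂_mem h _ _).2, mul_one]
    rw [mul_comm]
    rfl

theorem condMean_s₂_succ {k : ℕ} (hk : k ∈ Icc 1 K) (h : Fin H) (φ : S₂ → ℝ) :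
    HasCondMean Pr (ℱ (2 * (k * H + h) + 1)) (fun ω => φ ((X ω).s₂ k h.succ))
      (fun ω => ∑ y, G.P₂ h ((X ω).s₂ k h.castSucc) ((X ω).b k h) y * φ y) := by
  have h1 := HasCondMean.sum (s := univ) (ℱ.le _) fun z _ =>
    (hX.condMean_state_succ hk h z).mul_left (ℱ.le _) (BddMeas.const (φ z.2))
  convert h1 using 1
  · funext ω
    simp only [mul_ite, mul_one, mul_zero, sum_ite_eq, mem_univ, if_true]
    rfl
  · funext ω
    rw [Fintype.sum_prod_type, sum_comm]
    refine sum_congr rfl fun y _ => ?_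
    simp only [jointKernel, ← mul_sum, ← sum_mul, (G.P₁_mem h _ _).2, one_mul]
    rw [mul_comm]
    rfl

theorem prob_trans₁_inaccurate_le [Nonempty A] (hH : 1 ≤ H) (hK : 1 ≤ K) (hδ : 0 < δ)
    (hδ1 : δ ≤ 1) :
    Pr.real {ω | ¬ ∀ k ∈ Icc 1 K, ∀ h x a,
      H * ∑ x', |pHat₁ (X ω) k h x a x' - G.P₁ h x a x'| ≤ bonus₁ δ K (X ω) k h x a} ≤ δ := by
  have : Nonempty S₁ := ⟨G.init₁⟩
  have : Nonempty (Fin H) := ⟨⟨0, hH⟩⟩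
  refine (measureReal_mono ?_).trans (prob_l1_deviation_le (Pr := Pr) (J := Fin H × S₁ × A)
    (𝒢 := fun j τ => ℱ (2 * (τ * H + j.1) + 1)) (fun j τ => ℱ.le _)
    (fun j σ τ hστ => ℱ.mono (by gcongr))
    (P := fun j τ ω => (X ω).s₁ τ j.1.castSucc = j.2.1 ∧ (X ω).a τ j.1 = j.2.2)
    (s := fun j τ ω => (X ω).s₁ τ j.1.succ) (p := fun j => G.P₁ j.1 j.2.1 j.2.2)
    (q := fun j τ ω => G.P₁ j.1 ((X ω).s₁ τ j.1.castSucc) ((X ω).a τ j.1)) hK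
    (fun j τ hτ => (ℱ.mono (by simp) _ (hX.measurableSet_s₁ hτ j.1.castSucc j.2.1)).inter
      (hX.measurableSet_a hτ j.1 j.2.2))
    (fun j τ hτ x => ℱ.mono (by simp only [Fin.val_succ, add_one_mul]; omega) _
      (hX.measurableSet_s₁ hτ j.1.succ x))
    (fun j τ _ ω => G.P₁_mem _ _ _) (fun j τ _ ω hP => by simp only [hP.1, hP.2])
    (fun j τ hτ φ => hX.condMean_s₁_succ hτ j.1 φ) hδ hδ1)
  intro ω hω
  by_contra hc
  refine hω fun k hk h x a => ?_
  simp only [Set.mem_ofPred_eq, not_exists, not_and, not_lt] at hc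
  obtain ⟨hk1, hk2⟩ := mem_Icc.1 hk
  have h1 := hc k hk2 (h, x, a)
  have hlog : Real.log (2 * (Fintype.card (Fin H × S₁ × A) : ℝ) * K / δ) =
      Real.log (2 * (Fintype.card S₁ : ℝ) * Fintype.card A * H * K / δ) := by
    simp only [Fintype.card_prod, Fintype.card_fin]
    push_cast
    congr 1
    ring
  simp only [hlog] at h1
  simp only [pHat₁, bonus₁, if_neg (by omega : ¬ k = 0)]
  refine mul_sum_abs_le_bonus (fun x' => ?_) (G.P₁_mem h x a) ?_ (Nat.cast_nonneg _) ?_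
  · refine card_le_card fun τ hτ => ?_
    simp only [mem_filter] at hτ ⊢
    exact ⟨hτ.1, hτ.2.1, hτ.2.2.1⟩
  · have := half_le_log_two_mul (n := Fintype.card S₁ * Fintype.card A * H * K)
      (by have := Fintype.card_pos (α := S₁); have := Fintype.card_pos (α := A); positivity) hδ hδ1
    push_cast at this
    simpa only [mul_assoc] using this
  · simpa only [count₁, and_assoc] using h1

theorem prob_trans₂_inaccurate_le [Nonempty B] (hH : 1 ≤ H) (hK : 1 ≤ K) (hδ : 0 < δ)
    (hδ1 : δ ≤ 1) :
    Pr.real {ω | ¬ ∀ k ∈ Icc 1 K, ∀ h y b,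
      H * ∑ y', |pHat₂ (X ω) k h y b y' - G.P₂ h y b y'| ≤ bonus₂ δ K (X ω) k h y b} ≤ δ := by
  have : Nonempty S₂ := ⟨G.init₂⟩
  have : Nonempty (Fin H) := ⟨⟨0, hH⟩⟩
  refine (measureReal_mono ?_).trans (prob_l1_deviation_le (Pr := Pr) (J := Fin H × S₂ × B)
    (𝒢 := fun j τ => ℱ (2 * (τ * H + j.1) + 1)) (fun j τ => ℱ.le _)
    (fun j σ τ hστ => ℱ.mono (by gcongr))
    (P := fun j τ ω => (X ω).s₂ τ j.1.castSucc = j.2.1 ∧ (X ω).b τ j.1 = j.2.2)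
    (s := fun j τ ω => (X ω).s₂ τ j.1.succ) (p := fun j => G.P₂ j.1 j.2.1 j.2.2)
    (q := fun j τ ω => G.P₂ j.1 ((X ω).s₂ τ j.1.castSucc) ((X ω).b τ j.1)) hK
    (fun j τ hτ => (ℱ.mono (by simp) _ (hX.measurableSet_s₂ hτ j.1.castSucc j.2.1)).inter
      (hX.measurableSet_b hτ j.1 j.2.2))
    (fun j τ hτ x => ℱ.mono (by simp only [Fin.val_succ, add_one_mul]; omega) _
      (hX.measurableSet_s₂ hτ j.1.succ x))
    (fun j τ _ ω => G.P₂_mem _ _ _) (fun j τ _ ω hP => by simp only [hP.1, hP.2])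
    (fun j τ hτ φ => hX.condMean_s₂_succ hτ j.1 φ) hδ hδ1)
  intro ω hω
  by_contra hc
  refine hω fun k hk h y b => ?_
  simp only [Set.mem_ofPred_eq, not_exists, not_and, not_lt] at hc
  obtain ⟨hk1, hk2⟩ := mem_Icc.1 hk
  have h1 := hc k hk2 (h, y, b)
  have hlog : Real.log (2 * (Fintype.card (Fin H × S₂ × B) : ℝ) * K / δ) =
      Real.log (2 * (Fintype.card S₂ : ℝ) * Fintype.card B * H * K / δ) := by
    simp only [Fintype.card_prod, Fintype.card_fin]
    push_cast
    congr 1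
    ring
  simp only [hlog] at h1
  simp only [pHat₂, bonus₂, if_neg (by omega : ¬ k = 0)]
  refine mul_sum_abs_le_bonus (fun y' => ?_) (G.P₂_mem h y b) ?_ (Nat.cast_nonneg _) ?_
  · refine card_le_card fun τ hτ => ?_
    simp only [mem_filter] at hτ ⊢
    exact ⟨hτ.1, hτ.2.1, hτ.2.2.1⟩
  · have := half_le_log_two_mul (n := Fintype.card S₂ * Fintype.card B * H * K)
      (by have := Fintype.card_pos (α := S₂); have := Fintype.card_pos (α := B); positivity) hδ hδ1
    push_cast at this
    simpa only [mul_assoc] using this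
  · simpa only [count₂, and_assoc] using h1

/-- Concentration of the empirical rewards. -/
theorem prob_reward_inaccurate_le [Nonempty A] [Nonempty B] (hH : 1 ≤ H) (hK : 1 ≤ K) (hδ : 0 < δ)
    (hδ1 : δ ≤ 1 / 2) :
    Pr.real {ω | ¬ ∀ k ∈ Icc 1 K, ∀ h x y a b,
      |rHat (X ω) k h x y a b - G.r h x y a b| ≤ bonusR δ K (X ω) k h x y a b} ≤ δ := by
  have : Nonempty S₁ := ⟨G.init₁⟩
  have : Nonempty S₂ := ⟨G.init₂⟩
  have : Nonempty (Fin H) := ⟨⟨0, hH⟩⟩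
  set M : ℝ := (Fintype.card S₁ : ℝ) * Fintype.card S₂ * Fintype.card A * Fintype.card B * H * K
    with hM
  have hM1 : 1 ≤ M := by
    have : 0 < Fintype.card S₁ * Fintype.card S₂ * Fintype.card A * Fintype.card B * H * K := by
      have := Fintype.card_pos (α := S₁)
      have := Fintype.card_pos (α := S₂)
      have := Fintype.card_pos (α := A)
      have := Fintype.card_pos (α := B)
      positivity
    rw [hM]
    exact_mod_cast this
  set L := Real.log (M / δ) with hL
  have hL1 : 1 / 2 ≤ L := by
    have h1 : (2 : ℝ) ≤ M / δ := by
      rw [le_div_iff₀ hδ]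
      linarith
    have := Real.log_le_log two_pos h1
    have := Real.log_two_gt_d9
    linarith
  let J := Fin H × S₁ × S₂ × A × B
  let P : J → ℕ → Ω → Prop := fun j τ ω => (X ω).s₁ τ j.1.castSucc = j.2.1 ∧
    (X ω).s₂ τ j.1.castSucc = j.2.2.1 ∧ (X ω).a τ j.1 = j.2.2.2.1 ∧ (X ω).b τ j.1 = j.2.2.2.2
  have hPdec : ∀ j τ ω, Decidable (P j τ ω) := fun j τ ω => instDecidableAnd
  -- The two signs give the two-sided bound.
  let sgn : Bool → ℝ := fun σ => if σ then 1 else -1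
  have hsgn : ∀ σ, |sgn σ| ≤ 1 := fun σ => by simp only [sgn]; split_ifs <;> simp
  let ρ : J → ℕ → Ω → ℝ := fun j τ ω => G.r j.1 ((X ω).s₁ τ j.1.castSucc)
    ((X ω).s₂ τ j.1.castSucc) ((X ω).a τ j.1) ((X ω).b τ j.1)
  set E : J × Fin K × Bool → Set Ω := fun i => {ω | ∃ k ≤ K,
    #{τ ∈ Icc 1 k | P i.1 τ ω} = (i.2.1 : ℕ) + 1 ∧
      √(4 * L * ((i.2.1 : ℕ) + 1 : ℕ)) ≤ ∑ τ ∈ Icc 1 k, if P i.1 τ ω then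
        sgn i.2.2 * (X ω).reward τ i.1.1 - sgn i.2.2 * ρ i.1 τ ω else 0} with hE
  have hEi : ∀ i, Pr.real (E i) ≤ Real.exp (-(2 * L)) := by
    rintro ⟨j, n, σ⟩
    refine (prob_visits_ge_le (𝒢 := fun τ => ℱ (2 * (τ * H + j.1) + 1)) (fun τ => ℱ.le _)
      (fun σ τ hστ => ℱ.mono (by gcongr)) (P := P j)
      (v := fun τ ω => sgn σ * (X ω).reward τ j.1) (m := fun τ ω => sgn σ * ρ j τ ω)
      (fun τ hτ => ?_) (fun τ hτ => ?_) (fun τ hτ => ?_) (fun τ hτ ω => ?_) (fun τ hτ ω => ?_)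
      (n := (n : ℕ) + 1) (Nat.succ_pos _) (Real.sqrt_nonneg _)).trans
      (Real.exp_le_exp.2 (neg_le_neg (le_of_eq ?_)))
    · have hle : ℱ (2 * (τ * H + j.1)) ≤ ℱ (2 * (τ * H + j.1) + 1) := ℱ.mono (by simp)
      exact (hle _ (hX.measurableSet_s₁ hτ j.1.castSucc j.2.1)).inter
        ((hle _ (hX.measurableSet_s₂ hτ j.1.castSucc j.2.2.1)).inter
          ((hX.measurableSet_a hτ j.1 j.2.2.2.1).inter (hX.measurableSet_b hτ j.1 j.2.2.2.2)))
    · exact (hX.condMean_reward hτ j.1).mul_left (ℱ.le _) (BddMeas.const (sgn σ))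
    · exact ((hX.reward_meas τ hτ j.1).const_mul _).mono
        (ℱ.mono (by simp only [add_one_mul]; omega)) le_rfl
    · obtain ⟨h1, h2⟩ := hX.reward_mem τ hτ j.1 ω
      rw [abs_mul, abs_of_nonneg h1]
      exact mul_le_one₀ (hsgn σ) h1 h2
    · obtain ⟨h1, h2⟩ := G.r_mem j.1 ((X ω).s₁ τ j.1.castSucc)
        ((X ω).s₂ τ j.1.castSucc) ((X ω).a τ j.1) ((X ω).b τ j.1)
      rw [abs_mul, abs_of_nonneg h1]
      exact mul_le_one₀ (hsgn σ) h1 h2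
    · rw [Real.sq_sqrt (by positivity)]
      push_cast
      field_simp
      ring
  have hsub : {ω | ¬ ∀ k ∈ Icc 1 K, ∀ h x y a b,
      |rHat (X ω) k h x y a b - G.r h x y a b| ≤ bonusR δ K (X ω) k h x y a b} ⊆ ⋃ i, E i := by
    intro ω hω
    by_contra hc
    refine hω fun k hk h x y a b => ?_
    obtain ⟨hk1, hk2⟩ := mem_Icc.1 hk
    simp only [hE, Set.mem_iUnion, Set.mem_ofPred_eq, not_exists, not_and, not_le] at hc
    let j : J := (h, x, y, a, b)
    have hcount : count (X ω) k h x y a b = #{τ ∈ Icc 1 k | P j τ ω} := by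
      rw [count]
      congr
    have hρ : ∀ τ, P j τ ω → ρ j τ ω = G.r h x y a b := by
      rintro τ ⟨h1, h2, h3, h4⟩
      simp only [ρ, h1, h2, h3, h4]
      rfl
    have hrw : rHat (X ω) k h x y a b =
        (∑ τ ∈ Icc 1 k, if P j τ ω then (X ω).reward τ h else 0) /
          max (#{τ ∈ Icc 1 k | P j τ ω} : ℝ) 1 := by
      rw [rHat, hcount]
      exact congrArg (· / _) (sum_congr rfl fun τ _ => if_congr Iff.rfl rfl rfl)
    rw [hrw, bonusR, hcount, ← hM, ← hL]
    rcases Nat.eq_zero_or_pos #{τ ∈ Icc 1 k | P j τ ω} with hN | hN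
    · have h1 : ∑ τ ∈ Icc 1 k, (if P j τ ω then (X ω).reward τ h else 0) = 0 :=
        sum_eq_zero fun τ hτ => if_neg fun h2 =>
          (filter_eq_empty_iff.1 (card_eq_zero.1 hN)) hτ h2
      obtain ⟨h2, h3⟩ := G.r_mem h x y a b
      rw [hN, h1, zero_div, zero_sub, abs_neg, abs_of_nonneg h2]
      refine h3.trans (Real.le_sqrt_of_sq_le ?_)
      norm_num
      linarith
    · set N := #{τ ∈ Icc 1 k | P j τ ω} with hNdef
      have hN1 : (1 : ℝ) ≤ N := by exact_mod_cast hN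
      have hNK : N ≤ K := (card_filter_le _ _).trans (by simpa using hk2)
      have hdev : ∀ σ, sgn σ * ((∑ τ ∈ Icc 1 k, if P j τ ω then (X ω).reward τ h else 0) -
          N * G.r h x y a b) < √(4 * L * N) := by
        intro σ
        have h1 := hc (j, ⟨N - 1, by omega⟩, σ) k hk2 (by simp only; omega)
        simp only [Nat.sub_add_cancel hN] at h1
        refine lt_of_eq_of_lt ?_ h1
        rw [hNdef, natCast_card_filter, sum_mul, ← sum_sub_distrib, mul_sum]
        refine sum_congr rfl fun τ _ => ?_
        by_cases h2 : P j τ ω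
        · simp only [if_pos h2, hρ τ h2]
          ring
        · simp only [if_neg h2]
          ring
      rw [max_eq_left hN1, Real.sqrt_div' _ (by linarith)]
      have h2 := hdev true
      have h3 := hdev false
      simp only [sgn, if_true, Bool.false_eq_true, if_false] at h2 h3
      have hN0 : (0 : ℝ) < N := by linarith
      have h4 : |(∑ τ ∈ Icc 1 k, if P j τ ω then (X ω).reward τ h else 0) -
          N * G.r h x y a b| ≤ √(4 * L * N) := abs_le.2 ⟨by linarith, by linarith⟩
      have h5 : (∑ τ ∈ Icc 1 k, if P j τ ω then (X ω).reward τ h else 0) / N - G.r h x y a b =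
          ((∑ τ ∈ Icc 1 k, if P j τ ω then (X ω).reward τ h else 0) -
            N * G.r h x y a b) / N := by
        field_simp
      rw [h5, abs_div, abs_of_pos hN0, div_le_div_iff₀ hN0 (Real.sqrt_pos.2 hN0)]
      rw [Real.sqrt_mul' _ hN0.le] at h4
      calc _ ≤ √(4 * L) * √N * √N := mul_le_mul_of_nonneg_right h4 (Real.sqrt_nonneg _)
        _ = _ := by rw [mul_assoc, Real.mul_self_sqrt hN0.le]
  calc _ ≤ Pr.real (⋃ i, E i) := measureReal_mono hsub
    _ ≤ ∑ i, Pr.real (E i) := measureReal_iUnion_fintype_le _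
    _ ≤ ∑ _i : J × Fin K × Bool, Real.exp (-(2 * L)) := sum_le_sum fun i _ => hEi i
    _ = 2 * M * Real.exp (-L) ^ 2 := by
        rw [sum_const, card_univ, nsmul_eq_mul, ← Real.exp_nat_mul]
        simp only [J, Fintype.card_prod, Fintype.card_fin, Fintype.card_bool, hM]
        push_cast
        rw [mul_neg]
        ring
    _ = δ * (2 * δ / M) := by
        rw [Real.exp_neg, hL, Real.exp_log (by positivity)]
        field_simp
    _ ≤ δ := mul_le_of_le_one_right hδ.le (div_le_one_of_le₀ (by linarith) (by linarith))

end IsPlay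

end Events

/-! ### Expected and realized bonuses -/

section Azuma

variable {H : ℕ} {S₁ S₂ A B : Type*} [Fintype S₁] [Fintype S₂] [Fintype A] [Fintype B]
  [DecidableEq S₁] [DecidableEq S₂] [DecidableEq A] [DecidableEq B]

/-- The bonus of an unvisited point, which is the largest bonus. -/
def maxBonus (H : ℕ) (S₁ S₂ A B : Type*) [Fintype S₁] [Fintype S₂] [Fintype A] [Fintype B]
    (δ : ℝ) (K : ℕ) : ℝ :=
  √(4 * Real.log ((Fintype.card S₁ : ℝ) * Fintype.card S₂ * Fintype.card A * Fintype.card B *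
      H * K / δ)) +
    (√(2 * (H : ℝ) ^ 2 * Fintype.card S₁ *
        Real.log (2 * (Fintype.card S₁ : ℝ) * Fintype.card A * H * K / δ)) +
      √(2 * (H : ℝ) ^ 2 * Fintype.card S₂ *
        Real.log (2 * (Fintype.card S₂ : ℝ) * Fintype.card B * H * K / δ)))

theorem sqrt_div_max_le (c : ℝ) (n : ℕ) : √(c / max (n : ℝ) 1) ≤ √c := by
  rw [Real.sqrt_div' _ (by positivity)]
  exact div_le_self (Real.sqrt_nonneg _) (Real.one_le_sqrt.2 (le_max_right _ _))

theorem fullBonus_le_maxBonus (δ : ℝ) (K : ℕ) (X : Transcript H S₁ S₂ A B) (k : ℕ) (h : Fin H)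
    (z : S₁ × S₂) (u : A × B) : fullBonus δ K X k h z u ≤ maxBonus H S₁ S₂ A B δ K :=
  add_le_add (sqrt_div_max_le _ _) (add_le_add (sqrt_div_max_le _ _) (sqrt_div_max_le _ _))

/-- The bonuses of the visited points of an episode, computed from the earlier episodes. -/
def episodeBonus (δ : ℝ) (K : ℕ) (X : Transcript H S₁ S₂ A B) (k : ℕ) : ℝ :=
  ∑ h : Fin H, fullBonus δ K X (k - 1) h (X.state k h.castSucc) (X.act k h)

/-- The expectation of `FactoredMG.episodeBonus` under the policies `μ` and `X.ν k`. -/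
def expectedBonus (G : Game H S₁ S₂ A B) (δ : ℝ) (K : ℕ) (X : Transcript H S₁ S₂ A B) (k : ℕ)
    (μ : Fin H → S₁ → A → ℝ) : ℝ :=
  total (point (G.init₁, G.init₂)) (jointPolicy μ (X.ν k)) (jointKernel G.P₁ G.P₂)
    (fullBonus δ K X (k - 1))

variable {Ω : Type*} {mΩ : MeasurableSpace Ω} {Pr : Measure Ω} [IsProbabilityMeasure Pr]
  {ℱ : Filtration ℕ mΩ} {G : Game H S₁ S₂ A B} {η δ : ℝ} {K : ℕ}
  {X : Ω → Transcript H S₁ S₂ A B}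

/-- Azuma's inequality over episodes. Working with whole episodes rather than single steps is what
gives the deviation the right dependence on the horizon. -/
theorem IsPlay.prob_expectedBonus_gt_le [Nonempty A] (hX : IsPlay Pr ℱ G η δ K X) (hH : 1 ≤ H)
    (hK : 1 ≤ K) {L : ℝ} (hL : 0 ≤ L) (hpos : 0 < maxBonus H S₁ S₂ A B δ K) :
    Pr.real {ω | H * maxBonus H S₁ S₂ A B δ K * √(2 * K * L) +
        ∑ k ∈ Icc 1 K, episodeBonus δ K (X ω) k ≤
      ∑ k ∈ Icc 1 K, expectedBonus G δ K (X ω) k (policy η δ K G.init₂ (X ω) k)} ≤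
        Real.exp (-L) := by
  have hH' : (1 : ℝ) ≤ H := by exact_mod_cast hH
  have hK' : (1 : ℝ) ≤ K := by exact_mod_cast hK
  set c : ℝ := H * maxBonus H S₁ S₂ A B δ K with hc
  have hcpos : 0 < c := mul_pos (by linarith) hpos
  have hβ : ∀ k ∈ Icc 1 K, ∀ (h : Fin H) (z : S₁ × S₂) (u : A × B),
      BddMeas (ℱ (2 * (k * H))) fun ω => fullBonus δ K (X ω) (k - 1) h z u := fun k hk h z u =>
    ⟨(hX.dataMeas_pred hk).fullBonus δ K h z u, maxBonus H S₁ S₂ A B δ K, fun ω => by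
      rw [abs_of_nonneg (fullBonus_nonneg h z u)]
      exact fullBonus_le_maxBonus δ K (X ω) (k - 1) h z u⟩
  have h1 := prob_sum_ge_le (Pr := Pr) (𝒢 := fun k => ℱ (2 * (k * H))) (fun k => ℱ.le _)
    (fun k l hkl => ℱ.mono (by gcongr)) (I := fun _ _ => 1)
    (v := fun k ω => -(1 / c) * episodeBonus δ K (X ω) k)
    (m := fun k ω => -(1 / c) * expectedBonus G δ K (X ω) k (policy η δ K G.init₂ (X ω) k))
    (K := K) (fun k _ => BddMeas.const 1) (fun k _ ω => Or.inr rfl)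
    (fun k hk => (hX.condMean_total hk (hβ k hk)).mul_left (ℱ.le _) (BddMeas.const (-(1 / c))))
    (fun k hk => ?_) (fun k hk ω => ?_) (fun k hk ω => ?_) (n := K) (by linarith)
    (Real.sqrt_nonneg (2 * K * L)) (by simp)
  · rw [Real.sq_sqrt (by positivity), mul_div_cancel_left₀ _ (by positivity)] at h1
    refine (measureReal_mono fun ω hω => ?_).trans h1
    simp only [Set.mem_ofPred_eq, one_mul, sum_sub_distrib, ← mul_sum] at hω ⊢
    rw [neg_mul, neg_mul, sub_neg_eq_add, neg_add_eq_sub, ← mul_sub, one_div, inv_mul_eq_div,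
      le_div_iff₀ hcpos]
    linarith
  · have hk2 : ℱ (2 * (k * H)) ≤ ℱ (2 * ((k + 1) * H)) :=
      ℱ.mono (by gcongr; omega)
    have hm : BddMeas (ℱ (2 * ((k + 1) * H))) fun ω => ∑ h : Fin H, ∑ z, ∑ u,
        (if (X ω).state k h.castSucc = z then 1 else 0) * (if (X ω).act k h = u then 1 else 0) *
          fullBonus δ K (X ω) (k - 1) h z u := by
      refine BddMeas.sum fun h _ => BddMeas.sum fun z _ => BddMeas.sum fun u _ => ?_
      refine ((BddMeas.ite ?_).mul (BddMeas.ite ?_)).mul ((hβ k hk h z u).mono hk2)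
      · exact ℱ.mono (by have := h.is_lt; rw [add_one_mul, Fin.val_castSucc]; omega) _
          (hX.measurableSet_state hk h.castSucc z)
      · exact ℱ.mono (by have := h.is_lt; rw [add_one_mul]; omega) _
          (hX.measurableSet_act hk h u)
    have heq : (fun ω => episodeBonus δ K (X ω) k) = fun ω => ∑ h : Fin H, ∑ z, ∑ u,
        (if (X ω).state k h.castSucc = z then 1 else 0) * (if (X ω).act k h = u then 1 else 0) *
          fullBonus δ K (X ω) (k - 1) h z u := by
      funext ω
      simp [episodeBonus]
    rw [← heq] at hm
    exact hm.meas.const_mul _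
  · have h2 : 0 ≤ episodeBonus δ K (X ω) k := sum_nonneg fun h _ => fullBonus_nonneg _ _ _
    have h3 : episodeBonus δ K (X ω) k ≤ c :=
      (sum_le_card_nsmul univ _ _ fun h _ => fullBonus_le_maxBonus δ K (X ω) (k - 1) h _ _).trans_eq
        (by rw [card_fin, nsmul_eq_mul])
    rw [neg_mul, abs_neg, one_div, inv_mul_eq_div, abs_of_nonneg (by positivity)]
    exact div_le_one_of_le₀ h3 hcpos.le
  · have hπ := (isPolicy_policy η δ K G.init₂ (X ω) k).joint
      (hX.ν_policy k (mem_Icc.1 hk).2 ω)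
    have h2 : 0 ≤ expectedBonus G δ K (X ω) k (policy η δ K G.init₂ (X ω) k) :=
      total_nonneg (point_mem _).1 hπ (isSubkernel_joint_game G) fun h z u => fullBonus_nonneg h z u
    have h3 : expectedBonus G δ K (X ω) k (policy η δ K G.init₂ (X ω) k) ≤ c :=
      total_le (point_mem _) hπ (isSubkernel_joint_game G) hpos.le fun h z u =>
        fullBonus_le_maxBonus δ K (X ω) (k - 1) h z u
    rw [neg_mul, abs_neg, one_div, inv_mul_eq_div, abs_of_nonneg (by positivity)]
    exact div_le_one_of_le₀ h3 hcpos.le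

end Azuma

/-! ### Collecting the terms -/

/-- The form of all comparisons with the leading terms: both sides are squared. -/
theorem mul_sqrt_mul_sqrt_le {H u v Λ y : ℝ} (hu : 0 ≤ u) (hv : 0 ≤ v) (hΛ : 0 ≤ Λ)
    (h : H ^ 2 * (u * v) ≤ Λ ^ 2 * y) : H * (√u * √v) ≤ Λ * √y := by
  have h1 : (H * (√u * √v)) ^ 2 ≤ Λ ^ 2 * y := by
    rwa [mul_pow, mul_pow, Real.sq_sqrt hu, Real.sq_sqrt hv]
  calc H * (√u * √v) ≤ √(Λ ^ 2 * y) := Real.le_sqrt_of_sq_le h1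
    _ = Λ * √y := by rw [Real.sqrt_mul (by positivity), Real.sqrt_sq hΛ]

set_option maxHeartbeats 400000 in
/-- All terms of the regret are of order `(1 + L) * (C * √T)`; the leading ones of Player 1, of
Player 2 and of the rewards are `P`, `Q` and `R` below. -/
theorem collected_terms_le {H K s₁ s₂ a b L l l₁ l₂ : ℝ} (hH : 1 ≤ H) (hK : 1 ≤ K) (hs₁ : 1 ≤ s₁)
    (hs₂ : 1 ≤ s₂) (ha : 1 ≤ a) (hb : 1 ≤ b) (hL : 0 ≤ L) (hl : 0 ≤ l) (hl₁ : 0 ≤ l₁)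
    (hl₂ : 0 ≤ l₂) (hlL : l ≤ 1 + L) (hl₁L : l₁ ≤ 1 + L) (hl₂L : l₂ ≤ 1 + L) :
    H * (2 * H * √(K * l) + H) +
      3 * (H * (√(4 * L) + (√(2 * H ^ 2 * s₁ * l₁) + √(2 * H ^ 2 * s₂ * l₂))) * √(2 * K * L) +
        H * (3 * √(4 * L) * √(s₁ * s₂ * a * b * K) +
          (3 * √(2 * H ^ 2 * s₁ * l₁) * √(s₁ * a * K) +
            3 * √(2 * H ^ 2 * s₂ * l₂) * √(s₂ * b * K)))) ≤
      51 * (1 + L) ^ 1 * ((√((s₁ ^ 2 * a + s₂ ^ 2 * b) * H ^ 3) + √(s₁ * s₂ * a * b * H)) *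
        √(K * H)) := by
  set Λ := 1 + L with hΛ
  have hΛ1 : 1 ≤ Λ := by linarith
  have hΛ0 : 0 ≤ Λ := by linarith
  have hΛΛ : Λ ≤ Λ ^ 2 := by nlinarith
  have hLΛ : L ≤ Λ := by linarith
  have hLΛ2 : L ≤ Λ ^ 2 := by linarith
  have hs₁2 : 1 ≤ s₁ ^ 2 := one_le_pow₀ hs₁
  have hs₂2 : 1 ≤ s₂ ^ 2 := one_le_pow₀ hs₂
  have hs₁a : 1 ≤ s₁ ^ 2 * a := one_le_mul_of_one_le_of_one_le hs₁2 ha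
  have hM : 1 ≤ s₁ * s₂ * a * b := one_le_mul_of_one_le_of_one_le
    (one_le_mul_of_one_le_of_one_le (one_le_mul_of_one_le_of_one_le hs₁ hs₂) ha) hb
  have hs₁le : s₁ ≤ s₁ ^ 2 * a := by nlinarith
  have hs₂le : s₂ ≤ s₂ ^ 2 * b := by nlinarith
  set P := √(s₁ ^ 2 * a * (H ^ 4 * K)) with hP
  set Q := √(s₂ ^ 2 * b * (H ^ 4 * K)) with hQ
  set R := √(s₁ * s₂ * a * b * (H ^ 2 * K)) with hR
  have t1 : H * (√(H ^ 2) * √(K * l)) ≤ Λ * P := by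
    refine mul_sqrt_mul_sqrt_le (by positivity) (by positivity) hΛ0 ?_
    calc H ^ 2 * (H ^ 2 * (K * l)) = l * 1 * (H ^ 4 * K) := by ring
      _ ≤ Λ ^ 2 * (s₁ ^ 2 * a) * (H ^ 4 * K) := by
          have : l ≤ Λ ^ 2 := by linarith
          gcongr
      _ = _ := by ring
  have t2 : H * (√(H ^ 2) * √1) ≤ Λ * P := by
    refine mul_sqrt_mul_sqrt_le (by positivity) (by positivity) hΛ0 ?_
    calc H ^ 2 * (H ^ 2 * 1) = 1 * 1 * (H ^ 4 * 1) := by ring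
      _ ≤ Λ ^ 2 * (s₁ ^ 2 * a) * (H ^ 4 * K) := by
          have : 1 ≤ Λ ^ 2 := by linarith
          gcongr
      _ = _ := by ring
  have t3 : H * (√(4 * L) * √(s₁ * s₂ * a * b * K)) ≤ (2 * Λ) * R := by
    refine mul_sqrt_mul_sqrt_le (by positivity) (by positivity) (by positivity) ?_
    calc H ^ 2 * (4 * L * (s₁ * s₂ * a * b * K)) = L * (4 * (s₁ * s₂ * a * b * (H ^ 2 * K))) := by
          ring
      _ ≤ Λ ^ 2 * (4 * (s₁ * s₂ * a * b * (H ^ 2 * K))) := by gcongr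
      _ = _ := by ring
  have t4 : H * (√(2 * H ^ 2 * s₁ * l₁) * √(s₁ * a * K)) ≤ (2 * Λ) * P := by
    refine mul_sqrt_mul_sqrt_le (by positivity) (by positivity) (by positivity) ?_
    calc H ^ 2 * (2 * H ^ 2 * s₁ * l₁ * (s₁ * a * K)) = l₁ * (2 * (s₁ ^ 2 * a * (H ^ 4 * K))) := by
          ring
      _ ≤ Λ ^ 2 * (4 * (s₁ ^ 2 * a * (H ^ 4 * K))) := by
          have : l₁ ≤ Λ ^ 2 := by linarith
          gcongr
          norm_num
      _ = _ := by ring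
  have t5 : H * (√(2 * H ^ 2 * s₂ * l₂) * √(s₂ * b * K)) ≤ (2 * Λ) * Q := by
    refine mul_sqrt_mul_sqrt_le (by positivity) (by positivity) (by positivity) ?_
    calc H ^ 2 * (2 * H ^ 2 * s₂ * l₂ * (s₂ * b * K)) = l₂ * (2 * (s₂ ^ 2 * b * (H ^ 4 * K))) := by
          ring
      _ ≤ Λ ^ 2 * (4 * (s₂ ^ 2 * b * (H ^ 4 * K))) := by
          have : l₂ ≤ Λ ^ 2 := by linarith
          gcongr
          norm_num
      _ = _ := by ring
  have t6 : H * (√(4 * L) * √(2 * K * L)) ≤ (3 * Λ) * R := by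
    refine mul_sqrt_mul_sqrt_le (by positivity) (by positivity) (by positivity) ?_
    calc H ^ 2 * (4 * L * (2 * K * L)) = L ^ 2 * (8 * (1 * (H ^ 2 * K))) := by ring
      _ ≤ Λ ^ 2 * (9 * (s₁ * s₂ * a * b * (H ^ 2 * K))) := by
          gcongr
          norm_num
      _ = _ := by ring
  have t7 : H * (√(2 * H ^ 2 * s₁ * l₁) * √(2 * K * L)) ≤ (2 * Λ) * P := by
    refine mul_sqrt_mul_sqrt_le (by positivity) (by positivity) (by positivity) ?_
    calc H ^ 2 * (2 * H ^ 2 * s₁ * l₁ * (2 * K * L)) = l₁ * L * (4 * (s₁ * (H ^ 4 * K))) := by ring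
      _ ≤ Λ * Λ * (4 * (s₁ ^ 2 * a * (H ^ 4 * K))) := by gcongr
      _ = _ := by ring
  have t8 : H * (√(2 * H ^ 2 * s₂ * l₂) * √(2 * K * L)) ≤ (2 * Λ) * Q := by
    refine mul_sqrt_mul_sqrt_le (by positivity) (by positivity) (by positivity) ?_
    calc H ^ 2 * (2 * H ^ 2 * s₂ * l₂ * (2 * K * L)) = l₂ * L * (4 * (s₂ * (H ^ 4 * K))) := by ring
      _ ≤ Λ * Λ * (4 * (s₂ ^ 2 * b * (H ^ 4 * K))) := by gcongr
      _ = _ := by ring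
  rw [Real.sqrt_sq (by linarith)] at t1 t2
  rw [Real.sqrt_one] at t2
  have hW : √((s₁ ^ 2 * a + s₂ ^ 2 * b) * H ^ 3) * √(K * H) =
      √((s₁ ^ 2 * a + s₂ ^ 2 * b) * (H ^ 4 * K)) := by
    rw [← Real.sqrt_mul (by positivity)]
    congr 1
    ring
  have hR' : √(s₁ * s₂ * a * b * H) * √(K * H) = R := by
    rw [← Real.sqrt_mul (by positivity)]
    congr 1
    ring
  rw [pow_one, add_mul, hW, hR']
  set W := √((s₁ ^ 2 * a + s₂ ^ 2 * b) * (H ^ 4 * K)) with hWdef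
  have hPW : P ≤ W := Real.sqrt_le_sqrt (by gcongr; nlinarith)
  have hQW : Q ≤ W := Real.sqrt_le_sqrt (by gcongr; nlinarith)
  have hR0 : 0 ≤ Λ * R := by positivity
  have h1 := mul_le_mul_of_nonneg_left hPW hΛ0
  have h2 := mul_le_mul_of_nonneg_left hQW hΛ0
  linarith

end FactoredMG

end

/-- There are universal constants `c` and `p` (the constants hidden by the soft-O) such that, in
every game and against every Player 2, the regret bound holds with probability `1 - 4 δ`. -/
theorem theorem1 :
    ∃ (c : ℝ) (p : ℕ), 0 < c ∧
      ∀ (H K : ℕ) (_ : 1 ≤ H) (_ : 1 ≤ K)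
        (S₁ S₂ A B : Type*) [Fintype S₁] [Fintype S₂] [Fintype A] [Fintype B]
        [DecidableEq S₁] [DecidableEq S₂] [DecidableEq A] [DecidableEq B]
        (G : Game H S₁ S₂ A B) (δ : ℝ) (_ : 0 < δ) (_ : δ < 1) (η : ℝ)
        (_ : η = √(Real.log (Fintype.card A) / (K * (H : ℝ) ^ 2)))
        (Ω : Type*) (mΩ : MeasurableSpace Ω) (Pr : Measure Ω) [IsProbabilityMeasure Pr]
        (ℱ : Filtration ℕ mΩ) (X : Ω → Transcript H S₁ S₂ A B)
        (_ : IsPlay Pr ℱ G η δ K X) (T C : ℝ) (_ : T = K * H)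
        (_ : C = √(((Fintype.card S₁ : ℝ) ^ 2 * Fintype.card A +
              (Fintype.card S₂ : ℝ) ^ 2 * Fintype.card B) * (H : ℝ) ^ 3) +
            √((Fintype.card S₁ : ℝ) * Fintype.card S₂ * Fintype.card A * Fintype.card B * H)),
        1 - 4 * δ ≤ Pr.real {ω |
          regret G K (policy η δ K G.init₂ (X ω)) (X ω).ν ≤
            c * (1 + Real.log ((Fintype.card S₁ : ℝ) * Fintype.card S₂ * Fintype.card A *
                Fintype.card B * H * K / δ)) ^ p * (C * √T)} := by
  refine ⟨51, 1, by norm_num, ?_⟩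
  intro H K hH hK S₁ S₂ A B _ _ _ _ _ _ _ _ G δ hδ hδ1 η hη Ω mΩ Pr _ ℱ X hX T C hT hC
  -- For `δ ≥ 1 / 4` nothing is claimed; below, the logarithms are at least `log 4`, which makes
  -- the bonuses of unvisited points large enough.
  rcases le_or_gt (1 / 4) δ with hδ4 | hδ4
  · exact (by linarith : 1 - 4 * δ ≤ 0).trans measureReal_nonneg
  obtain ⟨ω₀⟩ : Nonempty Ω := nonempty_of_isProbabilityMeasure Pr
  have : Nonempty S₁ := ⟨G.init₁⟩
  have : Nonempty S₂ := ⟨G.init₂⟩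
  have : Nonempty A := ⟨(X ω₀).a 1 ⟨0, hH⟩⟩
  have : Nonempty B := ⟨(X ω₀).b 1 ⟨0, hH⟩⟩
  have hs₁ : (1 : ℝ) ≤ Fintype.card S₁ := by exact_mod_cast Fintype.card_pos
  have hs₂ : (1 : ℝ) ≤ Fintype.card S₂ := by exact_mod_cast Fintype.card_pos
  have ha : (1 : ℝ) ≤ Fintype.card A := by exact_mod_cast Fintype.card_pos
  have hb : (1 : ℝ) ≤ Fintype.card B := by exact_mod_cast Fintype.card_pos
  have hH' : (1 : ℝ) ≤ H := by exact_mod_cast hH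
  have hK' : (1 : ℝ) ≤ K := by exact_mod_cast hK
  set M : ℝ := (Fintype.card S₁ : ℝ) * Fintype.card S₂ * Fintype.card A * Fintype.card B * H * K
    with hM
  set L := Real.log (M / δ) with hL
  have hA : (1 : ℝ) ≤ Fintype.card S₁ * Fintype.card S₂ * Fintype.card B * H * K := by
    refine one_le_mul_of_one_le_of_one_le (one_le_mul_of_one_le_of_one_le
      (one_le_mul_of_one_le_of_one_le (one_le_mul_of_one_le_of_one_le ?_ ?_) ?_) ?_) ?_ <;>
      assumption
  have hS₂B : (1 : ℝ) ≤ Fintype.card S₂ * Fintype.card B :=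
    one_le_mul_of_one_le_of_one_le hs₂ hb
  have hS₁A : (1 : ℝ) ≤ Fintype.card S₁ * Fintype.card A :=
    one_le_mul_of_one_le_of_one_le hs₁ ha
  have hMA : (Fintype.card A : ℝ) ≤ M := by
    calc (Fintype.card A : ℝ) ≤
        Fintype.card A * (Fintype.card S₁ * Fintype.card S₂ * Fintype.card B * H * K) :=
          le_mul_of_one_le_right (by linarith) hA
      _ = M := by rw [hM]; ring
  have hM0 : 0 < M := by linarith
  have hMδ : M ≤ M / δ := le_div_self hM0.le hδ hδ1.le
  have hlog_two : Real.log 2 ≤ 1 := by have := Real.log_two_lt_d9; linarith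
  have hL0 : 0 < L := Real.log_pos (by rw [lt_div_iff₀ hδ]; linarith)
  have hlA : Real.log (Fintype.card A) ≤ 1 + L := by
    have : Real.log (Fintype.card A) ≤ L := Real.log_le_log (by linarith) (hMA.trans hMδ)
    linarith
  have hlog_le : ∀ n : ℝ, 1 ≤ n → n ≤ M → 0 ≤ Real.log (2 * n / δ) ∧
      Real.log (2 * n / δ) ≤ 1 + L := by
    intro n hn hnM
    refine ⟨Real.log_nonneg ((one_le_div hδ).2 (by linarith)), ?_⟩
    rw [mul_div_assoc, Real.log_mul two_ne_zero (by positivity)]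
    exact add_le_add hlog_two (Real.log_le_log (by positivity) (by gcongr))
  have hHK : (1 : ℝ) ≤ H * K := one_le_mul_of_one_le_of_one_le hH' hK'
  obtain ⟨hl₁0, hl₁⟩ := hlog_le (Fintype.card S₁ * Fintype.card A * H * K)
    (by rw [mul_assoc]; exact one_le_mul_of_one_le_of_one_le hS₁A hHK) (by
      calc (Fintype.card S₁ * Fintype.card A * H * K : ℝ) ≤
          Fintype.card S₁ * Fintype.card A * H * K * (Fintype.card S₂ * Fintype.card B) :=
            le_mul_of_one_le_right (by positivity) hS₂B
        _ = M := by rw [hM]; ring)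
  obtain ⟨hl₂0, hl₂⟩ := hlog_le (Fintype.card S₂ * Fintype.card B * H * K)
    (by rw [mul_assoc]; exact one_le_mul_of_one_le_of_one_le hS₂B hHK) (by
      calc (Fintype.card S₂ * Fintype.card B * H * K : ℝ) ≤
          Fintype.card S₂ * Fintype.card B * H * K * (Fintype.card S₁ * Fintype.card A) :=
            le_mul_of_one_le_right (by positivity) hS₁A
        _ = M := by rw [hM]; ring)
  simp only [← mul_assoc] at hl₁0 hl₁ hl₂0 hl₂
  have hmax : 0 < maxBonus H S₁ S₂ A B δ K :=
    add_pos_of_pos_of_nonneg (Real.sqrt_pos.2 (mul_pos four_pos hL0))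
      (add_nonneg (Real.sqrt_nonneg _) (Real.sqrt_nonneg _))
  have h1 := hX.prob_reward_inaccurate_le hH hK hδ (by linarith)
  have h2 := hX.prob_trans₁_inaccurate_le hH hK hδ hδ1.le
  have h3 := hX.prob_trans₂_inaccurate_le hH hK hδ hδ1.le
  have h4 := hX.prob_expectedBonus_gt_le hH hK hL0.le hmax
  have h5 : Real.exp (-L) ≤ δ := by
    rw [Real.exp_neg, hL, Real.exp_log (by positivity), inv_div]
    exact div_le_self hδ.le (by linarith)
  set E₁ := {ω | ¬ ∀ k ∈ Icc 1 K, ∀ h x y a b,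
      |rHat (X ω) k h x y a b - G.r h x y a b| ≤ bonusR δ K (X ω) k h x y a b}
  set E₂ := {ω | ¬ ∀ k ∈ Icc 1 K, ∀ h x a,
      H * ∑ x', |pHat₁ (X ω) k h x a x' - G.P₁ h x a x'| ≤ bonus₁ δ K (X ω) k h x a}
  set E₃ := {ω | ¬ ∀ k ∈ Icc 1 K, ∀ h y b,
      H * ∑ y', |pHat₂ (X ω) k h y b y' - G.P₂ h y b y'| ≤ bonus₂ δ K (X ω) k h y b}
  set E₄ := {ω | H * maxBonus H S₁ S₂ A B δ K * √(2 * K * L) +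
        ∑ k ∈ Icc 1 K, episodeBonus δ K (X ω) k ≤
      ∑ k ∈ Icc 1 K, expectedBonus G δ K (X ω) k (policy η δ K G.init₂ (X ω) k)}
  set E := {ω | regret G K (policy η δ K G.init₂ (X ω)) (X ω).ν ≤
    51 * (1 + L) ^ 1 * (C * √T)} with hE
  have hcover : (Set.univ : Set Ω) ⊆ E ∪ (E₁ ∪ (E₂ ∪ (E₃ ∪ E₄))) := by
    intro ω _
    by_contra hω
    simp only [Set.mem_union, not_or] at hω
    obtain ⟨hωE, hω₁, hω₂, hω₃, hω₄⟩ := hω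
    have hω₁ := not_not.1 hω₁
    have hω₂ := not_not.1 hω₂
    have hω₃ := not_not.1 hω₃
    simp only [E₄, Set.mem_ofPred_eq, not_le] at hω₄
    refine hωE ?_
    have hreg := regret_le_of_accurate (G := G) (X := X ω) hH hK hη rfl hL0.le hl₁0 hl₂0
      (fun k hk => hX.ν_policy k hk ω) fun k hk => ⟨hω₁ k hk, hω₂ k hk, hω₃ k hk⟩
    have hsum := sum_fullBonus_le δ K (X ω)
    have hcollect := collected_terms_le hH' hK' hs₁ hs₂ ha hb hL0.le
      (Real.log_nonneg ha) hl₁0 hl₂0 hlA hl₁ hl₂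
    rw [hE, Set.mem_ofPred_eq, hT, hC]
    refine (hreg.trans (add_le_add_right (mul_le_mul_of_nonneg_left
      (hω₄.le.trans (add_le_add_right hsum _)) (by norm_num)) _)).trans ?_
    exact hcollect
  have h6 : 1 ≤ Pr.real E + (Pr.real E₁ + (Pr.real E₂ + (Pr.real E₃ + Pr.real E₄))) := by
    calc (1 : ℝ) = Pr.real Set.univ := probReal_univ.symm
      _ ≤ Pr.real (E ∪ (E₁ ∪ (E₂ ∪ (E₃ ∪ E₄)))) := measureReal_mono hcover
      _ ≤ _ := (measureReal_union_le _ _).trans (add_le_add_right ((measureReal_union_le _ _).trans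
          (add_le_add_right ((measureReal_union_le _ _).trans
            (add_le_add_right (measureReal_union_le _ _) _)) _)) _)
  linarith
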